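/- **Setting.** Let $\mathbb X$ be a non-empty compact metric space with a finite Borel measure $\mu$, let $T\in\mathbb R$, and let $\tau:\mathbb X\to[0,\infty)$ be continuous. Let $\mathbb S=C(\mathbb X)$ with its Borel $\sigma$-algebra, and let $\mathbb M$ be the set of Gaussian measures on $\mathbb S$, with the $\sigma$-algebra generated by the maps $\nu\mapsto\nu(A)$; $m_\nu,k_\nu$ are the mean and covariance functions of $\nu\in\mathbb M$, and $\nu_n\to\nu_\infty$ means $m_{\nu_n}\to m_{\nu_\infty}$ and $k_{\nu_n}\to k_{\nu_\infty}$ uniformly. On $(\Omega,\mathcal F,\mathsf P)$ let $\xi$ be a Gaussian process on $\mathbb X$ with continuous paths and $(U_n)_{n\ge1}$ i.i.d. $\mathcal N(0,1)$ variables independent of $\xi$. For $\mathbb X$-valued $X_1,X_2,\dots$ put $Z_n=\xi(X_n)+\tau(X_n)U_n$, $\mathcal F_n=\sigma(X_1,Z_1,\dots,X_n,Z_n)$, $\mathcal F_\infty=\bigvee_n\mathcal F_n$; $(X_n)$ is a *sequential design* if each $X_{n}$ is $\mathcal F_{n-1}$-measurable. For $\nu\in\mathbb M$, let $s_\nu^2(x)=k_\nu(x,x)+\tau(x)^2$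 and let $\mathrm{Cond}_{x,z}(\nu)\in\mathbb M$ be the Gaussian measure with mean $m_\nu+k_\nu(\cdot,x)s_\nu^{-2}(x)(z-m_\nu(x))$ and covariance $k_\nu-k_\nu(\cdot,x)s_\nu^{-2}(x)k_\nu(x,\cdot)$ (equal to $\nu$ if $s_\nu^2(x)=0$). Put $\mathsf P_0^\xi=$ law of $\xi$ and $\mathsf P_{n+1}^\xi=\mathrm{Cond}_{X_{n+1},Z_{n+1}}(\mathsf P_n^\xi)$; this is the conditional distribution of $\xi$ given $\mathcal F_n$. $\mathrm{Var}_n$ is the conditional variance given $\mathcal F_n$. For a loss $L:\mathbb S\times\mathbb D\to[0,\infty)$ let $\overline L_\nu(d)=\int L(f,d)\,\nu(df)$ and $$\mathcal H(\nu)=\inf_{d}\overline L_\nu(d),\quad \mathcal J_x(\nu)=\iint\mathcal H\big(\mathrm{Cond}_{x,f(x)+u\tau(x)}(\nu)\big)\,\nu(df)\,\mathcal N(0,1)(du),\quad \mathcal G(\nu)=\sup_{x}\big(\mathcal H(\nu)-\mathcal J_x(\nu)\big).$$ For a positive sequence $\varepsilon$, a sequential design is *$\varepsilon$-quasi-SUR*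 for $\mathcal H$ if for some $n_0$, for all $n\ge n_0$, a.s. $\mathcal J_{X_{n+1}}(\mathsf P_n^\xi)\le\inf_x\mathcal J_x(\mathsf P_n^\xi)+\varepsilon_n$; it is *quasi-SUR* if this holds for some positive $\varepsilon$ with $\varepsilon_n\to0$. For a Gaussian random element $\zeta$ of $\mathbb S$ (on any probability space), let $\mathfrak P(\zeta)$ be the set of random elements of $\mathbb M$ that are conditional distributions of $\zeta$ given some sub-$\sigma$-algebra. A measurable $\mathcal H_1:\mathbb M\to\mathbb R$ is *$\mathfrak P$-uniformly integrable* if $(\mathcal H_1(\boldsymbol\nu))_{\boldsymbol\nu\in\mathfrak P(\zeta)}$ is uniformly integrable for every $\zeta$, and *$\mathfrak P$-continuous* if, for every $\zeta$, $\mathcal H_1(\boldsymbol\nu_n)\to\mathcal H_1(\boldsymbol\nu_\infty)$ a.s. whenever $\boldsymbol\nu_n,\boldsymbol\nu_\infty\in\mathfrak P(\zeta)$ and $\boldsymbol\nu_n\to\boldsymbol\nu_\infty$ a.s. A functional has the *supermartingale property* if its values at $\mathsf P_n^\xi$ form an $(\mathcal F_n)$-supermartingale for every such $\xi$, $(U_n)$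 and every sequential design. The loss $L$ is *regular* if: $\mathbb D$ is separable; $L(\cdot,d)$ is measurable for all $d$; $\overline L_\nu$ is finite and continuous on $\mathbb D$ for all $\nu\in\mathbb M$; $\mathcal H=\mathcal H_0+\mathcal H_1$ with $\mathcal H_0(\nu)=\int L_0\,d\nu$, $L_0\in\bigcap_{\nu\in\mathbb M}\mathcal L^1(\nu)$, and $\mathcal H_1$ measurable, $\mathfrak P$-uniformly integrable and $\mathfrak P$-continuous; and $\{\mathcal H=0\}=\{\mathcal G=0\}$. **Theorem.** Let $\alpha(f)=\mu\{x:f(x)\ge T\}$, and $L(f,d)=(\alpha(f)-d)^2$ for $d\in\mathbb D=\mathbb R$. Then $L$ is regular, and the induced functional is $\mathcal H(\nu)=\mathrm{Var}_\nu(\alpha)$, so that $\mathcal H(\mathsf P_n^\xi)=\mathrm{Var}_n(\alpha(\xi))$ a.s. for every sequential design. Moreover: 1. $\mathcal H$ is measurable and has the supermartingale property, and a decomposition $\mathcal H=\mathcal H_0+\mathcal H_1$ as above exists in which $\mathcal H_1$ has it too; 2. for every sequence $\varepsilon$ of positive reals there is an $\varepsilon$-quasi-SUR sequential design for $\mathcal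 H$; 3. for every sequential design there is an $\mathcal F_\infty$-measurable random element $\mathsf P_\infty^\xi$ of $\mathbb M$ that is a conditional distribution of $\xi$ given $\mathcal F_\infty$ and satisfies $\mathcal H(\mathsf P_n^\xi)\to\mathcal H(\mathsf P_\infty^\xi)$ a.s.; if the design is quasi-SUR for $\mathcal H$, then also $\mathcal G(\mathsf P_n^\xi)\to\mathcal G(\mathsf P_\infty^\xi)=0$ a.s.; 4. for every quasi-SUR sequential design for $\mathcal H$, $\mathcal H(\mathsf P_n^\xi)=\mathrm{Var}_n(\alpha(\xi))\to0$ almost surely. -/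

import Mathlib

open MeasureTheory ProbabilityTheory Filter Topology TopologicalSpace
open scoped ENNReal NNReal

universe u v w

namespace SUR

set_option maxHeartbeats 800000 in
theorem gaussianLaw_of_tendsto {Ω : Type*} [MeasurableSpace Ω] {P : Measure Ω}
    [IsProbabilityMeasure P] {Y : ℕ → Ω → ℝ} {Z : Ω → ℝ} (hYm : ∀ n, Measurable (Y n))
    (hY : ∀ n, HasGaussianLaw (Y n) P)
    (hlim : ∀ ω, Tendsto (fun n => Y n ω) atTop (𝓝 (Z ω))) : HasGaussianLaw Z P := by
  have hZm : Measurable Z := measurable_of_tendsto_metrizable hYm (tendsto_pi_nhds.2 hlim)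
  set m : ℕ → ℝ := fun n => P[Y n] with hm
  set v : ℕ → ℝ := fun n => Var[Y n; P] with hv
  have hv0 : ∀ n, 0 ≤ v n := fun n => variance_nonneg _ _
  have hcf : ∀ n (t : ℝ), charFun (P.map (Y n)) t
      = Complex.exp (t * m n * Complex.I - v n * t ^ 2 / 2) := by
    intro n t
    rw [(hY n).map_eq_gaussianReal, charFun_gaussianReal]
    simp [hm, hv]
  have hconv : ∀ t : ℝ, Tendsto (fun n => charFun (P.map (Y n)) t) atTop
      (𝓝 (charFun (P.map Z) t)) := by
    intro t
    simp only [charFun_apply_real]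
    have e : ∀ W : Ω → ℝ, Measurable W → ∫ x, Complex.exp (t * x * Complex.I) ∂(P.map W)
        = ∫ ω, Complex.exp (t * W ω * Complex.I) ∂P := fun W hW =>
      integral_map hW.aemeasurable (by fun_prop)
    simp only [e _ (hYm _), e _ hZm]
    refine tendsto_integral_of_dominated_convergence (fun _ => 1) (fun n => ?_)
      (integrable_const _) (fun n => ae_of_all _ fun ω => ?_) (ae_of_all _ fun ω => ?_)
    · have := hYm n
      fun_prop
    · rw [← Complex.ofReal_mul, Complex.norm_exp_ofReal_mul_I]
    · have : Continuous fun y : ℝ => Complex.exp (t * y * Complex.I) := by fun_prop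
      exact (this.tendsto _).comp (hlim ω)
  have hprobZ : IsProbabilityMeasure (P.map Z) := Measure.isProbabilityMeasure_map hZm.aemeasurable
  -- the variances are eventually bounded
  obtain ⟨V, hV⟩ : ∃ V : ℝ, ∀ᶠ n in atTop, v n ≤ V := by
    have hc : Continuous (charFun (P.map Z)) := continuous_charFun
    have h0 : ∀ᶠ t in 𝓝 (0 : ℝ), 1 / 2 < ‖charFun (P.map Z) t‖ := by
      refine (hc.norm.tendsto 0).eventually (lt_mem_nhds ?_)
      simp [charFun_zero]; norm_num
    have h1 : ∀ᶠ t in 𝓝[≠] (0 : ℝ), 1 / 2 < ‖charFun (P.map Z) t‖ := h0.filter_mono nhdsWithin_le_nhds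
    obtain ⟨t, ht, ht0⟩ := (h1.and eventually_mem_nhdsWithin).exists
    have ht0 : t ≠ 0 := ht0
    refine ⟨2 * Real.log 2 / t ^ 2, ?_⟩
    filter_upwards [(hconv t).norm.eventually (lt_mem_nhds ht)] with n hn
    rw [hcf, Complex.norm_exp] at hn
    have hre : ((t * m n * Complex.I - v n * t ^ 2 / 2 : ℂ)).re = - (v n * t ^ 2 / 2) := by
      have : (t * m n * Complex.I - v n * t ^ 2 / 2 : ℂ)
        = ((t * m n : ℝ) : ℂ) * Complex.I - ((v n * t ^ 2 / 2 : ℝ) : ℂ) := by push_cast; ring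
      rw [this, Complex.sub_re, Complex.ofReal_re, Complex.re_ofReal_mul]; simp
    rw [hre] at hn
    have := Real.log_lt_log (by norm_num) hn
    rw [Real.log_exp, one_div, Real.log_inv] at this
    rw [le_div_iff₀ (by positivity)]
    linarith
  -- the means are eventually bounded
  obtain ⟨M, hM⟩ : ∃ M : ℝ, ∀ᶠ n in atTop, |m n| ≤ M := by
    obtain ⟨K, hK⟩ : ∃ K : ℕ, P {ω | (K : ℝ) ≤ |Z ω|} < 1 / 4 := by
      have : Tendsto (fun K : ℕ => P {ω | (K : ℝ) ≤ |Z ω|}) atTop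
          (𝓝 (P (⋂ K : ℕ, {ω | (K : ℝ) ≤ |Z ω|}))) := by
        refine tendsto_measure_iInter_atTop (fun K => ?_) (fun a b hab ω h => ?_)
          ⟨0, measure_ne_top _ _⟩
        · exact (measurableSet_le measurable_const hZm.abs).nullMeasurableSet
        · exact le_trans (by exact_mod_cast hab) (show (b : ℝ) ≤ |Z ω| from h)
      have he : (⋂ K : ℕ, {ω | (K : ℝ) ≤ |Z ω|}) = ∅ := by
        ext ω
        simp only [Set.mem_iInter, Set.mem_ofPred_eq, Set.mem_empty_iff_false, iff_false, not_forall,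
          not_le]
        exact exists_nat_gt _
      rw [he, measure_empty] at this
      exact (this.eventually (gt_mem_nhds (by norm_num))).exists
    have hmeas := tendstoInMeasure_of_tendsto_ae (μ := P)
      (fun n => (hYm n).aestronglyMeasurable) (ae_of_all _ hlim) 1 one_pos
    set R : ℝ := 2 * (|V| + 1) with hR
    have hR1 : 1 ≤ R := by have := abs_nonneg V; linarith
    refine ⟨R + 1 + K, ?_⟩
    filter_upwards [hV, hmeas.eventually (gt_mem_nhds (show (0 : ℝ≥0∞) < 1 / 4 by norm_num))]
      with n hVn hn
    have hch : P {ω | R ≤ |Y n ω - m n|} ≤ 1 / 4 := by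
      refine (meas_ge_le_variance_div_sq (hY n).memLp_two (by linarith)).trans ?_
      rw [show (1 / 4 : ℝ≥0∞) = ENNReal.ofReal (1 / 4) by
        rw [ENNReal.ofReal_div_of_pos (by norm_num)]; simp]
      refine ENNReal.ofReal_le_ofReal ?_
      rw [div_le_iff₀ (by positivity)]
      have h2 : v n ≤ |V| := hVn.trans (le_abs_self V)
      have : 0 ≤ |V| := abs_nonneg V
      change v n ≤ _
      rw [hR]; nlinarith
    by_contra hcon
    push Not at hcon
    have hcover : (Set.univ : Set Ω) ⊆ {ω | (K : ℝ) ≤ |Z ω|} ∪ {ω | 1 ≤ edist (Y n ω) (Z ω)}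
        ∪ {ω | R ≤ |Y n ω - m n|} := by
      intro ω _
      by_contra hω
      simp only [Set.mem_union, Set.mem_ofPred_eq, not_or, not_le] at hω
      obtain ⟨⟨ha, hb⟩, hc⟩ := hω
      rw [edist_dist, ENNReal.ofReal_lt_one, Real.dist_eq] at hb
      have h1 := abs_sub_abs_le_abs_sub (m n) (Y n ω)
      rw [abs_sub_comm] at h1
      have h2 := abs_sub_abs_le_abs_sub (Y n ω) (Z ω)
      linarith
    have := (measure_mono (μ := P) hcover).trans ((measure_union_le _ _).trans
      (add_le_add (measure_union_le _ _) le_rfl))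
    rw [measure_univ] at this
    have h3 : (1 : ℝ≥0∞) < 1 := by
      calc (1 : ℝ≥0∞) ≤ _ := this
        _ < 1 / 4 + 1 / 4 + 1 / 4 :=
            ENNReal.add_lt_add_of_lt_of_le (by finiteness) (ENNReal.add_lt_add hK hn) hch
        _ ≤ 1 := by
            rw [show (1 / 4 : ℝ≥0∞) = ENNReal.ofReal (1 / 4) by
              rw [ENNReal.ofReal_div_of_pos (by norm_num)]; simp]
            rw [← ENNReal.ofReal_add (by norm_num) (by norm_num),
              ← ENNReal.ofReal_add (by norm_num) (by norm_num)]
            rw [← ENNReal.ofReal_one]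
            exact ENNReal.ofReal_le_ofReal (by norm_num)
    exact lt_irrefl _ h3
  -- extract a convergent subsequence of the parameters
  obtain ⟨⟨m', v'⟩, hmem, φ, hφ, hsub⟩ :=
    (isCompact_Icc.prod isCompact_Icc : IsCompact (Set.Icc (-M) M ×ˢ Set.Icc (0 : ℝ) V)).tendsto_subseq'
      (x := fun n => (m n, v n)) (by
        refine Eventually.frequently ?_
        filter_upwards [hV, hM] with n h1 h2
        exact ⟨abs_le.1 h2, hv0 n, h1⟩)
  have hm' : Tendsto (fun n => m (φ n)) atTop (𝓝 m') := (continuous_fst.tendsto _).comp hsub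
  have hv' : Tendsto (fun n => v (φ n)) atTop (𝓝 v') := (continuous_snd.tendsto _).comp hsub
  have hlaw : P.map Z = gaussianReal m' v'.toNNReal := by
    refine Measure.ext_of_charFun ?_
    ext t
    refine tendsto_nhds_unique ((hconv t).comp hφ.tendsto_atTop) ?_
    rw [charFun_gaussianReal, Real.coe_toNNReal _ hmem.2.1]
    simp only [Function.comp_def, hcf]
    refine (Complex.continuous_exp.tendsto _).comp ?_
    refine Tendsto.sub (Tendsto.mul (Tendsto.mul tendsto_const_nhds ?_) tendsto_const_nhds)
      (Tendsto.div_const (Tendsto.mul ?_ tendsto_const_nhds) _)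
    · exact (Complex.continuous_ofReal.tendsto _).comp hm'
    · exact (Complex.continuous_ofReal.tendsto _).comp hv'
  exact ⟨by rw [hlaw]; infer_instance⟩

section GaussianMeasures

variable {𝕏 : Type v} [MetricSpace 𝕏] [CompactSpace 𝕏]

/-- The space of continuous functions carries its Borel σ-algebra. -/
instance instMeasurableSpaceContinuousMap : MeasurableSpace C(𝕏, ℝ) := borel _

instance instBorelSpaceContinuousMap : BorelSpace C(𝕏, ℝ) := ⟨rfl⟩

/-- Finite-rank operators `f ↦ ∑ i, f (x i) • φ i` that converge pointwise to the identity. -/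
theorem exists_finite_rank_approx (𝕏 : Type v) [MetricSpace 𝕏] [CompactSpace 𝕏] :
    ∃ (N : ℕ → ℕ) (x : ∀ n, Fin (N n) → 𝕏) (φ : ∀ n, Fin (N n) → C(𝕏, ℝ)),
      ∀ f : C(𝕏, ℝ), Tendsto (fun n => ∑ i, f (x n i) • φ n i) atTop (𝓝 f) := by
  have key : ∀ n : ℕ, ∃ (N : ℕ) (x : Fin N → 𝕏) (φ : Fin N → C(𝕏, ℝ)),
      (∀ y, ∑ i, φ i y = 1) ∧ (∀ i y, 0 ≤ φ i y) ∧
      (∀ i y, φ i y ≠ 0 → dist y (x i) < 1 / ((n : ℝ) + 1)) := by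
    intro n
    have hpos : (0 : ℝ) < 1 / ((n : ℝ) + 1) := by positivity
    obtain ⟨t, -, htf, ht⟩ := (isCompact_univ (X := 𝕏)).finite_cover_balls hpos
    have := htf.fintype
    let e := Fintype.equivFin t
    obtain ⟨φ, h1, h2, h3, -⟩ := exists_continuous_sum_one_of_isOpen_isCompact
      (s := fun i : Fin (Fintype.card t) => Metric.ball (e.symm i : 𝕏) (1 / ((n : ℝ) + 1)))
      (fun i => Metric.isOpen_ball) (isCompact_univ (X := 𝕏)) (by
        intro y hy
        obtain ⟨z, hz, hyz⟩ := Set.mem_iUnion₂.1 (ht hy)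
        exact Set.mem_iUnion.2 ⟨e ⟨z, hz⟩, by simpa using hyz⟩)
    refine ⟨_, fun i => e.symm i, φ, fun y => ?_, fun i y => (h3 i y).1, fun i y hy => ?_⟩
    · simpa using h2 (Set.mem_univ y)
    · exact h1 i (subset_tsupport _ hy)
  choose N x φ h1 h2 h3 using key
  refine ⟨N, x, φ, fun f => ?_⟩
  rw [Metric.tendsto_atTop]
  intro ε hε
  obtain ⟨δ, hδ, hf⟩ := Metric.uniformContinuous_iff.1
    (CompactSpace.uniformContinuous_of_continuous f.continuous) (ε / 2) (half_pos hε)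
  obtain ⟨K, hK⟩ := exists_nat_one_div_lt hδ
  refine ⟨K, fun n hn => ?_⟩
  refine lt_of_le_of_lt ((ContinuousMap.dist_le (half_pos hε).le).2 fun y => ?_) (half_lt_self hε)
  have e1 : (∑ i, f (x n i) • φ n i) y - f y = ∑ i, (f (x n i) - f y) * φ n i y := by
    simp only [ContinuousMap.coe_sum, Finset.sum_apply, ContinuousMap.smul_apply, smul_eq_mul,
      sub_mul, Finset.sum_sub_distrib, ← Finset.mul_sum, h1, mul_one]
  rw [Real.dist_eq, e1]
  calc |∑ i, (f (x n i) - f y) * φ n i y| ≤ ∑ i, |(f (x n i) - f y) * φ n i y| :=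
        Finset.abs_sum_le_sum_abs _ _
    _ ≤ ∑ i, ε / 2 * φ n i y := by
        refine Finset.sum_le_sum fun i _ => ?_
        rw [abs_mul, abs_of_nonneg (h2 n i y)]
        by_cases h0 : φ n i y = 0
        · simp [h0]
        · refine mul_le_mul_of_nonneg_right ?_ (h2 n i y)
          rw [← Real.dist_eq, dist_comm]
          refine (hf (lt_trans (h3 n i y h0) (lt_of_le_of_lt ?_ hK))).le
          have : (K : ℝ) ≤ n := by exact_mod_cast hn
          gcongr
    _ = ε / 2 := by rw [← Finset.mul_sum, h1, mul_one]

/-- A process with continuous paths is a random element of `C(𝕏, ℝ)`. -/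
theorem measurable_path {Ω : Type*} [MeasurableSpace Ω] {ξ : Ω → C(𝕏, ℝ)}
    (h : ∀ x, Measurable fun ω => ξ ω x) : Measurable ξ := by
  obtain ⟨N, x, φ, hT⟩ := exists_finite_rank_approx 𝕏
  refine measurable_of_tendsto_metrizable (f := fun n ω => ∑ i, ξ ω (x n i) • φ n i) (fun n => ?_)
    (tendsto_pi_nhds.2 fun ω => hT (ξ ω))
  refine Finset.measurable_sum _ fun i _ => ?_
  exact (h (x n i)).smul_const (φ n i)

/-- The law of a Gaussian process with continuous paths is a Gaussian measure on `C(𝕏, ℝ)`. -/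
theorem isGaussian_law {Ω : Type*} [MeasurableSpace Ω] {P : Measure Ω}
    [IsProbabilityMeasure P] {ξ : Ω → C(𝕏, ℝ)} (h : ∀ x, Measurable fun ω => ξ ω x)
    (hG : IsGaussianProcess (fun x ω => ξ ω x) P) : IsGaussian (P.map ξ) := by
  classical
  have hξ := measurable_path h
  obtain ⟨N, x, φ, hT⟩ := exists_finite_rank_approx 𝕏
  refine isGaussian_of_isGaussian_map fun L => ?_
  have hL : Measurable L := L.continuous.measurable
  rw [Measure.map_map hL hξ]
  refine (gaussianLaw_of_tendsto (Y := fun n ω => ∑ i, ξ ω (x n i) * L (φ n i)) (fun n => ?_)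
    (fun n => ?_) (fun ω => ?_)).isGaussian_map
  · exact Finset.measurable_sum _ fun i _ => (h _).mul_const _
  · have h1 := hG.hasGaussianLaw (Finset.univ.image (x n))
    have hmem : ∀ i, x n i ∈ Finset.univ.image (x n) := fun i =>
      Finset.mem_image_of_mem _ (Finset.mem_univ i)
    let A : ((Finset.univ.image (x n) : Finset 𝕏) → ℝ) →L[ℝ] ℝ :=
      ∑ i, L (φ n i) • ContinuousLinearMap.proj (R := ℝ) (φ := fun _ => ℝ) ⟨x n i, hmem i⟩
    have := h1.map A
    refine this.congr (ae_of_all _ fun ω => ?_)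
    simp [A, mul_comm]
  · have := (L.continuous.tendsto _).comp (hT (ξ ω))
    refine this.congr fun n => ?_
    simp

/-- The set of all Gaussian measures on `C(𝕏, ℝ)`, with the σ-algebra generated by the evaluation
maps `ν ↦ ν A`. -/
abbrev GaussMeas (𝕏 : Type v) [MetricSpace 𝕏] [CompactSpace 𝕏] : Type v :=
  {ν : Measure C(𝕏, ℝ) // IsGaussian ν}

instance (ν : GaussMeas 𝕏) : IsGaussian ν.1 := ν.2

/-- Mean function of a Gaussian measure. -/
noncomputable def meanFun (ν : GaussMeas 𝕏) (x : 𝕏) : ℝ := ∫ f, f x ∂ν.1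

/-- Covariance function of a Gaussian measure. -/
noncomputable def covFun (ν : GaussMeas 𝕏) (x y : 𝕏) : ℝ :=
  cov[fun f : C(𝕏, ℝ) => f x, fun f : C(𝕏, ℝ) => f y; ν.1]

/-- Convergence of Gaussian measures: uniform convergence of the mean functions and of the
covariance functions. -/
def GaussTendsto (ν : ℕ → GaussMeas 𝕏) (νlim : GaussMeas 𝕏) : Prop :=
  TendstoUniformly (fun n x => meanFun (ν n) x) (meanFun νlim) atTop ∧
  TendstoUniformly (fun n (p : 𝕏 × 𝕏) => covFun (ν n) p.1 p.2)
    (fun p => covFun νlim p.1 p.2) atTop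

theorem memLp_eval (ν : GaussMeas 𝕏) (x : 𝕏) : MemLp (fun f : C(𝕏, ℝ) => f x) 2 ν.1 :=
  IsGaussian.memLp_dual ν.1 (ContinuousMap.evalCLM ℝ x) 2 (by simp)

theorem covFun_eq_integral (ν : GaussMeas 𝕏) (x y : 𝕏) :
    Integrable (fun f : C(𝕏, ℝ) => (f x - meanFun ν x) • f) ν.1 ∧
    covFun ν y x = (∫ f : C(𝕏, ℝ), (f x - meanFun ν x) • f ∂ν.1) y := by
  have h2 : MemLp (fun f : C(𝕏, ℝ) => f x - meanFun ν x) 2 ν.1 :=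
    (memLp_eval ν x).sub (memLp_const _)
  have hint : Integrable (fun f : C(𝕏, ℝ) => (f x - meanFun ν x) • f) ν.1 :=
    memLp_one_iff_integrable.1 (IsGaussian.memLp_two_id.smul h2)
  refine ⟨hint, ?_⟩
  have e1 : (∫ f : C(𝕏, ℝ), (f x - meanFun ν x) • f ∂ν.1) y
      = ∫ f : C(𝕏, ℝ), (f x - meanFun ν x) * f y ∂ν.1 := by
    have := (ContinuousMap.evalCLM ℝ y : C(𝕏, ℝ) →L[ℝ] ℝ).integral_comp_comm hint
    simpa using this.symm
  rw [e1, covFun, covariance_comm, covariance]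
  have hi : Integrable (fun f : C(𝕏, ℝ) => (f x - meanFun ν x) * f y) ν.1 :=
    h2.integrable_mul (memLp_eval ν y)
  have h1 : Integrable (fun f : C(𝕏, ℝ) => f x - meanFun ν x) ν.1 := h2.integrable (by simp)
  have hz : ∫ f : C(𝕏, ℝ), (f x - meanFun ν x) ∂ν.1 = 0 := by
    rw [integral_sub ((memLp_eval ν x).integrable (by simp)) (integrable_const _)]
    simp [meanFun]
  change ∫ f : C(𝕏, ℝ), (f x - meanFun ν x) * (f y - meanFun ν y) ∂ν.1 = _
  simp only [mul_sub]
  rw [integral_sub hi (h1.mul_const _), integral_mul_const, hz]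
  simp

/-- The function `k_ν(·, x)`. -/
noncomputable def covCol (ν : GaussMeas 𝕏) (x : 𝕏) : C(𝕏, ℝ) where
  toFun y := covFun ν y x
  continuous_toFun := by
    simp only [(covFun_eq_integral ν x _).2]
    exact ContinuousMap.continuous _

/-- The variance `s_ν²(x) = k_ν(x, x) + τ(x)²` of a noisy observation at `x`. -/
noncomputable def obsVar (τ : C(𝕏, ℝ≥0)) (ν : GaussMeas 𝕏) (x : 𝕏) : ℝ :=
  covFun ν x x + (τ x : ℝ) ^ 2

/-- The map `(f, e) ↦ f + k_ν(·, x) (z - f x - τ(x) e) / s_ν²(x)` on `C(𝕏, ℝ) × ℝ`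
(with `a / 0 = 0`). -/
noncomputable def condMap (τ : C(𝕏, ℝ≥0)) (x : 𝕏) (z : ℝ) (ν : GaussMeas 𝕏)
    (p : C(𝕏, ℝ) × ℝ) : C(𝕏, ℝ) :=
  p.1 + ((z - p.1 x - τ x * p.2) / obsVar τ ν x) • covCol ν x

theorem isGaussian_condMap (τ : C(𝕏, ℝ≥0)) (x : 𝕏) (z : ℝ) (ν : GaussMeas 𝕏) :
    IsGaussian ((ν.1.prod (gaussianReal 0 1)).map (condMap τ x z ν)) := by
  let c : C(𝕏, ℝ) := (z / obsVar τ ν x) • covCol ν x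
  let ev : C(𝕏, ℝ) →L[ℝ] ℝ := ContinuousMap.evalCLM ℝ x
  let A : C(𝕏, ℝ) × ℝ →L[ℝ] C(𝕏, ℝ) :=
    ContinuousLinearMap.fst ℝ _ _ -
      ((obsVar τ ν x)⁻¹ • (ev.comp (ContinuousLinearMap.fst ℝ _ _) +
        (τ x : ℝ) • ContinuousLinearMap.snd ℝ _ _)).smulRight (covCol ν x)
  have hA : condMap τ x z ν = (fun f => f + c) ∘ A := by
    funext p
    ext y
    simp [condMap, A, c, ev]
    ring
  rw [hA, ← Measure.map_map (by fun_prop) A.continuous.measurable]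
  infer_instance

/-- `condObs τ x z ν` is the conditional distribution of `ξ ∼ ν` given that `ξ(x) + τ(x) e = z`, for
`e ∼ N(0, 1)` independent of `ξ`. It is the Gaussian measure with the mean and covariance functions
of `meanFun_condObs` and `covFun_condObs`, constructed as the law of
`ξ + k_ν(·, x) (z - ξ(x) - τ(x) e) / s_ν²(x)`; when `s_ν²(x) = 0` it is `ν`. -/
noncomputable def condObs (τ : C(𝕏, ℝ≥0)) (x : 𝕏) (z : ℝ) (ν : GaussMeas 𝕏) : GaussMeas 𝕏 :=
  ⟨(ν.1.prod (gaussianReal 0 1)).map (condMap τ x z ν), isGaussian_condMap τ x z ν⟩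

theorem measurable_condMap (τ : C(𝕏, ℝ≥0)) (x : 𝕏) (z : ℝ) (ν : GaussMeas 𝕏) :
    Measurable (condMap τ x z ν) := by
  have h : Continuous fun p : C(𝕏, ℝ) × ℝ => p.1 x :=
    (ContinuousMap.evalCLM ℝ x : C(𝕏, ℝ) →L[ℝ] ℝ).continuous.comp continuous_fst
  have : Continuous (condMap τ x z ν) := by
    unfold condMap
    fun_prop
  exact this.measurable

/-- The mean function of `condObs τ x z ν` is `m + k(·, x) (z - m(x)) / s²(x)`. -/
theorem meanFun_condObs (τ : C(𝕏, ℝ≥0)) (x : 𝕏) (z : ℝ) (ν : GaussMeas 𝕏) (y : 𝕏) :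
    meanFun (condObs τ x z ν) y
      = meanFun ν y + covFun ν y x / obsVar τ ν x * (z - meanFun ν x) := by
  have hev : ∀ y : 𝕏, Continuous fun f : C(𝕏, ℝ) => f y := fun y =>
    (ContinuousMap.evalCLM ℝ y : C(𝕏, ℝ) →L[ℝ] ℝ).continuous
  have hi : ∀ y : 𝕏, Integrable (fun p : C(𝕏, ℝ) × ℝ => p.1 y) (ν.1.prod (gaussianReal 0 1)) :=
    fun y => ((memLp_eval ν y).comp_fst (gaussianReal 0 1)).integrable (by simp)
  have he : Integrable (fun p : C(𝕏, ℝ) × ℝ => p.2) (ν.1.prod (gaussianReal 0 1)) :=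
    (((memLp_id_gaussianReal' (μ := 0) (v := 1) 2 (by simp))).comp_snd ν.1).integrable (by simp)
  have hm : ∀ y : 𝕏, ∫ p : C(𝕏, ℝ) × ℝ, p.1 y ∂(ν.1.prod (gaussianReal 0 1)) = meanFun ν y := by
    intro y
    rw [integral_fun_fst (fun f : C(𝕏, ℝ) => f y)]
    simp [meanFun]
  have hme : ∫ p : C(𝕏, ℝ) × ℝ, p.2 ∂(ν.1.prod (gaussianReal 0 1)) = 0 := by
    rw [integral_fun_snd (fun e : ℝ => e)]
    simp
  have e1 : meanFun (condObs τ x z ν) y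
      = ∫ p : C(𝕏, ℝ) × ℝ, (p.1 y + covFun ν y x / obsVar τ ν x * (z - p.1 x - τ x * p.2))
        ∂(ν.1.prod (gaussianReal 0 1)) := by
    unfold meanFun condObs
    rw [integral_map (measurable_condMap τ x z ν).aemeasurable (hev y).aestronglyMeasurable]
    refine integral_congr_ae (ae_of_all _ fun p => ?_)
    simp [condMap, covCol]
    ring
  have h1 : Integrable (fun p : C(𝕏, ℝ) × ℝ => z - p.1 x) (ν.1.prod (gaussianReal 0 1)) :=
    (integrable_const z).sub (hi x)
  have h2 : Integrable (fun p : C(𝕏, ℝ) × ℝ => (τ x : ℝ) * p.2) (ν.1.prod (gaussianReal 0 1)) :=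
    he.const_mul _
  have h3 : Integrable (fun p : C(𝕏, ℝ) × ℝ => z - p.1 x - τ x * p.2)
      (ν.1.prod (gaussianReal 0 1)) := h1.sub h2
  rw [e1, integral_add (hi y) (h3.const_mul _), integral_const_mul, integral_sub h1 h2,
    integral_sub (integrable_const z) (hi x), integral_const_mul, hm, hm, hme]
  simp

/-- The covariance function of `condObs τ x z ν` is `k - k(·, x) k(x, ·) / s²(x)`. -/
theorem covFun_condObs (τ : C(𝕏, ℝ≥0)) (x : 𝕏) (z : ℝ) (ν : GaussMeas 𝕏) (y y' : 𝕏) :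
    covFun (condObs τ x z ν) y y'
      = covFun ν y y' - covFun ν y x * covFun ν x y' / obsVar τ ν x := by
  have hev : ∀ y : 𝕏, Continuous fun f : C(𝕏, ℝ) => f y := fun y =>
    (ContinuousMap.evalCLM ℝ y : C(𝕏, ℝ) →L[ℝ] ℝ).continuous
  set Q := ν.1.prod (gaussianReal 0 1) with hQ
  have hL : ∀ y : 𝕏, MemLp (fun p : C(𝕏, ℝ) × ℝ => p.1 y) 2 Q :=
    fun y => (memLp_eval ν y).comp_fst (gaussianReal 0 1)
  have he : MemLp (fun p : C(𝕏, ℝ) × ℝ => (τ x : ℝ) * p.2) 2 Q :=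
    ((memLp_id_gaussianReal' (μ := 0) (v := 1) 2 (by simp)).comp_snd ν.1).const_mul _
  have hff : ∀ a b : 𝕏, cov[fun p : C(𝕏, ℝ) × ℝ => p.1 a, fun p => p.1 b; Q] = covFun ν a b := by
    intro a b
    have : ν.1 = Q.map Prod.fst := by simp [hQ]
    rw [covFun, this, covariance_map (hev a).aestronglyMeasurable (hev b).aestronglyMeasurable
      measurable_fst.aemeasurable]
    rfl
  have hfe : ∀ a : 𝕏, cov[fun p : C(𝕏, ℝ) × ℝ => p.1 a, fun p => (τ x : ℝ) * p.2; Q] = 0 := by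
    intro a
    refine IndepFun.covariance_eq_zero ?_ (hL a) he
    exact indepFun_prod (hev a).measurable (measurable_const_mul _)
  have hee : cov[fun p : C(𝕏, ℝ) × ℝ => (τ x : ℝ) * p.2, fun p => (τ x : ℝ) * p.2; Q]
      = (τ x : ℝ) ^ 2 := by
    rw [covariance_const_mul_left, covariance_const_mul_right]
    have hg : gaussianReal 0 1 = Q.map Prod.snd := by simp [hQ]
    have : cov[fun p : C(𝕏, ℝ) × ℝ => p.2, fun p => p.2; Q]
        = cov[fun e : ℝ => e, fun e : ℝ => e; gaussianReal 0 1] := by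
      rw [hg, covariance_map (by fun_prop) (by fun_prop) measurable_snd.aemeasurable]
      rfl
    rw [this, covariance_self (by fun_prop), variance_fun_id_gaussianReal]
    simp [sq]
  set W : C(𝕏, ℝ) × ℝ → ℝ := fun p => p.1 x + (τ x : ℝ) * p.2 with hW
  have hWL : MemLp W 2 Q := (hL x).add he
  have hfW : ∀ a, cov[fun p : C(𝕏, ℝ) × ℝ => p.1 a, W; Q] = covFun ν a x := by
    intro a
    have := covariance_add_right (hL a) (hL x) he
    rw [hff, hfe, add_zero] at this
    exact this
  have hWW : cov[W, W; Q] = obsVar τ ν x := by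
    have h1 : cov[W, W; Q] = _ := covariance_add_left (hL x) he hWL
    have h2 : cov[W, fun p => (τ x : ℝ) * p.2; Q] = _ := covariance_add_left (hL x) he he
    rw [h1, hfW, covariance_comm, h2, hfe, hee, zero_add, obsVar]
  have hsymm : ∀ a b, covFun ν a b = covFun ν b a := fun a b => covariance_comm _ _
  let g : 𝕏 → C(𝕏, ℝ) × ℝ → ℝ := fun a p => p.1 a - covFun ν a x / obsVar τ ν x * W p
  have hg : ∀ a, MemLp (g a) 2 Q := fun a => (hL a).sub (hWL.const_mul _)
  have e1 : covFun (condObs τ x z ν) y y' = cov[fun p => g y p + covFun ν y x / obsVar τ ν x * z,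
      fun p => g y' p + covFun ν y' x / obsVar τ ν x * z; Q] := by
    unfold covFun condObs
    rw [covariance_map (hev y).aestronglyMeasurable (hev y').aestronglyMeasurable
      (measurable_condMap τ x z ν).aemeasurable]
    congr 1 <;>
    · funext p
      simp [condMap, covCol, g, hW, covFun]
      ring
  rw [e1, covariance_add_const_left ((hg y).integrable (by simp)),
    covariance_add_const_right ((hg y').integrable (by simp)),
    covariance_fun_sub_fun_sub (hL y) (hWL.const_mul _) (hL y') (hWL.const_mul _), hff,
    covariance_const_mul_right, hfW, covariance_const_mul_left, covariance_comm W, hfW,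
    covariance_const_mul_left, covariance_const_mul_right, hWW, hsymm x y']
  by_cases h0 : obsVar τ ν x = 0
  · simp [h0]
  · field_simp
    ring

end GaussianMeasures

section Model

variable {𝕏 : Type v} [MetricSpace 𝕏] [CompactSpace 𝕏]
variable {Ω : Type u} [mΩ : MeasurableSpace Ω]

/-- `ν` is a version of the conditional distribution of `ξ` given the σ-algebra `𝓕` that is a
random element of the space of Gaussian measures. -/
def IsCondLaw {Ω : Type u} {mΩ : MeasurableSpace Ω} (P : Measure[mΩ] Ω) (ξ : Ω → C(𝕏, ℝ))
    (𝓕 : MeasurableSpace Ω) (ν : Ω → GaussMeas 𝕏) : Prop :=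
  Measurable[mΩ] ν ∧ ∀ A : Set C(𝕏, ℝ), MeasurableSet A →
    (fun ω => (ν ω).1.real A) =ᵐ[P] P[(ξ ⁻¹' A).indicator (fun _ => (1 : ℝ)) | 𝓕]

/-- The set of all Gaussian conditional distributions of `ξ`. -/
def gaussCondLaws {Ω : Type u} {mΩ : MeasurableSpace Ω} (P : Measure[mΩ] Ω) (ξ : Ω → C(𝕏, ℝ)) :
    Set (Ω → GaussMeas 𝕏) :=
  {ν | ∃ 𝓕 : MeasurableSpace Ω, 𝓕 ≤ mΩ ∧ IsCondLaw P ξ 𝓕 ν}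

/-- A Gaussian process `ξ` with continuous sample paths, and i.i.d. standard normal noise variables
`U 0, U 1, …` independent of `ξ`. -/
structure GPModel (𝕏 : Type v) [MetricSpace 𝕏] [CompactSpace 𝕏] {Ω : Type u} [MeasurableSpace Ω]
    (P : Measure Ω) where
  ξ : Ω → C(𝕏, ℝ)
  U : ℕ → Ω → ℝ
  measurable_ξ : ∀ x, Measurable fun ω => ξ ω x
  gaussian_ξ : IsGaussianProcess (fun x ω => ξ ω x) P
  measurable_U : ∀ n, Measurable (U n)
  law_U : ∀ n, P.map (U n) = gaussianReal 0 1
  iIndepFun_U : iIndepFun U P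
  indepFun_ξ_U : IndepFun (fun ω x => ξ ω x) (fun ω n => U n ω) P

variable {P : Measure Ω} [IsProbabilityMeasure P]

/-- The law of `ξ`, as a Gaussian measure on `C(𝕏, ℝ)`. -/
noncomputable def GPModel.law (M : GPModel 𝕏 P) : GaussMeas 𝕏 :=
  ⟨P.map M.ξ, isGaussian_law M.measurable_ξ M.gaussian_ξ⟩

/-- The observation `ξ(X n) + τ(X n) U n`; the design point `X n` (written `X_{n+1}` when counting
from one) is the one that is chosen after `n` observations. -/
def obs (τ : C(𝕏, ℝ≥0)) (M : GPModel 𝕏 P) (X : ℕ → Ω → 𝕏) (n : ℕ) (ω : Ω) : ℝ :=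
  M.ξ ω (X n ω) + τ (X n ω) * M.U n ω

/-- The posterior distribution of `ξ` after `n` observations. -/
noncomputable def postLaw (τ : C(𝕏, ℝ≥0)) (M : GPModel 𝕏 P) (X : ℕ → Ω → 𝕏) :
    ℕ → Ω → GaussMeas 𝕏
  | 0, _ => M.law
  | n + 1, ω => condObs τ (X n ω) (obs τ M X n ω) (postLaw τ M X n ω)

variable [MeasurableSpace 𝕏]

/-- The σ-algebra `𝓕ₙ` generated by the first `n` design points and observations. -/
@[reducible]
def obsSigma (τ : C(𝕏, ℝ≥0)) (M : GPModel 𝕏 P) (X : ℕ → Ω → 𝕏) (n : ℕ) : MeasurableSpace Ω :=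
  ⨆ (i : ℕ) (_ : i < n), MeasurableSpace.comap (X i) inferInstance ⊔
    MeasurableSpace.comap (obs τ M X i) inferInstance

/-- A (non-randomized) sequential design: `X n` is `𝓕ₙ`-measurable. -/
def IsDesign (τ : C(𝕏, ℝ≥0)) (M : GPModel 𝕏 P) (X : ℕ → Ω → 𝕏) : Prop :=
  ∀ n, Measurable[obsSigma τ M X n] (X n)

theorem obsSigma_mono (τ : C(𝕏, ℝ≥0)) (M : GPModel 𝕏 P) (X : ℕ → Ω → 𝕏) :
    Monotone (obsSigma τ M X) := fun _ _ h =>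
  iSup_mono fun _ => iSup_mono' fun hi => ⟨lt_of_lt_of_le hi h, le_rfl⟩

theorem obsSigma_le [BorelSpace 𝕏] {τ : C(𝕏, ℝ≥0)} {M : GPModel 𝕏 P} {X : ℕ → Ω → 𝕏}
    (hX : IsDesign τ M X) (n : ℕ) : obsSigma τ M X n ≤ mΩ := by
  induction n using Nat.strong_induction_on with
  | _ n ih =>
    refine iSup₂_le fun i hi => ?_
    have hXi : Measurable (X i) := (hX i).mono (ih i hi) le_rfl
    have hξ : Measurable M.ξ := measurable_path M.measurable_ξ
    have hev : Measurable fun p : C(𝕏, ℝ) × 𝕏 => p.1 p.2 := by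
      have : Continuous fun p : C(𝕏, ℝ) × 𝕏 => p.1 p.2 := by fun_prop
      exact this.measurable
    have hτ : Measurable fun x : 𝕏 => (τ x : ℝ) := by
      have : Continuous fun x : 𝕏 => (τ x : ℝ) := by fun_prop
      exact this.measurable
    have hobs : Measurable (obs τ M X i) :=
      (hev.comp (hξ.prodMk hXi)).add ((hτ.comp hXi).mul (M.measurable_U i))
    exact sup_le hXi.comap_le hobs.comap_le

/-- The filtration `(𝓕ₙ)` of a sequential design. -/
def obsFiltration [BorelSpace 𝕏] {τ : C(𝕏, ℝ≥0)} {M : GPModel 𝕏 P} {X : ℕ → Ω → 𝕏}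
    (hX : IsDesign τ M X) : Filtration ℕ mΩ where
  seq := obsSigma τ M X
  mono' := obsSigma_mono τ M X
  le' := obsSigma_le hX

end Model

section Functionals

variable {𝕏 : Type v} [MetricSpace 𝕏] [CompactSpace 𝕏]

/-- Uniform integrability of `(H ∘ ν)` over all Gaussian conditional distributions `ν` of any given
Gaussian random element. -/
def IsUIGauss (H : GaussMeas 𝕏 → ℝ) : Prop :=
  ∀ (Ω : Type u) [MeasurableSpace Ω] (P : Measure Ω) [IsProbabilityMeasure P] (ξ : Ω → C(𝕏, ℝ)),
    Measurable ξ → IsGaussian (P.map ξ) →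
    UniformIntegrable (fun (ν : gaussCondLaws P ξ) ω => H (ν.1 ω)) 1 P

/-- Almost sure continuity along converging sequences of Gaussian conditional distributions of any
given Gaussian random element. -/
def IsASContGauss (H : GaussMeas 𝕏 → ℝ) : Prop :=
  ∀ (Ω : Type u) [MeasurableSpace Ω] (P : Measure Ω) [IsProbabilityMeasure P] (ξ : Ω → C(𝕏, ℝ)),
    Measurable ξ → IsGaussian (P.map ξ) →
    ∀ (ν : ℕ → Ω → GaussMeas 𝕏) (νlim : Ω → GaussMeas 𝕏),
      (∀ n, ν n ∈ gaussCondLaws P ξ) → νlim ∈ gaussCondLaws P ξ →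
      (∀ᵐ ω ∂P, GaussTendsto (fun n => ν n ω) (νlim ω)) →
      ∀ᵐ ω ∂P, Tendsto (fun n => H (ν n ω)) atTop (𝓝 (H (νlim ω)))

/-- The supermartingale property: `H (P_n^ξ)` is an `(𝓕ₙ)`-supermartingale for every model and
every sequential design. -/
def HasSupermartingaleProperty [MeasurableSpace 𝕏] [BorelSpace 𝕏] (τ : C(𝕏, ℝ≥0))
    (H : GaussMeas 𝕏 → ℝ) : Prop :=
  ∀ (Ω : Type u) [MeasurableSpace Ω] (P : Measure Ω) [IsProbabilityMeasure P] (M : GPModel 𝕏 P)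
    (X : ℕ → Ω → 𝕏) (hX : IsDesign τ M X),
    Supermartingale (fun n ω => H (postLaw τ M X n ω)) (obsFiltration hX) P

/-- The expected residual uncertainty `𝒥_x(ν)` after a noisy observation at `x`. -/
noncomputable def expResidual (τ : C(𝕏, ℝ≥0)) (H : GaussMeas 𝕏 → ℝ≥0∞) (x : 𝕏)
    (ν : GaussMeas 𝕏) : ℝ≥0∞ :=
  ∫⁻ f, ∫⁻ e, H (condObs τ x (f x + τ x * e) ν) ∂(gaussianReal 0 1) ∂ν.1

/-- The maximal expected gain `𝒢(ν) = sup_x (H(ν) - 𝒥_x(ν))`. -/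
noncomputable def maxGain (τ : C(𝕏, ℝ≥0)) (H : GaussMeas 𝕏 → ℝ≥0∞) (ν : GaussMeas 𝕏) : ℝ≥0∞ :=
  ⨆ x, (H ν - expResidual τ H x ν)

/-- An `ε`-quasi-SUR sequential design for the uncertainty functional `H`. -/
def IsQuasiSUR [MeasurableSpace 𝕏] {Ω : Type u} [MeasurableSpace Ω] {P : Measure Ω}
    [IsProbabilityMeasure P] (τ : C(𝕏, ℝ≥0)) (H : GaussMeas 𝕏 → ℝ≥0∞) (M : GPModel 𝕏 P) (ε : ℕ → ℝ)
    (X : ℕ → Ω → 𝕏) : Prop :=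
  IsDesign τ M X ∧ ∃ n₀, ∀ n ≥ n₀, ∀ᵐ ω ∂P,
    expResidual τ H (X n ω) (postLaw τ M X n ω)
      ≤ (⨅ x, expResidual τ H x (postLaw τ M X n ω)) + ENNReal.ofReal (ε n)

/-- `H = H₀ + H₁` with `H₀(ν) = ∫ L₀ dν`, `L₀` integrable for all Gaussian measures, and `H₁`
measurable with the uniform integrability and continuity properties above. -/
structure IsUICDecomposition (H : GaussMeas 𝕏 → ℝ≥0∞) (L₀ : C(𝕏, ℝ) → ℝ) (H₁ : GaussMeas 𝕏 → ℝ) :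
    Prop where
  measurable_L₀ : Measurable L₀
  integrable_L₀ : ∀ ν : GaussMeas 𝕏, Integrable L₀ ν.1
  measurable_H₁ : Measurable H₁
  eq_add : ∀ ν : GaussMeas 𝕏, (H ν).toReal = ∫ f, L₀ f ∂ν.1 + H₁ ν
  isUI_H₁ : IsUIGauss.{u} H₁
  isASCont_H₁ : IsASContGauss.{u} H₁

variable {D : Type w}

/-- The average loss of a decision `d` under `ν`. -/
noncomputable def avgLoss (L : C(𝕏, ℝ) → D → ℝ) (ν : GaussMeas 𝕏) (d : D) : ℝ≥0∞ :=
  ∫⁻ f, ENNReal.ofReal (L f d) ∂ν.1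

/-- The uncertainty functional `H(ν) = inf_d ∫ L(f, d) ν(df)` induced by a loss function. -/
noncomputable def uncertainty (L : C(𝕏, ℝ) → D → ℝ) (ν : GaussMeas 𝕏) : ℝ≥0∞ :=
  ⨅ d, avgLoss L ν d

/-- Regular non-negative loss functions. -/
structure IsRegularLoss (τ : C(𝕏, ℝ≥0)) [TopologicalSpace D] (L : C(𝕏, ℝ) → D → ℝ) : Prop where
  nonempty : Nonempty D
  separable : SeparableSpace D
  nonneg : ∀ f d, 0 ≤ L f d
  measurable : ∀ d, Measurable fun f => L f d
  avgLoss_ne_top : ∀ ν d, avgLoss L ν d ≠ ∞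
  continuous_avgLoss : ∀ ν, Continuous (avgLoss L ν)
  decomposition : ∃ L₀ H₁, IsUICDecomposition.{u} (uncertainty L) L₀ H₁
  zeros_eq : {ν | uncertainty L ν = 0} = {ν | maxGain τ (uncertainty L) ν = 0}

/-- The excursion volume `α(f) = μ {x | f x ≥ T}`. -/
noncomputable def excursionVolume [MeasurableSpace 𝕏] (μ : Measure 𝕏) (T : ℝ) (f : C(𝕏, ℝ)) : ℝ :=
  μ.real {x | T ≤ f x}

/-- The loss `(α(f) - d)²`. -/
noncomputable def volumeLoss [MeasurableSpace 𝕏] (μ : Measure 𝕏) (T : ℝ) (f : C(𝕏, ℝ)) (d : ℝ) :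
    ℝ :=
  (excursionVolume μ T f - d) ^ 2

end Functionals

end SUR

open SUR

/-!
The uncertainty functional of the quadratic loss is `ν ↦ Var_ν(α)` (`uncertainty_sq`), where `α` is
the excursion volume, a bounded measurable functional. Most of the argument works for an arbitrary
bounded measurable functional `a`; the excursion volume enters only where zero gain has to force
zero variance, and in the almost sure continuity of the mean.

*Conditioning.* The residual of the process after regression on a noisy observation is independent
of the observation (`indepFun_residual`), so the one-step update disintegrates the joint law
(`lintegral_condObs`). Since the next noise variable is independent of the process and of the past,
induction shows that the posterior distribution is the regular conditional distribution given the
observations (`isRegCond_postLaw`). Conditional means are thus martingales and their squares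
submartingales, which gives the supermartingale properties; the decomposition is
`Var_ν(α) = ∫ α² dν - (∫ α dν)²`.

*Continuity.* By Fubini's theorem `∫ α dν` is the integral over `x` of `ν {f | T ≤ f x}`, which
depends continuously on the mean and the variance at `x` unless the limiting law has an atom at
`T`. For conditional distributions of a fixed Gaussian process that happens with positive
probability only if the value at `x` is almost surely equal to `T`, and then every conditional
exceedance probability is one (`tendsto_measureReal_condLaws`).

*Zero gain.* The expected gain of an observation at `x` is the variance of the posterior mean of
`α`, which dominates the squared covariance of `α` with every function of the observation that is
bounded by one. Applied to trigonometric functions, for which the independent noise contributes a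
non-vanishing factor, it bounds the covariances of `α` with `cos (t f(x) + φ)`
(`sq_covTrig_le_gain`). If these vanish for all `x`, `t`, `φ`, then `α` is uncorrelated with every
event `T ≤ f x`; integrating over `x` gives `Var(α) = 0` (`variance_excursionVolume_eq_zero`).

*Designs.* The expected residual is upper semicontinuous in the design point, so an almost optimal
point can be chosen measurably from a dense sequence, as a function of the current posterior
distribution (`exists_isQuasiSUR`).

*Limits.* By Lévy's upward theorem the characteristic functions of the posterior distributions
converge, and limits of Gaussian characteristic functions with convergent parameters are Gaussian,
so that the conditional distribution given all observations has a Gaussian version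
(`exists_isRegCond_iSup`). The expected one-step decreases of the variance have a finite sum, hence
they tend to zero almost surely, and along a quasi-SUR design so does the maximal gain. The
trigonometric covariances converge as well, so they vanish in the limit, and the limiting variance
is zero (`ae_varFun_eq_zero_of_tendsto_maxGain`).
-/

set_option linter.unusedSectionVars false

namespace SUR

/-! ### Conditioning on one observation -/

section Covariance

/-- The Cauchy-Schwarz inequality for covariances. -/
theorem sq_covariance_le {Ω : Type*} [MeasurableSpace Ω] {Q : Measure Ω} [IsProbabilityMeasure Q]
    {X Y : Ω → ℝ} (hX : MemLp X 2 Q) (hY : MemLp Y 2 Q) :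
    cov[X, Y; Q] ^ 2 ≤ Var[X; Q] * Var[Y; Q] := by
  have h : ∀ t : ℝ, 0 ≤ Var[X; Q] * (t * t) + (2 * cov[X, Y; Q]) * t + Var[Y; Q] := by
    intro t
    have h1 := variance_nonneg (fun ω => t * X ω + Y ω) Q
    rw [variance_fun_add (hX.const_mul t) hY, variance_const_mul,
      covariance_const_mul_left] at h1
    linarith
  have := discrim_le_zero h
  rw [discrim] at this
  linarith

end Covariance

section Kernel

variable {𝕏 : Type v} [MetricSpace 𝕏] [CompactSpace 𝕏]

/-- The tautological Markov kernel from the space of Gaussian measures to `C(𝕏, ℝ)`. -/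
noncomputable def gaussKernel (𝕏 : Type v) [MetricSpace 𝕏] [CompactSpace 𝕏] :
    Kernel (GaussMeas 𝕏) C(𝕏, ℝ) where
  toFun := Subtype.val
  measurable' := measurable_subtype_coe

@[simp]
theorem gaussKernel_apply (ν : GaussMeas 𝕏) : gaussKernel 𝕏 ν = ν.1 := rfl

instance : IsMarkovKernel (gaussKernel 𝕏) :=
  ⟨fun ν => by rw [gaussKernel_apply]; infer_instance⟩

theorem continuous_eval_const (x : 𝕏) : Continuous fun f : C(𝕏, ℝ) => f x :=
  (ContinuousMap.evalCLM ℝ x : C(𝕏, ℝ) →L[ℝ] ℝ).continuous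

theorem measurable_eval_const (x : 𝕏) : Measurable fun f : C(𝕏, ℝ) => f x :=
  (continuous_eval_const x).measurable

theorem measurable_integral_gaussMeas {g : C(𝕏, ℝ) → ℝ} (hg : Measurable g) :
    Measurable fun ν : GaussMeas 𝕏 => ∫ f, g f ∂ν.1 :=
  (StronglyMeasurable.integral_kernel (κ := gaussKernel 𝕏) hg.stronglyMeasurable).measurable

variable [MeasurableSpace 𝕏] [BorelSpace 𝕏]

theorem measurable_eval : Measurable fun p : C(𝕏, ℝ) × 𝕏 => p.1 p.2 := by
  have : Continuous fun p : C(𝕏, ℝ) × 𝕏 => p.1 p.2 := by fun_prop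
  exact this.measurable

theorem measurable_noise (τ : C(𝕏, ℝ≥0)) : Measurable fun x : 𝕏 => (τ x : ℝ) := by
  have : Continuous fun x : 𝕏 => (τ x : ℝ) := by fun_prop
  exact this.measurable

theorem measurable_meanFun : Measurable fun p : GaussMeas 𝕏 × 𝕏 => meanFun p.1 p.2 := by
  have h : StronglyMeasurable fun q : (GaussMeas 𝕏 × 𝕏) × C(𝕏, ℝ) => q.2 q.1.2 :=
    (measurable_eval.comp
      (measurable_snd.prodMk (measurable_snd.comp measurable_fst))).stronglyMeasurable
  exact (h.integral_kernel_prod_right'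
    (κ := (gaussKernel 𝕏).comap Prod.fst measurable_fst)).measurable

theorem covFun_eq_sub (ν : GaussMeas 𝕏) (x y : 𝕏) :
    covFun ν x y = ∫ f, f x * f y ∂ν.1 - meanFun ν x * meanFun ν y :=
  covariance_eq_sub (memLp_eval ν x) (memLp_eval ν y)

theorem measurable_covFun :
    Measurable fun p : GaussMeas 𝕏 × 𝕏 × 𝕏 => covFun p.1 p.2.1 p.2.2 := by
  simp only [covFun_eq_sub]
  have h : StronglyMeasurable
      fun q : (GaussMeas 𝕏 × 𝕏 × 𝕏) × C(𝕏, ℝ) => q.2 q.1.2.1 * q.2 q.1.2.2 :=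
    ((measurable_eval.comp (measurable_snd.prodMk (by fun_prop))).mul
      (measurable_eval.comp (measurable_snd.prodMk (by fun_prop)))).stronglyMeasurable
  refine (h.integral_kernel_prod_right'
    (κ := (gaussKernel 𝕏).comap Prod.fst measurable_fst)).measurable.sub ?_
  exact (measurable_meanFun.comp (measurable_fst.prodMk (by fun_prop))).mul
    (measurable_meanFun.comp (measurable_fst.prodMk (by fun_prop)))

theorem measurable_covCol : Measurable fun p : GaussMeas 𝕏 × 𝕏 => covCol p.1 p.2 :=
  measurable_path fun y => measurable_covFun.comp
    (g := fun p : GaussMeas 𝕏 × 𝕏 × 𝕏 => covFun p.1 p.2.1 p.2.2)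
    (f := fun p : GaussMeas 𝕏 × 𝕏 => (p.1, y, p.2)) (by fun_prop)

theorem measurable_obsVar (τ : C(𝕏, ℝ≥0)) :
    Measurable fun p : GaussMeas 𝕏 × 𝕏 => obsVar τ p.1 p.2 :=
  (measurable_covFun.comp
    (g := fun p : GaussMeas 𝕏 × 𝕏 × 𝕏 => covFun p.1 p.2.1 p.2.2)
    (f := fun p : GaussMeas 𝕏 × 𝕏 => (p.1, p.2, p.2)) (by fun_prop)).add
    (((measurable_noise τ).comp measurable_snd).pow_const 2)

/-- The one-step update depends measurably on the design point, the observation and the prior. -/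
theorem measurable_condObs (τ : C(𝕏, ℝ≥0)) :
    Measurable fun p : 𝕏 × ℝ × GaussMeas 𝕏 => condObs τ p.1 p.2.1 p.2.2 := by
  refine Measurable.subtype_mk (Measure.measurable_of_measurable_coe _ fun s hs => ?_)
  have hmap : Measurable fun q : (𝕏 × ℝ × GaussMeas 𝕏) × (C(𝕏, ℝ) × ℝ) =>
      condMap τ q.1.1 q.1.2.1 q.1.2.2 q.2 := by
    have h1 : Measurable fun q : (𝕏 × ℝ × GaussMeas 𝕏) × (C(𝕏, ℝ) × ℝ) => q.2.1 q.1.1 :=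
      measurable_eval.comp ((measurable_fst.comp measurable_snd).prodMk (by fun_prop))
    have h2 : Measurable fun q : (𝕏 × ℝ × GaussMeas 𝕏) × (C(𝕏, ℝ) × ℝ) => (τ q.1.1 : ℝ) :=
      (measurable_noise τ).comp (by fun_prop)
    have h3 : Measurable fun q : (𝕏 × ℝ × GaussMeas 𝕏) × (C(𝕏, ℝ) × ℝ) =>
        obsVar τ q.1.2.2 q.1.1 :=
      (measurable_obsVar τ).comp (Measurable.prodMk (by fun_prop) (by fun_prop))
    have h4 : Measurable fun q : (𝕏 × ℝ × GaussMeas 𝕏) × (C(𝕏, ℝ) × ℝ) =>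
        covCol q.1.2.2 q.1.1 :=
      measurable_covCol.comp (Measurable.prodMk (by fun_prop) (by fun_prop))
    unfold condMap
    fun_prop
  -- the value of the update at `s` is the mass of a section under the joint law of path and noise
  let κ : Kernel (𝕏 × ℝ × GaussMeas 𝕏) (C(𝕏, ℝ) × ℝ) :=
    ((gaussKernel 𝕏).comap (fun p => p.2.2) (by fun_prop)) ×ₖ
      Kernel.const _ (gaussianReal 0 1)
  have := Kernel.measurable_kernel_prodMk_left (κ := κ) (hmap hs)
  have e : (fun p : 𝕏 × ℝ × GaussMeas 𝕏 => (condObs τ p.1 p.2.1 p.2.2).1 s) =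
      fun p => κ p (Prod.mk p ⁻¹'
        ((fun q : (𝕏 × ℝ × GaussMeas 𝕏) × (C(𝕏, ℝ) × ℝ) =>
          condMap τ q.1.1 q.1.2.1 q.1.2.2 q.2) ⁻¹' s)) := by
    funext p
    simp only [κ]
    rw [condObs, Measure.map_apply (measurable_condMap _ _ _ _) hs, Kernel.prod_apply,
      Kernel.comap_apply, Kernel.const_apply]
    rfl
  exact e ▸ this

end Kernel

section OneStep

variable {𝕏 : Type v} [MetricSpace 𝕏] [CompactSpace 𝕏]

/-- The joint law of the process and of the noise variable of one observation. -/
noncomputable abbrev noisyLaw (ν : GaussMeas 𝕏) : Measure (C(𝕏, ℝ) × ℝ) :=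
  ν.1.prod (gaussianReal 0 1)

/-- The noisy observation at `x`. -/
def noisyEval (τ : C(𝕏, ℝ≥0)) (x : 𝕏) (p : C(𝕏, ℝ) × ℝ) : ℝ := p.1 x + τ x * p.2

/-- The noisy observation at `x`, as a continuous linear functional. -/
noncomputable def noisyEvalCLM (τ : C(𝕏, ℝ≥0)) (x : 𝕏) : C(𝕏, ℝ) × ℝ →L[ℝ] ℝ :=
  (ContinuousMap.evalCLM ℝ x).comp (ContinuousLinearMap.fst ℝ _ _) +
    (τ x : ℝ) • ContinuousLinearMap.snd ℝ _ _

theorem noisyEvalCLM_apply (τ : C(𝕏, ℝ≥0)) (x : 𝕏) (p : C(𝕏, ℝ) × ℝ) :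
    noisyEvalCLM τ x p = noisyEval τ x p := by
  simp [noisyEvalCLM, noisyEval]

theorem measurable_noisyEval (τ : C(𝕏, ℝ≥0)) (x : 𝕏) : Measurable (noisyEval τ x) := by
  have := (noisyEvalCLM τ x).continuous.measurable
  rwa [funext (noisyEvalCLM_apply τ x)] at this

theorem measurable_noisyEval_comp [MeasurableSpace 𝕏] [BorelSpace 𝕏] {Ω : Type*}
    {mΩ : MeasurableSpace Ω} (τ : C(𝕏, ℝ≥0)) {x : Ω → 𝕏} (hx : Measurable x) :
    Measurable fun q : Ω × (C(𝕏, ℝ) × ℝ) => noisyEval τ (x q.1) q.2 := by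
  have h1 : Measurable fun q : Ω × (C(𝕏, ℝ) × ℝ) => q.2.1 (x q.1) :=
    measurable_eval.comp ((measurable_fst.comp measurable_snd).prodMk (hx.comp measurable_fst))
  have h2 : Measurable fun q : Ω × (C(𝕏, ℝ) × ℝ) => (τ (x q.1) : ℝ) :=
    (measurable_noise τ).comp (hx.comp measurable_fst)
  exact h1.add (h2.mul (measurable_snd.comp measurable_snd))

/-- The residual `ξ - k(·, x) W / s²(x)` of the process after regression on the observation
`W = ξ(x) + τ(x) e`, as a continuous linear map of `(ξ, e)`. -/
noncomputable def residualCLM (τ : C(𝕏, ℝ≥0)) (x : 𝕏) (ν : GaussMeas 𝕏) :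
    C(𝕏, ℝ) × ℝ →L[ℝ] C(𝕏, ℝ) :=
  ContinuousLinearMap.fst ℝ _ _ - ((obsVar τ ν x)⁻¹ • noisyEvalCLM τ x).smulRight (covCol ν x)

/-- The update map adds to the residual the part of the process that the observed value `z`
explains. -/
theorem condMap_eq (τ : C(𝕏, ℝ≥0)) (x : 𝕏) (z : ℝ) (ν : GaussMeas 𝕏) (p : C(𝕏, ℝ) × ℝ) :
    condMap τ x z ν p = residualCLM τ x ν p + (z / obsVar τ ν x) • covCol ν x := by
  ext y
  simp [condMap, residualCLM, noisyEvalCLM]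
  ring

/-- Inserting the actual observation into the update map recovers the process. -/
theorem condMap_noisyEval (τ : C(𝕏, ℝ≥0)) (x : 𝕏) (ν : GaussMeas 𝕏) (p : C(𝕏, ℝ) × ℝ) :
    condMap τ x (noisyEval τ x p) ν p = p.1 := by
  ext y
  simp [condMap, noisyEval]

theorem memLp_noisyEval_parts (τ : C(𝕏, ℝ≥0)) (x : 𝕏) (ν : GaussMeas 𝕏) :
    (∀ y, MemLp (fun p : C(𝕏, ℝ) × ℝ => p.1 y) 2 (noisyLaw ν)) ∧
      MemLp (fun p : C(𝕏, ℝ) × ℝ => (τ x : ℝ) * p.2) 2 (noisyLaw ν) :=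
  ⟨fun y => (memLp_eval ν y).comp_fst (gaussianReal 0 1),
    ((memLp_id_gaussianReal' (μ := 0) (v := 1) 2 (by simp)).comp_snd ν.1).const_mul _⟩

theorem memLp_noisyEval (τ : C(𝕏, ℝ≥0)) (x : 𝕏) (ν : GaussMeas 𝕏) :
    MemLp (noisyEval τ x) 2 (noisyLaw ν) :=
  ((memLp_noisyEval_parts τ x ν).1 x).add (memLp_noisyEval_parts τ x ν).2

theorem covariance_fst_noisyEval (τ : C(𝕏, ℝ≥0)) (x : 𝕏) (ν : GaussMeas 𝕏) (y : 𝕏) :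
    cov[fun p : C(𝕏, ℝ) × ℝ => p.1 y, noisyEval τ x; noisyLaw ν] = covFun ν y x := by
  obtain ⟨hL, he⟩ := memLp_noisyEval_parts τ x ν
  have h1 : cov[fun p : C(𝕏, ℝ) × ℝ => p.1 y, noisyEval τ x; noisyLaw ν] = _ :=
    covariance_add_right (hL y) (hL x) he
  have h2 : cov[fun p : C(𝕏, ℝ) × ℝ => p.1 y, fun p => p.1 x; noisyLaw ν] = covFun ν y x := by
    have : ν.1 = (noisyLaw ν).map Prod.fst := by simp
    rw [covFun, this, covariance_map (continuous_eval_const y).aestronglyMeasurable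
      (continuous_eval_const x).aestronglyMeasurable measurable_fst.aemeasurable]
    simp [Function.comp_def]
  have h3 : cov[fun p : C(𝕏, ℝ) × ℝ => p.1 y, fun p => (τ x : ℝ) * p.2; noisyLaw ν] = 0 :=
    IndepFun.covariance_eq_zero
      (indepFun_prod (measurable_eval_const y) (measurable_const_mul _)) (hL y) he
  rw [h1, h2, h3, add_zero]

theorem variance_noisyEval (τ : C(𝕏, ℝ≥0)) (x : 𝕏) (ν : GaussMeas 𝕏) :
    cov[noisyEval τ x, noisyEval τ x; noisyLaw ν] = obsVar τ ν x := by
  obtain ⟨hL, he⟩ := memLp_noisyEval_parts τ x ν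
  have h1 : cov[noisyEval τ x, noisyEval τ x; noisyLaw ν] = _ :=
    covariance_add_left (hL x) he (memLp_noisyEval τ x ν)
  have h2 : cov[fun p => (τ x : ℝ) * p.2, noisyEval τ x; noisyLaw ν] = _ :=
    covariance_add_right he (hL x) he
  have h3 : cov[fun p : C(𝕏, ℝ) × ℝ => p.1 x, fun p => (τ x : ℝ) * p.2; noisyLaw ν] = 0 :=
    IndepFun.covariance_eq_zero
      (indepFun_prod (measurable_eval_const x) (measurable_const_mul _)) (hL x) he
  have h4 : cov[fun p : C(𝕏, ℝ) × ℝ => (τ x : ℝ) * p.2, fun p => (τ x : ℝ) * p.2; noisyLaw ν]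
      = (τ x : ℝ) ^ 2 := by
    rw [covariance_const_mul_left, covariance_const_mul_right]
    have hg : gaussianReal 0 1 = (noisyLaw ν).map Prod.snd := by simp
    have : cov[fun p : C(𝕏, ℝ) × ℝ => p.2, fun p => p.2; noisyLaw ν]
        = cov[fun e : ℝ => e, fun e : ℝ => e; gaussianReal 0 1] := by
      rw [hg, covariance_map (by fun_prop) (by fun_prop) measurable_snd.aemeasurable]
      simp [Function.comp_def]
    rw [this, covariance_self (by fun_prop), variance_fun_id_gaussianReal]
    simp [sq]
  rw [h1, h2, covariance_fst_noisyEval, covariance_comm, h3, h4, zero_add, obsVar]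

/-- The covariance of a functional of a random vector `R` with a random variable `W` is the value of
the functional at the cross-covariance vector. -/
theorem covariance_dual_comp {Ω E : Type*} [MeasurableSpace Ω] {Q : Measure Ω}
    [IsProbabilityMeasure Q] [NormedAddCommGroup E] [NormedSpace ℝ E] [CompleteSpace E]
    {R : Ω → E} {W : Ω → ℝ} (hR : MemLp R 2 Q) (hW : MemLp W 2 Q) (L : StrongDual ℝ E) :
    cov[fun ω => L (R ω), W; Q] = L (∫ ω, (W ω - Q[W]) • R ω ∂Q) := by
  have h2 : MemLp (fun ω => W ω - Q[W]) 2 Q := hW.sub (memLp_const _)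
  have hint : Integrable (fun ω => (W ω - Q[W]) • R ω) Q := memLp_one_iff_integrable.1 (hR.smul h2)
  have hL : MemLp (fun ω => L (R ω)) 2 Q := L.comp_memLp' hR
  rw [← L.integral_comp_comm hint, covariance]
  have hi : Integrable (fun ω => L (R ω) * (W ω - Q[W])) Q := hL.integrable_mul h2
  have h1 : Integrable (fun ω => W ω - Q[W]) Q := h2.integrable (by simp)
  have hz : ∫ ω, (W ω - Q[W]) ∂Q = 0 := by
    rw [integral_sub (hW.integrable (by simp)) (integrable_const _)]
    simp
  simp only [sub_mul]
  rw [integral_sub hi (h1.const_mul _), integral_const_mul, hz]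
  simp [mul_comm]

/-- Regression residual and observation are jointly Gaussian and uncorrelated. When `s²(x) = 0`
this still holds, with the convention `a / 0 = 0`, because `k(·, x)` is then the covariance with a
constant. -/
theorem indepFun_residual (τ : C(𝕏, ℝ≥0)) (x : 𝕏) (ν : GaussMeas 𝕏) :
    IndepFun (residualCLM τ x ν) (noisyEval τ x) (noisyLaw ν) := by
  have hR : MemLp (residualCLM τ x ν) 2 (noisyLaw ν) :=
    (residualCLM τ x ν).comp_memLp' (IsGaussian.memLp_two_id (μ := noisyLaw ν))
  have hW := memLp_noisyEval τ x ν
  have hfun : (noisyEvalCLM τ x : C(𝕏, ℝ) × ℝ → ℝ) = noisyEval τ x :=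
    funext (noisyEvalCLM_apply τ x)
  have hG : HasGaussianLaw (fun p => (residualCLM τ x ν p, noisyEval τ x p)) (noisyLaw ν) := by
    have := (IsGaussian.hasGaussianLaw_id (μ := noisyLaw ν)).map
      ((residualCLM τ x ν).prod (noisyEvalCLM τ x))
    rw [← hfun]
    exact this
  -- the regression coefficient makes the cross-covariance vector vanish at every `y`
  have hcross : ∫ p, (noisyEval τ x p - (noisyLaw ν)[noisyEval τ x]) • residualCLM τ x ν p
      ∂(noisyLaw ν) = 0 := by
    ext y
    have h := covariance_dual_comp hR hW (ContinuousMap.evalCLM ℝ y)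
    have hy : (fun p => ContinuousMap.evalCLM ℝ y (residualCLM τ x ν p)) =
        fun p : C(𝕏, ℝ) × ℝ => p.1 y - covFun ν y x / obsVar τ ν x * noisyEval τ x p := by
      funext p
      simp [residualCLM, noisyEvalCLM_apply, covCol]
      ring
    rw [hy, covariance_fun_sub_left ((memLp_noisyEval_parts τ x ν).1 y) (hW.const_mul _) hW,
      covariance_fst_noisyEval, covariance_const_mul_left, variance_noisyEval] at h
    have h' : ContinuousMap.evalCLM ℝ y (∫ p, (noisyEval τ x p - (noisyLaw ν)[noisyEval τ x]) •
        residualCLM τ x ν p ∂(noisyLaw ν)) = 0 := by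
      rw [← h]
      by_cases h0 : obsVar τ ν x = 0
      · -- a constant observation is uncorrelated with every value of the process
        have hv : Var[noisyEval τ x; noisyLaw ν] = 0 := by
          rw [← covariance_self hW.aemeasurable, variance_noisyEval, h0]
        have hcs := sq_covariance_le ((memLp_noisyEval_parts τ x ν).1 y) hW
        rw [hv, covariance_fst_noisyEval, mul_zero] at hcs
        simp [(pow_eq_zero_iff two_ne_zero).1 (le_antisymm hcs (sq_nonneg _))]
      · field_simp
        simp
    exact h'
  refine hG.indepFun_of_covariance_strongDual fun L₁ L₂ => ?_
  have hL₂ : L₂ ∘ noisyEval τ x = fun p => L₂ 1 * noisyEval τ x p := by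
    funext p
    have := L₂.map_smul (noisyEval τ x p) 1
    simp only [smul_eq_mul, mul_one] at this
    simp [this, mul_comm]
  rw [hL₂, covariance_const_mul_right]
  change L₂ 1 * cov[fun p => L₁ (residualCLM τ x ν p), noisyEval τ x; noisyLaw ν] = 0
  rw [covariance_dual_comp hR hW, hcross]
  simp

/-- `condObs τ x z ν` is a disintegration of the joint law of the process and of its noisy
observation at `x`. -/
theorem lintegral_condObs (τ : C(𝕏, ℝ≥0)) (x : 𝕏) (ν : GaussMeas 𝕏)
    {G : ℝ × C(𝕏, ℝ) → ℝ≥0∞} (hG : Measurable G) :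
    ∫⁻ p, ∫⁻ f, G (noisyEval τ x p, f) ∂(condObs τ x (noisyEval τ x p) ν).1 ∂(noisyLaw ν)
      = ∫⁻ p, G (noisyEval τ x p, p.1) ∂(noisyLaw ν) := by
  have hR : Measurable (residualCLM τ x ν) := (residualCLM τ x ν).continuous.measurable
  have hW := measurable_noisyEval τ x
  have hind := (indepFun_iff_map_prod_eq_prod_map_map hR.aemeasurable hW.aemeasurable).1
    (indepFun_residual τ x ν)
  have hJ : Measurable fun q : C(𝕏, ℝ) × ℝ =>
      G (q.2, q.1 + (q.2 / obsVar τ ν x) • covCol ν x) := by fun_prop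
  have : IsProbabilityMeasure ((noisyLaw ν).map (residualCLM τ x ν)) :=
    Measure.isProbabilityMeasure_map hR.aemeasurable
  have : IsProbabilityMeasure ((noisyLaw ν).map (noisyEval τ x)) :=
    Measure.isProbabilityMeasure_map hW.aemeasurable
  have e1 : ∀ p, G (noisyEval τ x p, p.1) = G (noisyEval τ x p,
      residualCLM τ x ν p + (noisyEval τ x p / obsVar τ ν x) • covCol ν x) := by
    intro p
    rw [← condMap_eq, condMap_noisyEval]
  have e2 : ∀ w, ∫⁻ f, G (w, f) ∂(condObs τ x w ν).1 =
      ∫⁻ r, G (w, r + (w / obsVar τ ν x) • covCol ν x) ∂(noisyLaw ν).map (residualCLM τ x ν) := by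
    intro w
    rw [condObs, lintegral_map (by fun_prop) (measurable_condMap τ x w ν),
      lintegral_map (by fun_prop) hR]
    simp only [condMap_eq]
  simp only [e1, e2]
  rw [← lintegral_map (f := fun w => ∫⁻ r, G (w, r + (w / obsVar τ ν x) • covCol ν x)
      ∂(noisyLaw ν).map (residualCLM τ x ν)) (Measurable.lintegral_prod_left hJ) hW,
    ← lintegral_map (f := fun q : C(𝕏, ℝ) × ℝ =>
      G (q.2, q.1 + (q.2 / obsVar τ ν x) • covCol ν x)) hJ (hR.prodMk hW), hind,
    lintegral_prod_symm _ hJ.aemeasurable]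

end OneStep

/-! ### Conditional distributions -/

section Disintegration

variable {𝕏 : Type v} [MetricSpace 𝕏] [CompactSpace 𝕏]

/-- `ν` is a conditional distribution of `ξ` given the random variable `π`, in integrated form:
the joint law of `(π, ξ)` is the law of `π` followed by the kernel `ν`. The σ-algebra of a
conditioning is encoded by taking for `π` the identity map into `Ω` with the smaller σ-algebra. -/
def Disintegrates {Ω Ω' : Type*} {mΩ : MeasurableSpace Ω} [mΩ' : MeasurableSpace Ω']
    (P : Measure Ω) (π : Ω → Ω') (ξ : Ω → C(𝕏, ℝ)) (ν : Ω' → GaussMeas 𝕏) : Prop :=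
  ∀ G : Ω' × C(𝕏, ℝ) → ℝ≥0∞, Measurable G →
    ∫⁻ ω, G (π ω, ξ ω) ∂P = ∫⁻ ω, ∫⁻ f, G (π ω, f) ∂(ν (π ω)).1 ∂P

section

variable {Ω Ω' : Type*} {mΩ : MeasurableSpace Ω} {mΩ' : MeasurableSpace Ω'} {P : Measure Ω}
  [IsProbabilityMeasure P] {π : Ω → Ω'} {ξ : Ω → C(𝕏, ℝ)} {ν : Ω' → GaussMeas 𝕏}

theorem measurable_lintegral_gaussMeas (hν : Measurable ν) {G : Ω' × C(𝕏, ℝ) → ℝ≥0∞}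
    (hG : Measurable G) : Measurable fun q => ∫⁻ f, G (q, f) ∂(ν q).1 := by
  have := hG.lintegral_kernel_prod_right' (κ := (gaussKernel 𝕏).comap ν hν)
  simpa only [Kernel.comap_apply, gaussKernel_apply] using this

/-- Uniqueness of conditional distributions: a measurable family with the defining identity on
rectangles agrees almost surely with `condDistrib`. -/
theorem ae_eq_condDistrib (hπ : Measurable π) (hξ : Measurable ξ) (hν : Measurable ν)
    (h : ∀ A, MeasurableSet A → ∀ B, MeasurableSet B →
      P (π ⁻¹' A ∩ ξ ⁻¹' B) = ∫⁻ ω in π ⁻¹' A, (ν (π ω)).1 B ∂P) :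
    ∀ᵐ ω ∂P, (ν (π ω)).1 = condDistrib ξ π P (π ω) := by
  let κ : Kernel Ω' C(𝕏, ℝ) := (gaussKernel 𝕏).comap ν hν
  have key : P.map (fun ω => (π ω, ξ ω)) = P.map π ⊗ₘ κ := by
    refine Measure.ext_prod fun {A B} hA hB => ?_
    rw [Measure.map_apply (hπ.prodMk hξ) (hA.prod hB), Measure.compProd_apply_prod hA hB,
      setLIntegral_map hA (κ.measurable_coe hB) hπ]
    exact h A hA B hB
  filter_upwards [ae_of_ae_map hπ.aemeasurable
    (condDistrib_ae_eq_of_measure_eq_compProd π hξ.aemeasurable key)] with ω hω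
  rw [hω]
  rfl

theorem disintegrates_of_ae_eq (hπ : Measurable π) (hξ : Measurable ξ)
    (h : ∀ᵐ ω ∂P, (ν (π ω)).1 = condDistrib ξ π P (π ω)) : Disintegrates P π ξ ν := by
  intro G hG
  rw [← lintegral_map hG (hπ.prodMk hξ), ← compProd_map_condDistrib hξ.aemeasurable,
    Measure.lintegral_compProd hG, lintegral_map hG.lintegral_kernel_prod_right' hπ]
  refine lintegral_congr_ae ?_
  filter_upwards [h] with ω hω
  rw [hω]

/-- Adjoining a standard normal variable that is independent of `(π, ξ)`. -/
theorem Disintegrates.lintegral_noisyLaw (h : Disintegrates P π ξ ν) (hπ : Measurable π)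
    (hξ : Measurable ξ) {e : Ω → ℝ} (he : Measurable e)
    (hlaw : P.map e = gaussianReal 0 1) (hind : IndepFun (fun ω => (π ω, ξ ω)) e P)
    {H : Ω' × (C(𝕏, ℝ) × ℝ) → ℝ≥0∞} (hH : Measurable H) :
    ∫⁻ ω, H (π ω, (ξ ω, e ω)) ∂P = ∫⁻ ω, ∫⁻ p, H (π ω, p) ∂(noisyLaw (ν (π ω))) ∂P := by
  have hJ : Measurable fun q : (Ω' × C(𝕏, ℝ)) × ℝ => H (q.1.1, (q.1.2, q.2)) :=
    hH.comp (by fun_prop)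
  have hG : Measurable fun q : Ω' × C(𝕏, ℝ) => ∫⁻ t, H (q.1, (q.2, t)) ∂(gaussianReal 0 1) :=
    hJ.lintegral_prod_right'
  have h1 := (indepFun_iff_map_prod_eq_prod_map_map (hπ.prodMk hξ).aemeasurable
    he.aemeasurable).1 hind
  rw [hlaw] at h1
  have : IsProbabilityMeasure (P.map fun ω => (π ω, ξ ω)) :=
    Measure.isProbabilityMeasure_map (hπ.prodMk hξ).aemeasurable
  calc ∫⁻ ω, H (π ω, (ξ ω, e ω)) ∂P
      = ∫⁻ q, H (q.1.1, (q.1.2, q.2)) ∂(P.map fun ω => ((π ω, ξ ω), e ω)) :=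
        (lintegral_map hJ ((hπ.prodMk hξ).prodMk he)).symm
    _ = ∫⁻ ω, ∫⁻ t, H (π ω, (ξ ω, t)) ∂(gaussianReal 0 1) ∂P := by
        rw [h1, lintegral_prod _ hJ.aemeasurable, lintegral_map hG (hπ.prodMk hξ)]
    _ = _ := by
        rw [h _ hG]
        refine lintegral_congr fun ω => ?_
        exact (lintegral_prod (fun p => H (π ω, p)) (hH.comp (by fun_prop)).aemeasurable).symm

/-- One step of sequential conditioning: if `ν` disintegrates `ξ` given `π`, the design point is a
function of `π` and the noise is independent of `(π, ξ)`, then the one-step update of `ν`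
disintegrates `ξ` given `π` and the new observation. -/
theorem Disintegrates.condObs [MeasurableSpace 𝕏] [BorelSpace 𝕏] (τ : C(𝕏, ℝ≥0))
    (h : Disintegrates P π ξ ν) (hπ : Measurable π)
    (hξ : Measurable ξ) (hν : Measurable ν) {e : Ω → ℝ} (he : Measurable e)
    (hlaw : P.map e = gaussianReal 0 1) (hind : IndepFun (fun ω => (π ω, ξ ω)) e P)
    {x : Ω' → 𝕏} (hx : Measurable x) :
    Disintegrates P (fun ω => (π ω, noisyEval τ (x (π ω)) (ξ ω, e ω))) ξ
      (fun q : Ω' × ℝ => SUR.condObs τ (x q.1) q.2 (ν q.1)) := by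
  intro G hG
  have hZ := measurable_noisyEval_comp τ hx
  have hc : Measurable fun q : Ω' × ℝ => SUR.condObs τ (x q.1) q.2 (ν q.1) :=
    (measurable_condObs τ).comp (f := fun q : Ω' × ℝ => (x q.1, q.2, ν q.1))
      ((hx.comp measurable_fst).prodMk (measurable_snd.prodMk (hν.comp measurable_fst)))
  -- `K` names the inner integral, which keeps the updated measure from being unfolded below
  obtain ⟨K, hK, hKe⟩ : ∃ K : Ω' × ℝ → ℝ≥0∞, Measurable K ∧
      ∀ q, ∫⁻ f, G (q, f) ∂(SUR.condObs τ (x q.1) q.2 (ν q.1)).1 = K q :=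
    ⟨_, measurable_lintegral_gaussMeas hc hG, fun _ => rfl⟩
  have e1 := h.lintegral_noisyLaw hπ hξ he hlaw hind
    (H := fun q => G ((q.1, noisyEval τ (x q.1) q.2), q.2.1))
    (hG.comp ((measurable_fst.prodMk hZ).prodMk (measurable_fst.comp measurable_snd)))
  have e2 := h.lintegral_noisyLaw hπ hξ he hlaw hind
    (H := fun q => K (q.1, noisyEval τ (x q.1) q.2)) (hK.comp (measurable_fst.prodMk hZ))
  refine e1.trans (Eq.trans (lintegral_congr fun ω => ?_)
    (e2.symm.trans (lintegral_congr fun ω => (hKe _).symm)))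
  rw [← lintegral_condObs τ (x (π ω)) (ν (π ω)) (G := fun q => G ((π ω, q.1), q.2))
    (hG.comp (by fun_prop))]
  exact lintegral_congr fun p => hKe (π ω, noisyEval τ (x (π ω)) p)

end

/-- `ν` is an `𝓕`-measurable version of the regular conditional distribution of `ξ` given `𝓕` with
values in the Gaussian measures. -/
structure IsRegCond {Ω : Type u} {mΩ : MeasurableSpace Ω} (P : Measure[mΩ] Ω)
    [IsFiniteMeasure P] (ξ : Ω → C(𝕏, ℝ)) (𝓕 : MeasurableSpace Ω) (ν : Ω → GaussMeas 𝕏) : Prop where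
  le : 𝓕 ≤ mΩ
  measurable : Measurable[𝓕] ν
  ae_eq : ∀ᵐ ω ∂P, (ν ω).1 = @condDistrib Ω Ω C(𝕏, ℝ) _ _ _ mΩ 𝓕 ξ id P _ ω

variable {Ω : Type u} {𝓕 mΩ : MeasurableSpace Ω} {P : Measure Ω} [IsProbabilityMeasure P]
  {ξ : Ω → C(𝕏, ℝ)} {ν : Ω → GaussMeas 𝕏}

theorem IsRegCond.integral_ae_eq (h : IsRegCond P ξ 𝓕 ν) (hξ : Measurable ξ) {g : C(𝕏, ℝ) → ℝ}
    (hg : Measurable g) (hint : Integrable (fun ω => g (ξ ω)) P) :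
    (fun ω => ∫ f, g f ∂(ν ω).1) =ᵐ[P] P[fun ω => g (ξ ω) | 𝓕] := by
  have h1 := condExp_ae_eq_integral_condDistrib (mβ := 𝓕) (X := id) (measurable_id'' h.le)
    hξ.aemeasurable hg.stronglyMeasurable hint
  rw [MeasurableSpace.comap_id] at h1
  filter_upwards [h1, h.ae_eq] with ω h2 h3
  rw [h2, h3, id]

theorem IsRegCond.isCondLaw (h : IsRegCond P ξ 𝓕 ν) (hξ : Measurable ξ) :
    IsCondLaw P ξ 𝓕 ν := by
  refine ⟨h.measurable.mono h.le le_rfl, fun A hA => ?_⟩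
  have h1 := condDistrib_ae_eq_condExp (mβ := 𝓕) (X := id) (μ := P) (measurable_id'' h.le) hξ hA
  rw [MeasurableSpace.comap_id] at h1
  filter_upwards [h1, h.ae_eq] with ω h2 h3
  rw [← h2, h3, id]

theorem IsRegCond.disintegrates (h : IsRegCond P ξ 𝓕 ν) (hξ : Measurable ξ) :
    Disintegrates (mΩ' := 𝓕) P id ξ ν := by
  exact disintegrates_of_ae_eq (mΩ' := 𝓕) (measurable_id'' h.le) hξ h.ae_eq

theorem isRegCond_of_disintegrates (hle : 𝓕 ≤ mΩ) (hξ : Measurable ξ) (hν : Measurable[𝓕] ν)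
    (h : ∀ A, MeasurableSet[𝓕] A → ∀ B, MeasurableSet B →
      P (A ∩ ξ ⁻¹' B) = ∫⁻ ω in A, (ν ω).1 B ∂P) :
    IsRegCond P ξ 𝓕 ν := by
  exact ⟨hle, hν, ae_eq_condDistrib (mΩ' := 𝓕) (measurable_id'' hle) hξ hν h⟩

end Disintegration

/-! ### Posterior distributions of a sequential design -/

section Independence

theorem indepFun_prodMk_of_prodMk {Ω α β γ : Type*} [MeasurableSpace Ω] [MeasurableSpace α]
    [MeasurableSpace β] [MeasurableSpace γ] {P : Measure Ω} [IsProbabilityMeasure P]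
    {a : Ω → α} {b : Ω → β} {c : Ω → γ} (ha : Measurable a) (hb : Measurable b) (hc : Measurable c)
    (h : IndepFun a (fun ω => (b ω, c ω)) P) (hbc : IndepFun b c P) :
    IndepFun (fun ω => (a ω, b ω)) c P := by
  have hab : IndepFun a b P := h.comp measurable_id measurable_fst
  rw [indepFun_iff_map_prod_eq_prod_map_map (by fun_prop) (by fun_prop)] at h hbc hab ⊢
  have : IsProbabilityMeasure (P.map a) := Measure.isProbabilityMeasure_map (by fun_prop)
  have : IsProbabilityMeasure (P.map b) := Measure.isProbabilityMeasure_map (by fun_prop)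
  have : IsProbabilityMeasure (P.map c) := Measure.isProbabilityMeasure_map (by fun_prop)
  have e : (fun ω => ((a ω, b ω), c ω)) =
      MeasurableEquiv.prodAssoc.symm ∘ fun ω => (a ω, (b ω, c ω)) := rfl
  rw [hab, e, ← Measure.map_map (by fun_prop) (by fun_prop), h, hbc, ← Measure.prodAssoc_prod,
    Measure.map_map (by fun_prop) (by fun_prop)]
  simp

end Independence

section Posterior

variable {𝕏 : Type v} [MetricSpace 𝕏] [CompactSpace 𝕏]
variable {Ω : Type u} [mΩ : MeasurableSpace Ω] {P : Measure Ω} [IsProbabilityMeasure P]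

theorem GPModel.measurable_path (M : GPModel 𝕏 P) : Measurable M.ξ :=
  SUR.measurable_path M.measurable_ξ

/-- The noise of an observation is independent of the process and of the earlier noise. -/
theorem GPModel.indepFun_noise (M : GPModel 𝕏 P) (n : ℕ) :
    IndepFun (fun ω => (M.ξ ω, fun i : Finset.range n => M.U i ω)) (M.U n) P := by
  -- the Borel σ-algebra of the path space is generated by the evaluations
  have h1 : IndepFun M.ξ (fun ω n => M.U n ω) P := by
    refine indep_of_indep_of_le_left M.indepFun_ξ_U ?_
    have : @Measurable _ _ (MeasurableSpace.comap (fun ω x => M.ξ ω x) MeasurableSpace.pi) _ M.ξ :=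
      @SUR.measurable_path 𝕏 _ _ Ω (MeasurableSpace.comap (fun ω x => M.ξ ω x) MeasurableSpace.pi)
        M.ξ fun x => (measurable_pi_apply x).comp (comap_measurable _)
    exact this.comap_le
  have h2 : IndepFun (fun ω (i : Finset.range n) => M.U i ω) (M.U n) P :=
    (M.iIndepFun_U.indepFun_finset (Finset.range n) {n} (by simp) M.measurable_U).comp
      measurable_id (measurable_pi_apply (⟨n, by simp⟩ : ({n} : Finset ℕ)))
  have hU := M.measurable_U
  refine indepFun_prodMk_of_prodMk M.measurable_path (by fun_prop) (hU n) ?_ h2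
  exact h1.comp measurable_id (ψ := fun u : ℕ → ℝ => (fun i : Finset.range n => u i, u n))
    (by fun_prop)

/-- The σ-algebra generated by the process and by the first `n` noise variables. -/
abbrev GPModel.sigma (M : GPModel 𝕏 P) (n : ℕ) : MeasurableSpace Ω :=
  MeasurableSpace.comap (fun ω => (M.ξ ω, fun i : Finset.range n => M.U i ω)) inferInstance

theorem GPModel.measurable_sigma_ξ (M : GPModel 𝕏 P) (n : ℕ) : Measurable[M.sigma n] M.ξ :=
  measurable_fst.comp (comap_measurable _)

theorem GPModel.measurable_sigma_U (M : GPModel 𝕏 P) {n i : ℕ} (hi : i < n) :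
    Measurable[M.sigma n] (M.U i) := by
  have h : Measurable fun q : C(𝕏, ℝ) × (Finset.range n → ℝ) =>
      q.2 ⟨i, Finset.mem_range.2 hi⟩ := by fun_prop
  exact h.comp (comap_measurable fun ω => (M.ξ ω, fun i : Finset.range n => M.U i ω))

variable [MeasurableSpace 𝕏]

theorem obsSigma_zero (τ : C(𝕏, ℝ≥0)) (M : GPModel 𝕏 P) (X : ℕ → Ω → 𝕏) :
    obsSigma τ M X 0 = ⊥ := by
  simp [obsSigma]

theorem obsSigma_succ (τ : C(𝕏, ℝ≥0)) (M : GPModel 𝕏 P) (X : ℕ → Ω → 𝕏) (n : ℕ) :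
    obsSigma τ M X (n + 1) = obsSigma τ M X n ⊔ (MeasurableSpace.comap (X n) inferInstance ⊔
      MeasurableSpace.comap (obs τ M X n) inferInstance) :=
  Nat.iSup_lt_succ _ n

theorem measurable_design_succ (τ : C(𝕏, ℝ≥0)) (M : GPModel 𝕏 P) (X : ℕ → Ω → 𝕏) (n : ℕ) :
    Measurable[obsSigma τ M X (n + 1)] (X n) := by
  rw [obsSigma_succ]
  exact Measurable.mono (comap_measurable _) (le_sup_left.trans le_sup_right) le_rfl

theorem measurable_obs_succ (τ : C(𝕏, ℝ≥0)) (M : GPModel 𝕏 P) (X : ℕ → Ω → 𝕏) (n : ℕ) :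
    Measurable[obsSigma τ M X (n + 1)] (obs τ M X n) := by
  rw [obsSigma_succ]
  exact Measurable.mono (comap_measurable _) (le_sup_right.trans le_sup_right) le_rfl

variable [BorelSpace 𝕏]

theorem measurable_postLaw (τ : C(𝕏, ℝ≥0)) (M : GPModel 𝕏 P) (X : ℕ → Ω → 𝕏) (n : ℕ) :
    Measurable[obsSigma τ M X n] (postLaw τ M X n) := by
  induction n with
  | zero => exact measurable_const
  | succ n ih =>
    have h1 := measurable_design_succ τ M X n
    have h2 := measurable_obs_succ τ M X n
    have h3 : Measurable[obsSigma τ M X (n + 1)] (postLaw τ M X n) :=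
      ih.mono (obsSigma_mono τ M X n.le_succ) le_rfl
    exact @Measurable.comp Ω (𝕏 × ℝ × GaussMeas 𝕏) (GaussMeas 𝕏) (obsSigma τ M X (n + 1)) _ _ _
      (fun ω => (X n ω, obs τ M X n ω, postLaw τ M X n ω)) (measurable_condObs τ)
      (@Measurable.prodMk _ (obsSigma τ M X (n + 1)) _ _ _ _ _ _ h1
        (@Measurable.prodMk _ (obsSigma τ M X (n + 1)) _ _ _ _ _ _ h2 h3))

/-- The first `n` design points and observations are functions of the process and of the first `n`
noise variables. -/
theorem obsSigma_le_comap {τ : C(𝕏, ℝ≥0)} {M : GPModel 𝕏 P} {X : ℕ → Ω → 𝕏}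
    (hX : IsDesign τ M X) (n : ℕ) : obsSigma τ M X n ≤ M.sigma n := by
  suffices ∀ m ≤ n, obsSigma τ M X m ≤ (M.sigma n) from this n le_rfl
  intro m
  induction m using Nat.strong_induction_on with
  | _ m ih =>
    intro hm
    refine iSup₂_le fun i hi => ?_
    have hXi : Measurable[M.sigma n] (X i) := (hX i).mono (ih i hi (hi.le.trans hm)) le_rfl
    have h1 : Measurable[M.sigma n] fun ω => M.ξ ω (X i ω) :=
      measurable_eval.comp
        (@Measurable.prodMk _ (M.sigma n) _ _ _ _ _ _ (M.measurable_sigma_ξ n) hXi)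
    have h2 : Measurable[M.sigma n] fun ω => (τ (X i ω) : ℝ) := (measurable_noise τ).comp hXi
    have h3 : Measurable[M.sigma n] fun ω => M.ξ ω (X i ω) + τ (X i ω) * M.U i ω :=
      (show Measurable fun q : ℝ × ℝ × ℝ => q.1 + q.2.1 * q.2.2 by fun_prop).comp
        (@Measurable.prodMk _ (M.sigma n) _ _ _ _ _ _ h1
          (@Measurable.prodMk _ (M.sigma n) _ _ _ _ _ _ h2
            (M.measurable_sigma_U (hi.trans_le hm))))
    exact sup_le hXi.comap_le h3.comap_le

theorem indepFun_obsSigma_noise {τ : C(𝕏, ℝ≥0)} {M : GPModel 𝕏 P} {X : ℕ → Ω → 𝕏}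
    (hX : IsDesign τ M X) (n : ℕ) :
    @IndepFun Ω (Ω × C(𝕏, ℝ)) ℝ mΩ (@Prod.instMeasurableSpace _ _ (obsSigma τ M X n) _) _
      (fun ω => (id ω, M.ξ ω)) (M.U n) P := by
  refine indep_of_indep_of_le_left (M.indepFun_noise n) ?_
  have hid : @Measurable _ _ (M.sigma n) (obsSigma τ M X n) id :=
    measurable_id'' (obsSigma_le_comap hX n)
  exact (@Measurable.prodMk _ (M.sigma n) _ _ (obsSigma τ M X n) _ _ _ hid
    (M.measurable_sigma_ξ n)).comap_le

/-- Sequential conditioning: the posterior distribution defined by iterating the one-step update is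
the regular conditional distribution of the process given the observations. -/
theorem isRegCond_postLaw {τ : C(𝕏, ℝ≥0)} {M : GPModel 𝕏 P} {X : ℕ → Ω → 𝕏}
    (hX : IsDesign τ M X) (n : ℕ) :
    IsRegCond P M.ξ (obsSigma τ M X n) (postLaw τ M X n) := by
  have hξ := M.measurable_path
  induction n with
  | zero =>
    refine isRegCond_of_disintegrates (obsSigma_le hX 0) hξ (measurable_postLaw τ M X 0) ?_
    intro A hA B hB
    rw [obsSigma_zero, MeasurableSpace.measurableSet_bot_iff] at hA
    rcases hA with rfl | rfl
    · simp
    · simp [postLaw, GPModel.law, Measure.map_apply hξ hB]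
  | succ n ih =>
    refine isRegCond_of_disintegrates (obsSigma_le hX (n + 1)) hξ (measurable_postLaw τ M X (n + 1))
      ?_
    have hd := Disintegrates.condObs (mΩ' := obsSigma τ M X n) τ (ih.disintegrates hξ)
      (measurable_id'' ih.le) hξ ih.measurable (M.measurable_U n) (M.law_U n)
      (indepFun_obsSigma_noise hX n) (hX n)
    intro A hA B hB
    -- the events of the next σ-algebra are determined by the current one and the new observation
    have hle : obsSigma τ M X (n + 1) ≤ MeasurableSpace.comap (fun ω => (id ω, obs τ M X n ω))
        (@Prod.instMeasurableSpace _ _ (obsSigma τ M X n) _) := by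
      have hm : @Measurable _ _ (MeasurableSpace.comap (fun ω => (id ω, obs τ M X n ω))
          (@Prod.instMeasurableSpace _ _ (obsSigma τ M X n) _))
          (@Prod.instMeasurableSpace _ _ (obsSigma τ M X n) _)
          (fun ω => (id ω, obs τ M X n ω)) := comap_measurable _
      have h1 : @Measurable _ _ (MeasurableSpace.comap (fun ω => (id ω, obs τ M X n ω))
          (@Prod.instMeasurableSpace _ _ (obsSigma τ M X n) _)) (obsSigma τ M X n) id :=
        (@measurable_fst _ _ (obsSigma τ M X n) _).comp hm
      have h2 := (@measurable_snd _ _ (obsSigma τ M X n) _).comp hm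
      rw [obsSigma_succ]
      refine sup_le ?_ (sup_le ?_ h2.comap_le)
      · have := h1.comap_le
        rwa [MeasurableSpace.comap_id] at this
      · exact ((hX n).comp h1).comap_le
    obtain ⟨D, hD, rfl⟩ := hle A hA
    have hS := @MeasurableSet.prod _ _
      (@Prod.instMeasurableSpace _ _ (obsSigma τ M X n) _) _ _ _ hD hB
    have hind : @Measurable _ _ (@Prod.instMeasurableSpace _ _
        (@Prod.instMeasurableSpace _ _ (obsSigma τ M X n) _) _) _
        ((D ×ˢ B).indicator fun _ => (1 : ℝ≥0∞)) := Measurable.indicator measurable_const hS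
    have key := hd _ hind
    have hA' := obsSigma_le hX (n + 1) _ hA
    have e1 : ∀ ω, (D ×ˢ B).indicator (fun _ => (1 : ℝ≥0∞))
        ((id ω, noisyEval τ (X n (id ω)) (M.ξ ω, M.U n ω)), M.ξ ω) =
        (((fun ω => (id ω, obs τ M X n ω)) ⁻¹' D) ∩ M.ξ ⁻¹' B).indicator 1 ω := fun ω => rfl
    have e2 : ∀ ω, ∫⁻ f, (D ×ˢ B).indicator (fun _ => (1 : ℝ≥0∞))
        ((id ω, noisyEval τ (X n (id ω)) (M.ξ ω, M.U n ω)), f)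
          ∂(SUR.condObs τ (X n (id ω)) (noisyEval τ (X n (id ω)) (M.ξ ω, M.U n ω))
            (postLaw τ M X n (id ω))).1 =
        ((fun ω => (id ω, obs τ M X n ω)) ⁻¹' D).indicator
          (fun ω => (postLaw τ M X (n + 1) ω).1 B) ω := by
      intro ω
      change ∫⁻ f, (D ×ˢ B).indicator (fun _ => (1 : ℝ≥0∞))
        ((id ω, obs τ M X n ω), f) ∂(postLaw τ M X (n + 1) ω).1 = _
      by_cases hω : (id ω, obs τ M X n ω) ∈ D
      · rw [Set.indicator_of_mem (by exact hω), ← lintegral_indicator_one hB]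
        refine lintegral_congr fun f => ?_
        by_cases hf : f ∈ B
        · rw [Set.indicator_of_mem hf, Set.indicator_of_mem (Set.mk_mem_prod hω hf)]
          rfl
        · rw [Set.indicator_of_notMem hf, Set.indicator_of_notMem fun h => hf h.2]
      · rw [Set.indicator_of_notMem (by exact hω)]
        refine (lintegral_congr fun f => ?_).trans lintegral_zero
        rw [Set.indicator_of_notMem]
        exact fun h => hω h.1
    simp only [e1, e2] at key
    rw [lintegral_indicator_one (hA'.inter (hξ hB)), lintegral_indicator hA'] at key
    exact key

end Posterior

/-! ### The variance of a bounded functional -/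

section Variance

variable {𝕏 : Type v} [MetricSpace 𝕏] [CompactSpace 𝕏] {a : C(𝕏, ℝ) → ℝ} {c : ℝ}

/-- The functional `ν ↦ Var_ν(a)`, with values in `[0, ∞]`. -/
noncomputable def varFun (a : C(𝕏, ℝ) → ℝ) (ν : GaussMeas 𝕏) : ℝ≥0∞ :=
  ENNReal.ofReal Var[a; ν.1]

theorem toReal_varFun (a : C(𝕏, ℝ) → ℝ) (ν : GaussMeas 𝕏) :
    (varFun a ν).toReal = Var[a; ν.1] :=
  ENNReal.toReal_ofReal (variance_nonneg _ _)

theorem memLp_of_abs_le {Ω : Type*} [MeasurableSpace Ω] {P : Measure Ω} [IsFiniteMeasure P]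
    {g : Ω → ℝ} (hg : Measurable g) (hc : ∀ ω, |g ω| ≤ c) (p : ℝ≥0∞) : MemLp g p P :=
  MemLp.of_bound hg.aestronglyMeasurable c (ae_of_all _ hc)

theorem integrable_of_abs_le {Ω : Type*} [MeasurableSpace Ω] {P : Measure Ω} [IsFiniteMeasure P]
    {g : Ω → ℝ} (hg : Measurable g) (hc : ∀ ω, |g ω| ≤ c) : Integrable g P :=
  memLp_one_iff_integrable.1 (memLp_of_abs_le hg hc 1)

theorem abs_integral_le_of_abs_le {Ω : Type*} [MeasurableSpace Ω] {P : Measure Ω}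
    [IsProbabilityMeasure P] {g : Ω → ℝ} (hc : ∀ ω, |g ω| ≤ c) : |∫ ω, g ω ∂P| ≤ c := by
  simpa using norm_integral_le_of_norm_le_const (μ := P) (f := g) (C := c) (ae_of_all _ hc)

theorem variance_eq_integral_sq_sub {Ω : Type*} [MeasurableSpace Ω] {P : Measure Ω}
    [IsProbabilityMeasure P] {g : Ω → ℝ} (hg : Measurable g) (hc : ∀ ω, |g ω| ≤ c) :
    Var[g; P] = ∫ ω, g ω ^ 2 ∂P - (∫ ω, g ω ∂P) ^ 2 :=
  variance_eq_sub (memLp_of_abs_le hg hc 2)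

theorem abs_sq_le_of_abs_le {y : ℝ} (h : |y| ≤ c) : |y ^ 2| ≤ c ^ 2 := by
  rw [abs_pow]
  exact pow_le_pow_left₀ (abs_nonneg _) h 2

theorem measurable_varFun (ha : Measurable a) (hc : ∀ f, |a f| ≤ c) :
    Measurable (varFun a) := by
  refine Measurable.ennreal_ofReal ?_
  simp only [variance_eq_integral_sq_sub ha hc]
  exact (measurable_integral_gaussMeas (ha.pow_const 2)).sub
    ((measurable_integral_gaussMeas ha).pow_const 2)

theorem integral_sq_sub_eq {Ω : Type*} [MeasurableSpace Ω] {P : Measure Ω}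
    [IsProbabilityMeasure P] {g : Ω → ℝ} (hg : Measurable g) (hc : ∀ ω, |g ω| ≤ c) (d : ℝ) :
    ∫ ω, (g ω - d) ^ 2 ∂P = Var[g; P] + (∫ ω, g ω ∂P - d) ^ 2 := by
  have h1 : Integrable g P := integrable_of_abs_le hg hc
  have h2 : Integrable (fun ω => g ω ^ 2) P :=
    integrable_of_abs_le (hg.pow_const 2) fun ω => abs_sq_le_of_abs_le (hc ω)
  have e : ∀ ω, (g ω - d) ^ 2 = g ω ^ 2 - 2 * d * g ω + d ^ 2 := fun ω => by ring
  simp only [e]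
  have h3 : Integrable (fun ω => 2 * d * g ω) P := h1.const_mul _
  have h4 : Integrable (fun ω => g ω ^ 2 - 2 * d * g ω) P := h2.sub h3
  rw [integral_add h4 (integrable_const _), integral_sub h2 h3, integral_const_mul,
    variance_eq_integral_sq_sub hg hc]
  simp
  ring

theorem avgLoss_sq (ha : Measurable a) (hc : ∀ f, |a f| ≤ c) (ν : GaussMeas 𝕏) (d : ℝ) :
    avgLoss (fun f d => (a f - d) ^ 2) ν d
      = ENNReal.ofReal (Var[a; ν.1] + (∫ f, a f ∂ν.1 - d) ^ 2) := by
  rw [← integral_sq_sub_eq ha hc, avgLoss, ← ofReal_integral_eq_lintegral_ofReal _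
    (ae_of_all _ fun f => sq_nonneg _)]
  refine integrable_of_abs_le (c := (c + |d|) ^ 2) ((ha.sub_const d).pow_const 2) fun f => ?_
  exact abs_sq_le_of_abs_le ((abs_sub _ _).trans (by linarith [hc f]))

theorem uncertainty_sq (ha : Measurable a) (hc : ∀ f, |a f| ≤ c) (ν : GaussMeas 𝕏) :
    uncertainty (fun f (d : ℝ) => (a f - d) ^ 2) ν = varFun a ν := by
  simp only [uncertainty, avgLoss_sq ha hc]
  refine le_antisymm (iInf_le_of_le (∫ f, a f ∂ν.1) (by simp [varFun])) (le_iInf fun d => ?_)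
  exact ENNReal.ofReal_le_ofReal (by nlinarith [sq_nonneg (∫ f, a f ∂ν.1 - d)])

section Conditional

variable {Ω : Type u} {𝓕 mΩ : MeasurableSpace Ω} {P : Measure Ω} [IsProbabilityMeasure P]
  {ξ : Ω → C(𝕏, ℝ)} {ν : Ω → GaussMeas 𝕏}

theorem IsRegCond.variance_ae_eq (h : IsRegCond P ξ 𝓕 ν) (hξ : Measurable ξ) (ha : Measurable a)
    (hc : ∀ f, |a f| ≤ c) :
    (fun ω => Var[a; (ν ω).1]) =ᵐ[P] Var[fun ω => a (ξ ω); P | 𝓕] := by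
  have hY : MemLp (fun ω => a (ξ ω)) 2 P := memLp_of_abs_le (ha.comp hξ) (fun ω => hc _) 2
  have h1 := h.integral_ae_eq hξ ha (integrable_of_abs_le (ha.comp hξ) (fun ω => hc _))
  have h2 := h.integral_ae_eq hξ (ha.pow_const 2) (integrable_of_abs_le ((ha.comp hξ).pow_const 2)
    (fun ω => abs_sq_le_of_abs_le (hc (ξ ω))))
  filter_upwards [h1, h2, condVar_ae_eq_condExp_sq_sub_sq_condExp h.le hY] with ω h3 h4 h5
  rw [variance_eq_integral_sq_sub ha hc, h5, h3, h4]
  rfl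

end Conditional

section Supermartingale

variable {Ω : Type u} [mΩ : MeasurableSpace Ω] {P : Measure Ω} [IsProbabilityMeasure P]
  [MeasurableSpace 𝕏] [BorelSpace 𝕏] {τ : C(𝕏, ℝ≥0)} {M : GPModel 𝕏 P} {X : ℕ → Ω → 𝕏}

theorem martingale_integral_postLaw (hX : IsDesign τ M X) (ha : Measurable a)
    (hc : ∀ f, |a f| ≤ c) :
    Martingale (fun n ω => ∫ f, a f ∂(postLaw τ M X n ω).1) (obsFiltration hX) P := by
  have hint : Integrable (fun ω => a (M.ξ ω)) P :=
    integrable_of_abs_le (ha.comp M.measurable_path) fun ω => hc _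
  have h := fun n => (isRegCond_postLaw hX n).integral_ae_eq M.measurable_path ha hint
  refine ⟨fun n => ((measurable_integral_gaussMeas ha).comp
    (measurable_postLaw τ M X n)).stronglyMeasurable, fun i j hij => ?_⟩
  exact (condExp_congr_ae (h j)).trans ((condExp_condExp_of_le ((obsFiltration hX).mono hij)
    ((obsFiltration hX).le j)).trans (h i).symm)

/-- Jensen's inequality, in the form that conditional variances are non-negative. -/
theorem supermartingale_neg_sq_integral_postLaw (hX : IsDesign τ M X) (ha : Measurable a)
    (hc : ∀ f, |a f| ≤ c) :
    Supermartingale (fun n ω => -(∫ f, a f ∂(postLaw τ M X n ω).1) ^ 2) (obsFiltration hX) P := by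
  have hm := martingale_integral_postLaw hX ha hc
  have hmeas : ∀ n, Measurable fun ω => ∫ f, a f ∂(postLaw τ M X n ω).1 := fun n =>
    ((hm.1 n).mono ((obsFiltration hX).le n)).measurable
  have hbd : ∀ n ω, |∫ f, a f ∂(postLaw τ M X n ω).1| ≤ c := fun n ω =>
    abs_integral_le_of_abs_le hc
  refine supermartingale_nat (fun n => ((hm.1 n).pow 2).neg) (fun n => ?_) fun n => ?_
  · exact (integrable_of_abs_le ((hmeas n).pow_const 2)
      fun ω => abs_sq_le_of_abs_le (hbd n ω)).neg
  · have hL : MemLp (fun ω => ∫ f, a f ∂(postLaw τ M X (n + 1) ω).1) 2 P :=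
      memLp_of_abs_le (hmeas _) (hbd _) 2
    have hnn : 0 ≤ᵐ[P]
        Var[fun ω => ∫ f, a f ∂(postLaw τ M X (n + 1) ω).1; P | obsFiltration hX n] :=
      condExp_nonneg (ae_of_all _ fun ω => sq_nonneg _)
    have hneg := condExp_neg (μ := P)
      ((fun ω => ∫ f, a f ∂(postLaw τ M X (n + 1) ω).1) ^ 2) (obsFiltration hX n)
    filter_upwards [hnn, hneg, condVar_ae_eq_condExp_sq_sub_sq_condExp ((obsFiltration hX).le n) hL,
      hm.2 n (n + 1) n.le_succ] with ω h1 h2 h3 h4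
    rw [h3, Pi.sub_apply, Pi.pow_apply, h4] at h1
    have h5 : (P[-(fun ω => ∫ f, a f ∂(postLaw τ M X (n + 1) ω).1) ^ 2 | obsFiltration hX n]) ω
      ≤ -(∫ f, a f ∂(postLaw τ M X n ω).1) ^ 2 := by
      rw [h2]
      simp only [Pi.zero_apply, Pi.neg_apply] at h1 ⊢
      linarith
    exact h5

/-- The posterior variance is the sum of the martingale of the posterior second moments and of the
supermartingale of minus the squared posterior means. -/
theorem supermartingale_varFun_postLaw (hX : IsDesign τ M X) (ha : Measurable a)
    (hc : ∀ f, |a f| ≤ c) :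
    Supermartingale (fun n ω => (varFun a (postLaw τ M X n ω)).toReal) (obsFiltration hX) P := by
  have h1 := (martingale_integral_postLaw hX (ha.pow_const 2)
    fun f => abs_sq_le_of_abs_le (hc f)).supermartingale.add
    (supermartingale_neg_sq_integral_postLaw hX ha hc)
  convert! h1 using 1
  funext n ω
  rw [toReal_varFun, variance_eq_integral_sq_sub ha hc]
  simp [sub_eq_add_neg]

end Supermartingale

end Variance

/-! ### The expected gain of an observation -/

section Gain

variable {𝕏 : Type v} [MetricSpace 𝕏] [CompactSpace 𝕏] [MeasurableSpace 𝕏] [BorelSpace 𝕏]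
  {a : C(𝕏, ℝ) → ℝ} {c : ℝ}

/-- The posterior mean of `a` after the observation `z` at `x`. -/
noncomputable def postMean (a : C(𝕏, ℝ) → ℝ) (τ : C(𝕏, ℝ≥0)) (x : 𝕏) (ν : GaussMeas 𝕏)
    (z : ℝ) : ℝ := ∫ f, a f ∂(condObs τ x z ν).1

theorem measurable_condObs_right (τ : C(𝕏, ℝ≥0)) (x : 𝕏) (ν : GaussMeas 𝕏) :
    Measurable fun z => condObs τ x z ν :=
  (measurable_condObs τ).comp (f := fun z => (x, z, ν)) (by fun_prop)

theorem measurable_postMean (ha : Measurable a) (τ : C(𝕏, ℝ≥0)) (x : 𝕏) (ν : GaussMeas 𝕏) :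
    Measurable (postMean a τ x ν) :=
  (measurable_integral_gaussMeas ha).comp (measurable_condObs_right τ x ν)

theorem abs_postMean_le (hc : ∀ f, |a f| ≤ c) (τ : C(𝕏, ℝ≥0)) (x : 𝕏) (ν : GaussMeas 𝕏) (z : ℝ) :
    |postMean a τ x ν z| ≤ c :=
  abs_integral_le_of_abs_le hc

/-- Bochner integral form of `lintegral_condObs`. -/
theorem integral_condObs (τ : C(𝕏, ℝ≥0)) (x : 𝕏) (ν : GaussMeas 𝕏) {F : ℝ × C(𝕏, ℝ) → ℝ}
    (hF : Measurable F) (hc : ∀ q, |F q| ≤ c) :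
    ∫ p, ∫ f, F (noisyEval τ x p, f) ∂(condObs τ x (noisyEval τ x p) ν).1 ∂(noisyLaw ν)
      = ∫ p, F (noisyEval τ x p, p.1) ∂(noisyLaw ν) := by
  have hW := measurable_noisyEval τ x
  let κ : Kernel ℝ C(𝕏, ℝ) := (gaussKernel 𝕏).comap _ (measurable_condObs_right τ x ν)
  have hκ : ∀ z, κ z = (condObs τ x z ν).1 := fun z => rfl
  have : IsProbabilityMeasure ((noisyLaw ν).map (noisyEval τ x)) :=
    Measure.isProbabilityMeasure_map hW.aemeasurable
  have key : (noisyLaw ν).map (fun p => (noisyEval τ x p, p.1)) =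
      (noisyLaw ν).map (noisyEval τ x) ⊗ₘ κ := by
    refine Measure.ext_of_lintegral _ fun G hG => ?_
    rw [lintegral_map hG (hW.prodMk measurable_fst), Measure.lintegral_compProd hG,
      lintegral_map hG.lintegral_kernel_prod_right' hW]
    simp only [hκ]
    exact (lintegral_condObs τ x ν hG).symm
  rw [← integral_map (φ := fun p => (noisyEval τ x p, p.1)) (f := F)
    (hW.prodMk measurable_fst).aemeasurable hF.aestronglyMeasurable, key,
    Measure.integral_compProd (integrable_of_abs_le hF hc),
    integral_map hW.aemeasurable
      (hF.stronglyMeasurable.integral_kernel_prod_right' (κ := κ)).aestronglyMeasurable]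
  simp only [hκ]

/-- The posterior mean is the projection of `a` on the functions of the observation. -/
theorem integral_postMean_mul (ha : Measurable a) (hc : ∀ f, |a f| ≤ c) (τ : C(𝕏, ℝ≥0)) (x : 𝕏)
    (ν : GaussMeas 𝕏) {g : ℝ → ℝ} (hg : Measurable g) {K : ℝ} (hK : ∀ z, |g z| ≤ K) :
    ∫ p, postMean a τ x ν (noisyEval τ x p) * g (noisyEval τ x p) ∂(noisyLaw ν)
      = ∫ p, a p.1 * g (noisyEval τ x p) ∂(noisyLaw ν) := by
  have h := integral_condObs (c := c * K) τ x ν (F := fun q => a q.2 * g q.1)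
    ((ha.comp measurable_snd).mul (hg.comp measurable_fst)) (fun q => by
      rw [abs_mul]
      exact mul_le_mul (hc _) (hK _) (abs_nonneg _) ((abs_nonneg _).trans (hc q.2)))
  simp only [integral_mul_const] at h
  exact h

theorem integral_noisyLaw_fst (ν : GaussMeas 𝕏) (g : C(𝕏, ℝ) → ℝ) :
    ∫ p, g p.1 ∂(noisyLaw ν) = ∫ f, g f ∂ν.1 := by
  rw [integral_fun_fst]
  simp

theorem integrable_postMean_sq (ha : Measurable a) (hc : ∀ f, |a f| ≤ c) (τ : C(𝕏, ℝ≥0)) (x : 𝕏)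
    (ν : GaussMeas 𝕏) :
    Integrable (fun p => postMean a τ x ν (noisyEval τ x p) ^ 2) (noisyLaw ν) :=
  integrable_of_abs_le
    (((measurable_postMean ha τ x ν).comp (measurable_noisyEval τ x)).pow_const 2)
    fun _ => abs_sq_le_of_abs_le (abs_postMean_le hc τ x ν _)

/-- The law of total variance: the expected posterior variance is the second moment of `a` minus the
second moment of its posterior mean. -/
theorem expResidual_varFun (ha : Measurable a) (hc : ∀ f, |a f| ≤ c) (τ : C(𝕏, ℝ≥0)) (x : 𝕏)
    (ν : GaussMeas 𝕏) : expResidual τ (varFun a) x ν = ENNReal.ofReal (∫ f, a f ^ 2 ∂ν.1 -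
      ∫ p, postMean a τ x ν (noisyEval τ x p) ^ 2 ∂(noisyLaw ν)) := by
  have hW := measurable_noisyEval τ x
  have hm : Measurable fun p => condObs τ x (noisyEval τ x p) ν :=
    (measurable_condObs_right τ x ν).comp hW
  have h1 : expResidual τ (varFun a) x ν
      = ∫⁻ p, varFun a (condObs τ x (noisyEval τ x p) ν) ∂(noisyLaw ν) := by
    exact (lintegral_prod (fun p => varFun a (condObs τ x (noisyEval τ x p) ν))
      ((measurable_varFun ha hc).comp hm).aemeasurable).symm
  have hsq : ∫ p, ∫ f, a f ^ 2 ∂(condObs τ x (noisyEval τ x p) ν).1 ∂(noisyLaw ν)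
      = ∫ f, a f ^ 2 ∂ν.1 := by
    rw [← integral_noisyLaw_fst]
    exact integral_condObs τ x ν (F := fun q => a q.2 ^ 2) ((ha.comp measurable_snd).pow_const 2)
      fun q => abs_sq_le_of_abs_le (hc _)
  have hi1 : Integrable (fun p => ∫ f, a f ^ 2 ∂(condObs τ x (noisyEval τ x p) ν).1)
      (noisyLaw ν) :=
    integrable_of_abs_le ((measurable_integral_gaussMeas (ha.pow_const 2)).comp hm)
      fun p => abs_integral_le_of_abs_le fun f => abs_sq_le_of_abs_le (hc f)
  have hi2 := integrable_postMean_sq ha hc τ x ν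
  have hv : ∀ p, Var[a; (condObs τ x (noisyEval τ x p) ν).1] =
      ∫ f, a f ^ 2 ∂(condObs τ x (noisyEval τ x p) ν).1 - postMean a τ x ν (noisyEval τ x p) ^ 2 :=
    fun p => variance_eq_integral_sq_sub ha hc
  rw [h1, ← hsq, ← integral_sub hi1 hi2]
  simp only [varFun]
  rw [← ofReal_integral_eq_lintegral_ofReal]
  · simp only [hv]
  · simp only [hv]
    exact hi1.sub hi2
  · exact ae_of_all _ fun p => variance_nonneg _ _

theorem expResidual_varFun_le (ha : Measurable a) (hc : ∀ f, |a f| ≤ c) (τ : C(𝕏, ℝ≥0)) (x : 𝕏)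
    (ν : GaussMeas 𝕏) : expResidual τ (varFun a) x ν ≤ varFun a ν := by
  have hm : Measurable fun p => postMean a τ x ν (noisyEval τ x p) :=
    (measurable_postMean ha τ x ν).comp (measurable_noisyEval τ x)
  have h1 := variance_nonneg (fun p => postMean a τ x ν (noisyEval τ x p)) (noisyLaw ν)
  rw [variance_eq_integral_sq_sub hm fun _ => abs_postMean_le hc τ x ν _] at h1
  have h2 := integral_postMean_mul ha hc τ x ν (g := fun _ => 1) measurable_const (K := 1) (by simp)
  simp only [mul_one] at h2
  rw [h2, integral_noisyLaw_fst] at h1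
  rw [expResidual_varFun ha hc, varFun, variance_eq_integral_sq_sub ha hc]
  exact ENNReal.ofReal_le_ofReal (by linarith)

/-- The gain from an observation at `x` is the variance of the posterior mean of `a`. By the
Cauchy-Schwarz inequality it dominates the squared covariance of `a` with every function of the
observation that is bounded by one. -/
theorem sq_cov_le_gain (ha : Measurable a) (hc : ∀ f, |a f| ≤ c) (τ : C(𝕏, ℝ≥0)) (x : 𝕏)
    (ν : GaussMeas 𝕏) {g : ℝ → ℝ} (hg : Measurable g) (hg1 : ∀ z, |g z| ≤ 1) :
    ENNReal.ofReal ((∫ p, a p.1 * g (noisyEval τ x p) ∂(noisyLaw ν) -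
      (∫ f, a f ∂ν.1) * ∫ p, g (noisyEval τ x p) ∂(noisyLaw ν)) ^ 2)
      ≤ varFun a ν - expResidual τ (varFun a) x ν := by
  have hW := measurable_noisyEval τ x
  have hm : Measurable fun p => postMean a τ x ν (noisyEval τ x p) :=
    (measurable_postMean ha τ x ν).comp hW
  have hmb : ∀ p, |postMean a τ x ν (noisyEval τ x p)| ≤ c := fun p => abs_postMean_le hc τ x ν _
  have hgm : Measurable fun p => g (noisyEval τ x p) := hg.comp hW
  have hmean := integral_postMean_mul ha hc τ x ν (g := fun _ => 1) measurable_const (K := 1)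
    (by simp)
  simp only [mul_one] at hmean
  rw [integral_noisyLaw_fst] at hmean
  have hcov := sq_covariance_le (memLp_of_abs_le (P := noisyLaw ν) hm hmb 2)
    (memLp_of_abs_le (P := noisyLaw ν) hgm (fun _ => hg1 _) 2)
  rw [covariance_eq_sub (memLp_of_abs_le hm hmb 2) (memLp_of_abs_le hgm (fun _ => hg1 _) 2), hmean]
    at hcov
  have hmul := integral_postMean_mul ha hc τ x ν hg hg1
  have hv1 : Var[fun p => g (noisyEval τ x p); noisyLaw ν] ≤ 1 := by
    rw [variance_eq_integral_sq_sub hgm fun p => hg1 _]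
    have h1 := (abs_le.1 (abs_integral_le_of_abs_le (P := noisyLaw ν)
      fun p => abs_sq_le_of_abs_le (hg1 (noisyEval τ x p)))).2
    have := sq_nonneg (∫ p, g (noisyEval τ x p) ∂(noisyLaw ν))
    linarith
  have hv2 := variance_nonneg (fun p => postMean a τ x ν (noisyEval τ x p)) (noisyLaw ν)
  have hv3 := variance_eq_integral_sq_sub (P := noisyLaw ν) hm hmb
  rw [hmean] at hv3
  rw [expResidual_varFun ha hc, varFun, ← ENNReal.ofReal_sub, variance_eq_integral_sq_sub ha hc]
  · refine ENNReal.ofReal_le_ofReal ?_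
    rw [← hmul]
    refine (hcov.trans (mul_le_of_le_one_right hv2 hv1)).trans ?_
    rw [hv3]
    linarith
  · rw [← integral_noisyLaw_fst ν (fun f => a f ^ 2)]
    have e := integral_condObs τ x ν (F := fun q => a q.2 ^ 2)
      ((ha.comp measurable_snd).pow_const 2) fun q => abs_sq_le_of_abs_le (hc _)
    rw [← e, sub_nonneg]
    refine integral_mono (integrable_postMean_sq ha hc τ x ν) ?_ fun p => ?_
    · exact integrable_of_abs_le ((measurable_integral_gaussMeas (ha.pow_const 2)).comp
        ((measurable_condObs_right τ x ν).comp hW))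
        fun p => abs_integral_le_of_abs_le fun f => abs_sq_le_of_abs_le (hc f)
    · have h1 := variance_nonneg a (condObs τ x (noisyEval τ x p) ν).1
      rw [variance_eq_integral_sq_sub ha hc] at h1
      exact sub_nonneg.1 h1

theorem gain_le_maxGain (τ : C(𝕏, ℝ≥0)) (H : GaussMeas 𝕏 → ℝ≥0∞) (x : 𝕏) (ν : GaussMeas 𝕏) :
    H ν - expResidual τ H x ν ≤ maxGain τ H ν :=
  le_iSup (fun x => H ν - expResidual τ H x ν) x

section Semicontinuity

/-- Completing the square: the quadratic functional of a test function `g` falls short of the second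
moment of the posterior mean by the squared distance of `g` from the posterior mean. -/
theorem integral_two_mul_sub_sq (ha : Measurable a) (hc : ∀ f, |a f| ≤ c) (τ : C(𝕏, ℝ≥0)) (x : 𝕏)
    (ν : GaussMeas 𝕏) {g : ℝ → ℝ} (hg : Measurable g) {K : ℝ} (hK : ∀ z, |g z| ≤ K) :
    ∫ p, (2 * (a p.1 * g (noisyEval τ x p)) - g (noisyEval τ x p) ^ 2) ∂(noisyLaw ν) =
      ∫ p, postMean a τ x ν (noisyEval τ x p) ^ 2 ∂(noisyLaw ν) -
      ∫ p, (postMean a τ x ν (noisyEval τ x p) - g (noisyEval τ x p)) ^ 2 ∂(noisyLaw ν) := by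
  have hW := measurable_noisyEval τ x
  have hm : Measurable fun p => postMean a τ x ν (noisyEval τ x p) :=
    (measurable_postMean ha τ x ν).comp hW
  have hmb : ∀ p, |postMean a τ x ν (noisyEval τ x p)| ≤ c := fun p => abs_postMean_le hc τ x ν _
  have hgm : Measurable fun p => g (noisyEval τ x p) := hg.comp hW
  have habs : ∀ {y z : ℝ}, |y| ≤ c → |z| ≤ K → |y * z| ≤ c * K := fun {y z} h1 h2 => by
    rw [abs_mul]
    exact mul_le_mul h1 h2 (abs_nonneg _) ((abs_nonneg _).trans h1)
  have i1 : Integrable (fun p => g (noisyEval τ x p) ^ 2) (noisyLaw ν) :=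
    integrable_of_abs_le (hgm.pow_const 2) fun p => abs_sq_le_of_abs_le (hK _)
  have i2 : Integrable (fun p => a p.1 * g (noisyEval τ x p)) (noisyLaw ν) :=
    integrable_of_abs_le ((ha.comp measurable_fst).mul hgm) fun p => habs (hc _) (hK _)
  have i3 : Integrable (fun p => postMean a τ x ν (noisyEval τ x p) * g (noisyEval τ x p))
      (noisyLaw ν) := integrable_of_abs_le (hm.mul hgm) fun p => habs (hmb _) (hK _)
  have i4 := integrable_postMean_sq ha hc τ x ν
  have e : ∀ p, (postMean a τ x ν (noisyEval τ x p) - g (noisyEval τ x p)) ^ 2 =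
      postMean a τ x ν (noisyEval τ x p) ^ 2 -
      (2 * (postMean a τ x ν (noisyEval τ x p) * g (noisyEval τ x p)) -
        g (noisyEval τ x p) ^ 2) := fun p => by ring
  simp only [e]
  have i5 : Integrable (fun p => 2 * (postMean a τ x ν (noisyEval τ x p) * g (noisyEval τ x p)) -
      g (noisyEval τ x p) ^ 2) (noisyLaw ν) := (i3.const_mul 2).sub i1
  rw [integral_sub (i2.const_mul 2) i1, integral_sub i4 i5,
    integral_sub (i3.const_mul 2) i1, integral_const_mul, integral_const_mul,
    integral_postMean_mul ha hc τ x ν hg hK]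
  ring

/-- The second moment of the posterior mean is a supremum over bounded continuous test functions of
quantities that are continuous in the design point; this includes the points where the observation
is degenerate. -/
theorem lowerSemicontinuous_integral_postMean_sq (ha : Measurable a) (hc : ∀ f, |a f| ≤ c)
    (τ : C(𝕏, ℝ≥0)) (ν : GaussMeas 𝕏) :
    LowerSemicontinuous fun x => ∫ p, postMean a τ x ν (noisyEval τ x p) ^ 2 ∂(noisyLaw ν) := by
  intro x₀ s hs
  have hW := measurable_noisyEval τ x₀
  have : IsProbabilityMeasure ((noisyLaw ν).map (noisyEval τ x₀)) :=
    Measure.isProbabilityMeasure_map hW.aemeasurable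
  set δ := ∫ p, postMean a τ x₀ ν (noisyEval τ x₀ p) ^ 2 ∂(noisyLaw ν) - s with hδ
  have hδ0 : 0 < δ := sub_pos.2 hs
  have hmL : MemLp (postMean a τ x₀ ν) (ENNReal.ofReal 2) ((noisyLaw ν).map (noisyEval τ x₀)) :=
    memLp_of_abs_le (measurable_postMean ha τ x₀ ν) (abs_postMean_le hc τ x₀ ν) _
  -- a bounded continuous test function that is almost optimal at `x₀`
  obtain ⟨g, hg, -⟩ := hmL.exists_boundedContinuous_integral_rpow_sub_le (by norm_num)
    (half_pos hδ0)
  have hgK : ∀ z, |g z| ≤ ‖g‖ := fun z => g.norm_coe_le_norm z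
  have hg2 : ∫ p, (postMean a τ x₀ ν (noisyEval τ x₀ p) - g (noisyEval τ x₀ p)) ^ 2 ∂(noisyLaw ν)
      ≤ δ / 2 := by
    rw [integral_map hW.aemeasurable (by
      have := measurable_postMean ha τ x₀ ν
      have := g.continuous.measurable
      exact Measurable.aestronglyMeasurable (by fun_prop))] at hg
    simpa using hg
  have hcont : Continuous fun x => ∫ p, (2 * (a p.1 * g (noisyEval τ x p)) -
      g (noisyEval τ x p) ^ 2) ∂(noisyLaw ν) := by
    refine continuous_of_dominated (bound := fun _ => 2 * (c * ‖g‖) + ‖g‖ ^ 2) (fun x => ?_)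
      (fun x => ae_of_all _ fun p => ?_) (integrable_const _) (ae_of_all _ fun p => ?_)
    · have h1 := measurable_noisyEval τ x
      have h2 := g.continuous.measurable
      exact Measurable.aestronglyMeasurable (by fun_prop)
    · have h1 : |a p.1 * g (noisyEval τ x p)| ≤ c * ‖g‖ := by
        rw [abs_mul]
        exact mul_le_mul (hc _) (hgK _) (abs_nonneg _) ((abs_nonneg _).trans (hc p.1))
      have h2 := abs_sq_le_of_abs_le (hgK (noisyEval τ x p))
      rw [Real.norm_eq_abs]
      refine (abs_sub _ _).trans (add_le_add ?_ h2)
      rw [abs_mul, abs_two]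
      linarith
    · have h1 : Continuous fun x => noisyEval τ x p := by
        unfold noisyEval
        fun_prop
      have h2 := g.continuous
      fun_prop
  have hlt : s < ∫ p, (2 * (a p.1 * g (noisyEval τ x₀ p)) - g (noisyEval τ x₀ p) ^ 2)
      ∂(noisyLaw ν) := by
    rw [integral_two_mul_sub_sq ha hc τ x₀ ν g.continuous.measurable hgK]
    linarith
  filter_upwards [(hcont.tendsto x₀).eventually (lt_mem_nhds hlt)] with x hx
  rw [integral_two_mul_sub_sq ha hc τ x ν g.continuous.measurable hgK] at hx
  have : 0 ≤ ∫ p, (postMean a τ x ν (noisyEval τ x p) - g (noisyEval τ x p)) ^ 2 ∂(noisyLaw ν) :=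
    integral_nonneg fun p => sq_nonneg _
  linarith

theorem upperSemicontinuous_expResidual (ha : Measurable a) (hc : ∀ f, |a f| ≤ c)
    (τ : C(𝕏, ℝ≥0)) (ν : GaussMeas 𝕏) :
    UpperSemicontinuous fun x => expResidual τ (varFun a) x ν := by
  simp only [expResidual_varFun ha hc]
  have hf : Continuous fun s : ℝ => ENNReal.ofReal (∫ f, a f ^ 2 ∂ν.1 - s) :=
    ENNReal.continuous_ofReal.comp (by fun_prop)
  exact hf.comp_lowerSemicontinuous_antitone (lowerSemicontinuous_integral_postMean_sq ha hc τ ν)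
    fun s t h => ENNReal.ofReal_le_ofReal (by linarith)

/-- By upper semicontinuity the infimum over a dense sequence of design points is the infimum over
all of them. -/
theorem iInf_expResidual_denseSeq [Nonempty 𝕏] (ha : Measurable a) (hc : ∀ f, |a f| ≤ c)
    (τ : C(𝕏, ℝ≥0)) (ν : GaussMeas 𝕏) :
    ⨅ i, expResidual τ (varFun a) (denseSeq 𝕏 i) ν = ⨅ x, expResidual τ (varFun a) x ν := by
  refine le_antisymm (le_iInf fun x => ?_) (le_iInf fun i => iInf_le _ _)
  by_contra hlt
  rw [not_le] at hlt
  have hopen := upperSemicontinuous_iff_isOpen_preimage.1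
    (upperSemicontinuous_expResidual ha hc τ ν) (⨅ i, expResidual τ (varFun a) (denseSeq 𝕏 i) ν)
  obtain ⟨_, hy, i, rfl⟩ := (denseRange_denseSeq 𝕏).inter_open_nonempty _ hopen ⟨x, hlt⟩
  exact absurd (iInf_le (fun i => expResidual τ (varFun a) (denseSeq 𝕏 i) ν) i) (not_le.2 hy)

end Semicontinuity

end Gain

/-! ### Trigonometric test functions and the excursion volume -/

section CharacteristicFunction

/-- Real part at `t` of the characteristic function of the Gaussian law with mean `m` and second
moment `s`. -/
noncomputable def gaussianCharRe (t m s : ℝ) : ℝ :=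
  Real.cos (t * m) * Real.exp (-((s - m ^ 2).toNNReal * t ^ 2 / 2))

/-- Imaginary part at `t` of the characteristic function of the Gaussian law with mean `m` and
second moment `s`. -/
noncomputable def gaussianCharIm (t m s : ℝ) : ℝ :=
  Real.sin (t * m) * Real.exp (-((s - m ^ 2).toNNReal * t ^ 2 / 2))

theorem continuous_gaussianCharRe (t : ℝ) :
    Continuous fun q : ℝ × ℝ => gaussianCharRe t q.1 q.2 := by
  unfold gaussianCharRe
  fun_prop

theorem continuous_gaussianCharIm (t : ℝ) :
    Continuous fun q : ℝ × ℝ => gaussianCharIm t q.1 q.2 := by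
  unfold gaussianCharIm
  fun_prop

variable {Ω : Type*} {mΩ : MeasurableSpace Ω} {Q : Measure Ω} [IsProbabilityMeasure Q] {Y : Ω → ℝ}

/-- The characteristic function of the law of `Y`, in real and imaginary parts. -/
theorem charFun_map_eq (hY : Measurable Y) (t : ℝ) :
    charFun (Q.map Y) t = ((∫ ω, Real.cos (t * Y ω) ∂Q : ℝ) : ℂ) +
      ((∫ ω, Real.sin (t * Y ω) ∂Q : ℝ) : ℂ) * Complex.I := by
  have hc : Integrable (fun ω => (Real.cos (t * Y ω) : ℂ)) Q :=
    Integrable.of_bound (by fun_prop) 1 (ae_of_all _ fun ω => by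
      rw [Complex.norm_real]; exact Real.abs_cos_le_one _)
  have hs : Integrable (fun ω => (Real.sin (t * Y ω) : ℂ)) Q :=
    Integrable.of_bound (by fun_prop) 1 (ae_of_all _ fun ω => by
      rw [Complex.norm_real]; exact Real.abs_sin_le_one _)
  rw [charFun_apply_real, integral_map hY.aemeasurable (by fun_prop), ← integral_complex_ofReal,
    ← integral_complex_ofReal, ← integral_mul_const, ← integral_add hc (hs.mul_const _)]
  refine integral_congr_ae (ae_of_all _ fun ω => ?_)
  simp only
  rw [← Complex.ofReal_mul, Complex.exp_mul_I, Complex.ofReal_cos, Complex.ofReal_sin]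

/-- The Gaussian characteristic function, in real and imaginary parts. -/
theorem cexp_gaussian (m v t : ℝ) : Complex.exp (t * m * Complex.I - v * t ^ 2 / 2) =
    ((Real.cos (t * m) * Real.exp (-(v * t ^ 2 / 2)) : ℝ) : ℂ) +
      ((Real.sin (t * m) * Real.exp (-(v * t ^ 2 / 2)) : ℝ) : ℂ) * Complex.I := by
  have : (t * m * Complex.I - v * t ^ 2 / 2 : ℂ) =
      ((t * m : ℝ) : ℂ) * Complex.I + ((-(v * t ^ 2 / 2) : ℝ) : ℂ) := by
    push_cast
    ring
  rw [this, Complex.exp_add, Complex.exp_mul_I, ← Complex.ofReal_exp, ← Complex.ofReal_cos,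
    ← Complex.ofReal_sin]
  push_cast
  ring

/-- A law is Gaussian if its characteristic function has the Gaussian form at rational points. -/
theorem hasGaussianLaw_of_integral_cos_sin (hY : Measurable Y) {m : ℝ} {v : ℝ≥0}
    (h : ∀ t : ℚ, ∫ ω, Real.cos (t * Y ω) ∂Q = Real.cos (t * m) * Real.exp (-(v * t ^ 2 / 2)) ∧
      ∫ ω, Real.sin (t * Y ω) ∂Q = Real.sin (t * m) * Real.exp (-(v * t ^ 2 / 2))) :
    HasGaussianLaw Y Q := by
  have : IsProbabilityMeasure (Q.map Y) := Measure.isProbabilityMeasure_map hY.aemeasurable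
  have hlaw : Q.map Y = gaussianReal m v := by
    refine Measure.ext_of_charFun ((Rat.denseRange_cast (𝕜 := ℝ)).equalizer continuous_charFun
      continuous_charFun (funext fun t => ?_))
    simp only [Function.comp_apply]
    rw [charFun_map_eq hY, (h t).1, (h t).2, charFun_gaussianReal, cexp_gaussian]
  exact ⟨by rw [hlaw]; infer_instance⟩

theorem _root_.ProbabilityTheory.HasGaussianLaw.integral_cos_sin (h : HasGaussianLaw Y Q)
    (hY : Measurable Y) (t : ℝ) :
    ∫ ω, Real.cos (t * Y ω) ∂Q =
        gaussianCharRe t Q[Y] (∫ ω, Y ω ^ 2 ∂Q) ∧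
      ∫ ω, Real.sin (t * Y ω) ∂Q =
        gaussianCharIm t Q[Y] (∫ ω, Y ω ^ 2 ∂Q) := by
  have h1 := charFun_map_eq (Q := Q) hY t
  rw [h.map_eq_gaussianReal, charFun_gaussianReal, cexp_gaussian,
    variance_eq_sub h.memLp_two] at h1
  simp only [Pi.pow_apply] at h1
  constructor
  · have := congrArg Complex.re h1
    simpa only [Complex.add_re, Complex.ofReal_re, Complex.mul_re, Complex.ofReal_im, Complex.I_re,
      Complex.I_im, mul_zero, zero_mul, sub_zero, add_zero, mul_one, gaussianCharRe] using this.symm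
  · have := congrArg Complex.im h1
    simpa only [Complex.add_im, Complex.ofReal_re, Complex.mul_im, Complex.ofReal_im, Complex.I_re,
      Complex.I_im, mul_zero, zero_mul, zero_add, add_zero, mul_one, gaussianCharIm] using this.symm

theorem integral_cos_sin_gaussianReal (t : ℝ) :
    ∫ u, Real.cos (t * u) ∂(gaussianReal 0 1) = Real.exp (-(t ^ 2 / 2)) ∧
      ∫ u, Real.sin (t * u) ∂(gaussianReal 0 1) = 0 := by
  have h1 := charFun_map_eq (Q := gaussianReal 0 1) measurable_id t
  rw [Measure.map_id, charFun_gaussianReal, cexp_gaussian] at h1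
  constructor
  · have := congrArg Complex.re h1
    simpa only [Complex.add_re, Complex.ofReal_re, Complex.mul_re, Complex.ofReal_im, Complex.I_re,
      Complex.I_im, mul_zero, zero_mul, sub_zero, add_zero, mul_one, one_mul, id, NNReal.coe_one,
      Real.cos_zero] using this.symm
  · have := congrArg Complex.im h1
    simpa only [Complex.add_im, Complex.ofReal_re, Complex.mul_im, Complex.ofReal_im, Complex.I_re,
      Complex.I_im, mul_zero, zero_mul, zero_add, add_zero, mul_one, one_mul, id, NNReal.coe_one,
      Real.sin_zero] using this.symm

end CharacteristicFunction

section Trigonometric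

variable {𝕏 : Type v} [MetricSpace 𝕏] [CompactSpace 𝕏] {a : C(𝕏, ℝ) → ℝ} {c : ℝ}

/-- The covariance of `a` with the trigonometric function `cos (t y + φ)` of the value `y` of the
process at `x`. -/
noncomputable def covTrig (a : C(𝕏, ℝ) → ℝ) (ν : GaussMeas 𝕏) (x : 𝕏) (t φ : ℝ) : ℝ :=
  ∫ f, a f * Real.cos (t * f x + φ) ∂ν.1 -
    (∫ f, a f ∂ν.1) * ∫ f, Real.cos (t * f x + φ) ∂ν.1

theorem measurable_cos_eval (x : 𝕏) (t φ : ℝ) :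
    Measurable fun f : C(𝕏, ℝ) => Real.cos (t * f x + φ) :=
  Real.measurable_cos.comp (((measurable_eval_const x).const_mul t).add_const φ)

theorem abs_mul_cos_le (hc : ∀ f, |a f| ≤ c) (f : C(𝕏, ℝ)) (s : ℝ) :
    |a f * Real.cos s| ≤ c := by
  rw [abs_mul]
  exact (mul_le_of_le_one_right (abs_nonneg _) (Real.abs_cos_le_one _)).trans (hc f)

/-- Independent Gaussian noise multiplies trigonometric moments by its characteristic function. -/
theorem integral_mul_cos_noisyEval (ha : Measurable a) (hc : ∀ f, |a f| ≤ c) (τ : C(𝕏, ℝ≥0))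
    (ν : GaussMeas 𝕏) (x : 𝕏) (t φ : ℝ) :
    ∫ p, a p.1 * Real.cos (t * noisyEval τ x p + φ) ∂(noisyLaw ν) =
      (∫ f, a f * Real.cos (t * f x + φ) ∂ν.1) * Real.exp (-((t * τ x) ^ 2 / 2)) := by
  have hev := measurable_eval_const x
  -- the addition theorem separates the process from the noise
  have e : ∀ p : C(𝕏, ℝ) × ℝ, a p.1 * Real.cos (t * noisyEval τ x p + φ) =
      (a p.1 * Real.cos (t * p.1 x + φ)) * Real.cos (t * τ x * p.2) -
      (a p.1 * Real.sin (t * p.1 x + φ)) * Real.sin (t * τ x * p.2) := fun p => by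
    rw [show t * noisyEval τ x p + φ = (t * p.1 x + φ) + t * τ x * p.2 by
      rw [noisyEval]; ring, Real.cos_add]
    ring
  have hsin : ∀ f s, |a f * Real.sin s| ≤ c := fun f s => by
    rw [abs_mul]
    exact (mul_le_of_le_one_right (abs_nonneg _) (Real.abs_sin_le_one _)).trans (hc f)
  have i1 : Integrable (fun p : C(𝕏, ℝ) × ℝ =>
      (a p.1 * Real.cos (t * p.1 x + φ)) * Real.cos (t * τ x * p.2)) (noisyLaw ν) := by
    refine integrable_of_abs_le (c := c) (by fun_prop) fun p => ?_
    rw [abs_mul]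
    exact (mul_le_of_le_one_right (abs_nonneg _) (Real.abs_cos_le_one _)).trans
      (abs_mul_cos_le hc _ _)
  have i2 : Integrable (fun p : C(𝕏, ℝ) × ℝ =>
      (a p.1 * Real.sin (t * p.1 x + φ)) * Real.sin (t * τ x * p.2)) (noisyLaw ν) := by
    refine integrable_of_abs_le (c := c) (by fun_prop) fun p => ?_
    rw [abs_mul]
    exact (mul_le_of_le_one_right (abs_nonneg _) (Real.abs_sin_le_one _)).trans (hsin _ _)
  simp only [e]
  rw [integral_sub i1 i2]
  have h1 := integral_prod_mul (μ := ν.1) (ν := gaussianReal 0 1)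
    (fun f => a f * Real.cos (t * f x + φ)) (fun u => Real.cos (t * τ x * u))
  have h2 := integral_prod_mul (μ := ν.1) (ν := gaussianReal 0 1)
    (fun f => a f * Real.sin (t * f x + φ)) (fun u => Real.sin (t * τ x * u))
  rw [h1, h2, (integral_cos_sin_gaussianReal _).1, (integral_cos_sin_gaussianReal _).2]
  simp

/-- Trigonometric covariances are controlled by the gain from noisy observations. -/
theorem sq_covTrig_le_gain [MeasurableSpace 𝕏] [BorelSpace 𝕏] (ha : Measurable a)
    (hc : ∀ f, |a f| ≤ c) (τ : C(𝕏, ℝ≥0)) (ν : GaussMeas 𝕏) (x : 𝕏) (t φ : ℝ) :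
    ENNReal.ofReal ((covTrig a ν x t φ * Real.exp (-((t * τ x) ^ 2 / 2))) ^ 2) ≤
      maxGain τ (varFun a) ν := by
  refine le_trans (le_of_eq ?_) ((sq_cov_le_gain ha hc τ x ν (g := fun z => Real.cos (t * z + φ))
    (by fun_prop) fun z => Real.abs_cos_le_one _).trans (gain_le_maxGain τ _ x ν))
  have h1 := integral_mul_cos_noisyEval (a := fun _ => 1) (c := 1) measurable_const (by simp)
    τ ν x t φ
  simp only [one_mul] at h1
  rw [integral_mul_cos_noisyEval ha hc, h1, covTrig]
  congr 2
  ring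

theorem continuous_covTrig (ha : Measurable a) (hc : ∀ f, |a f| ≤ c) (ν : GaussMeas 𝕏) :
    Continuous fun q : ℝ × ℝ × 𝕏 => covTrig a ν q.2.2 q.1 q.2.1 := by
  have key : ∀ {b : C(𝕏, ℝ) → ℝ} {K : ℝ}, Measurable b → (∀ f, |b f| ≤ K) →
      Continuous fun q : ℝ × ℝ × 𝕏 => ∫ f, b f * Real.cos (q.1 * f q.2.2 + q.2.1) ∂ν.1 := by
    intro b K hb hK
    refine continuous_of_dominated (bound := fun _ => K) (fun q => ?_)
      (fun q => ae_of_all _ fun f => abs_mul_cos_le hK f _) (integrable_const _)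
      (ae_of_all _ fun f => by fun_prop)
    exact (hb.mul (measurable_cos_eval q.2.2 q.1 q.2.1)).aestronglyMeasurable
  have h1 := key (b := fun _ => 1) (K := 1) measurable_const (by simp)
  simp only [one_mul] at h1
  exact (key ha hc).sub (h1.const_mul _)

theorem covTrig_eq_zero_of_dense [Nonempty 𝕏] (ha : Measurable a) (hc : ∀ f, |a f| ≤ c)
    (ν : GaussMeas 𝕏) (h : ∀ (i : ℕ) (t φ : ℚ), covTrig a ν (denseSeq 𝕏 i) t φ = 0) (x : 𝕏)
    (t φ : ℝ) : covTrig a ν x t φ = 0 := by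
  have hd : DenseRange (Prod.map ((↑) : ℚ → ℝ) (Prod.map ((↑) : ℚ → ℝ) (denseSeq 𝕏))) :=
    Rat.denseRange_cast.prodMap (Rat.denseRange_cast.prodMap (denseRange_denseSeq 𝕏))
  have := hd.equalizer (continuous_covTrig ha hc ν) (continuous_const (y := (0 : ℝ)))
    (funext fun q => h q.2.2 q.1 q.2.1)
  exact congrFun this (t, φ, x)

end Trigonometric

section Excursion

variable {𝕏 : Type v} [MetricSpace 𝕏] [CompactSpace 𝕏] [MeasurableSpace 𝕏] [BorelSpace 𝕏]
  (μ : Measure 𝕏) [IsFiniteMeasure μ] (T : ℝ)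

theorem measurableSet_excursion :
    MeasurableSet {p : C(𝕏, ℝ) × 𝕏 | T ≤ p.1 p.2} :=
  measurableSet_le measurable_const measurable_eval

theorem measurable_measure_excursion : Measurable fun f : C(𝕏, ℝ) => μ {x | T ≤ f x} :=
  measurable_measure_prodMk_left (measurableSet_excursion T)

theorem measurable_excursionVolume : Measurable (excursionVolume μ T) :=
  (measurable_measure_excursion μ T).ennreal_toReal

theorem abs_excursionVolume_le (f : C(𝕏, ℝ)) : |excursionVolume μ T f| ≤ μ.real Set.univ := by
  rw [excursionVolume, abs_of_nonneg measureReal_nonneg]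
  exact measureReal_mono (Set.subset_univ _)

/-- Fubini's theorem for a weighted excursion volume. -/
theorem lintegral_mul_measure_excursion (ν : GaussMeas 𝕏) {w : C(𝕏, ℝ) → ℝ≥0∞}
    (hw : Measurable w) :
    ∫⁻ f, w f * μ {x | T ≤ f x} ∂ν.1 = ∫⁻ x, ∫⁻ f in {f | T ≤ f x}, w f ∂ν.1 ∂μ := by
  have hS := measurableSet_excursion (𝕏 := 𝕏) T
  have h1 : ∀ f : C(𝕏, ℝ), w f * μ {x | T ≤ f x} =
      ∫⁻ x, {p : C(𝕏, ℝ) × 𝕏 | T ≤ p.1 p.2}.indicator (fun p => w p.1) (f, x) ∂μ := fun f =>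
    (lintegral_indicator_const (measurableSet_le measurable_const f.continuous.measurable)
      (w f)).symm
  have h2 : ∀ x, ∫⁻ f in {f | T ≤ f x}, w f ∂ν.1 =
      ∫⁻ f, {p : C(𝕏, ℝ) × 𝕏 | T ≤ p.1 p.2}.indicator (fun p => w p.1) (f, x) ∂ν.1 := fun x =>
    (lintegral_indicator (measurableSet_le measurable_const (measurable_eval_const x)) w).symm
  simp only [h1, h2]
  exact lintegral_lintegral_swap ((hw.comp measurable_fst).indicator hS).aemeasurable

/-- If all trigonometric covariances vanish at `x`, the excursion volume is uncorrelated with the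
event that the process exceeds the threshold at `x`, because finite measures on `ℝ` are determined
by their characteristic functions. -/
theorem setLIntegral_measure_excursion_of_covTrig (ν : GaussMeas 𝕏) (x : 𝕏)
    (h : ∀ t φ, covTrig (excursionVolume μ T) ν x t φ = 0) :
    ∫⁻ f in {f | T ≤ f x}, μ {y | T ≤ f y} ∂ν.1 =
      (∫⁻ f, μ {y | T ≤ f y} ∂ν.1) * ν.1 {f | T ≤ f x} := by
  set A : C(𝕏, ℝ) → ℝ≥0∞ := fun f => μ {y | T ≤ f y} with hA
  have hAm : Measurable A := measurable_measure_excursion μ T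
  have hAfin : ∀ f, A f < ∞ := fun f => measure_lt_top _ _
  have hAle : ∀ f, A f ≤ μ Set.univ := fun f => measure_mono (Set.subset_univ _)
  have hAint : ∫⁻ f, A f ∂ν.1 ≠ ∞ := by
    refine ((lintegral_mono hAle).trans_lt ?_).ne
    simp [measure_lt_top]
  have hmean : (∫⁻ f, A f ∂ν.1).toReal = ∫ f, excursionVolume μ T f ∂ν.1 :=
    (integral_toReal hAm.aemeasurable (ae_of_all _ hAfin)).symm
  have hev := measurable_eval_const x
  have hfin1 : IsFiniteMeasure (ν.1.withDensity A) := isFiniteMeasure_withDensity hAint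
  have hfin2 : IsFiniteMeasure ((∫⁻ f, A f ∂ν.1) • ν.1) :=
    Measure.smul_finite _ hAint
  -- the law of `f x` weighted by the excursion volume is a multiple of the unweighted law
  have key : (ν.1.withDensity A).map (fun f => f x) =
      ((∫⁻ f, A f ∂ν.1) • ν.1).map (fun f => f x) := by
    refine Measure.ext_of_charFun (funext fun t => ?_)
    have hexp : ∀ s : ℝ, Complex.exp (t * s * Complex.I) =
        (Real.cos (t * s + 0) : ℂ) + (Real.cos (t * s + (-(Real.pi / 2))) : ℂ) * Complex.I := by
      intro s
      rw [add_zero, ← sub_eq_add_neg, Real.cos_sub_pi_div_two, ← Complex.ofReal_mul,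
        Complex.exp_mul_I, Complex.ofReal_cos, Complex.ofReal_sin]
    have hi : ∀ φ, Integrable (fun f : C(𝕏, ℝ) => (Real.cos (t * f x + φ) : ℂ)) ν.1 := fun φ =>
      (integrable_of_abs_le (measurable_cos_eval x t φ) fun f => Real.abs_cos_le_one _).ofReal
    have hi' : ∀ φ, Integrable (fun f : C(𝕏, ℝ) =>
        ((excursionVolume μ T f * Real.cos (t * f x + φ) : ℝ) : ℂ)) ν.1 := fun φ =>
      (integrable_of_abs_le ((measurable_excursionVolume μ T).mul (measurable_cos_eval x t φ))
        fun f => abs_mul_cos_le (abs_excursionVolume_le μ T) f _).ofReal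
    have hz : ∀ φ, ∫ f, excursionVolume μ T f * Real.cos (t * f x + φ) ∂ν.1 =
        (∫⁻ f, A f ∂ν.1).toReal * ∫ f, Real.cos (t * f x + φ) ∂ν.1 := fun φ => by
      rw [hmean]
      exact sub_eq_zero.1 (h t φ)
    rw [charFun_apply_real, charFun_apply_real, integral_map hev.aemeasurable (by fun_prop),
      integral_map hev.aemeasurable (by fun_prop),
      integral_withDensity_eq_integral_toReal_smul hAm (ae_of_all _ hAfin), integral_smul_measure]
    have e1 : ∀ f : C(𝕏, ℝ), (A f).toReal • Complex.exp (t * (f x : ℝ) * Complex.I) =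
        ((excursionVolume μ T f * Real.cos (t * f x + 0) : ℝ) : ℂ) +
        ((excursionVolume μ T f * Real.cos (t * f x + (-(Real.pi / 2))) : ℝ) : ℂ) * Complex.I := by
      intro f
      rw [hexp, Complex.real_smul]
      change ((excursionVolume μ T f : ℝ) : ℂ) * _ = _
      push_cast
      ring
    simp only [e1]
    simp only [hexp]
    rw [integral_add (hi' _) ((hi' _).mul_const _), integral_add (hi _) ((hi _).mul_const _),
      integral_mul_const, integral_mul_const, integral_complex_ofReal, integral_complex_ofReal,
      integral_complex_ofReal, integral_complex_ofReal, hz, hz, Complex.real_smul]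
    push_cast
    ring
  have hS : MeasurableSet (Set.Ici T) := measurableSet_Ici
  have h1 := congrArg (fun m => m (Set.Ici T)) key
  simp only [Measure.map_apply hev hS, withDensity_apply _ (hev hS), Measure.smul_apply,
    smul_eq_mul] at h1
  exact h1

/-- The excursion volume is deterministic as soon as it is uncorrelated with all trigonometric
functions of all values of the process. -/
theorem variance_excursionVolume_eq_zero (ν : GaussMeas 𝕏)
    (h : ∀ x t φ, covTrig (excursionVolume μ T) ν x t φ = 0) :
    Var[excursionVolume μ T; ν.1] = 0 := by
  set A : C(𝕏, ℝ) → ℝ≥0∞ := fun f => μ {y | T ≤ f y} with hA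
  have hAm : Measurable A := measurable_measure_excursion μ T
  have hAfin : ∀ f, A f < ∞ := fun f => measure_lt_top _ _
  -- one factor is expanded as an integral over `x` of indicators, which are uncorrelated with `A`
  have e1 : ∫⁻ f, A f * A f ∂ν.1 = (∫⁻ f, A f ∂ν.1) * ∫⁻ f, A f ∂ν.1 := by
    have h1 := lintegral_mul_measure_excursion μ T ν hAm
    have h2 := lintegral_mul_measure_excursion μ T ν (w := fun _ => 1) measurable_const
    simp only [one_mul, lintegral_one, Measure.restrict_apply MeasurableSet.univ, Set.univ_inter]
      at h2
    have hm : Measurable fun x => ν.1 {f | T ≤ f x} :=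
      measurable_measure_prodMk_right (measurableSet_excursion T)
    refine h1.trans ?_
    simp only [hA, setLIntegral_measure_excursion_of_covTrig μ T ν _ (h _)]
    rw [lintegral_const_mul _ hm, ← h2]
  rw [variance_eq_integral_sq_sub (measurable_excursionVolume μ T) (abs_excursionVolume_le μ T)]
  have e2 : ∫ f, excursionVolume μ T f ∂ν.1 = (∫⁻ f, A f ∂ν.1).toReal :=
    integral_toReal hAm.aemeasurable (ae_of_all _ hAfin)
  have e3 : ∫ f, excursionVolume μ T f ^ 2 ∂ν.1 = (∫⁻ f, A f * A f ∂ν.1).toReal := by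
    rw [← integral_toReal (f := fun f => A f * A f) (hAm.mul hAm).aemeasurable
      (ae_of_all _ fun f => ENNReal.mul_lt_top (hAfin f) (hAfin f))]
    simp only [ENNReal.toReal_mul, sq]
    rfl
  rw [e2, e3, e1, ENNReal.toReal_mul]
  ring

/-- Zero maximal gain forces zero variance, since the characteristic function of the noise has no
zeros. -/
theorem varFun_eq_zero_iff (ν : GaussMeas 𝕏) (τ : C(𝕏, ℝ≥0)) :
    varFun (excursionVolume μ T) ν = 0 ↔ maxGain τ (varFun (excursionVolume μ T)) ν = 0 := by
  refine ⟨fun h => by simp [maxGain, h], fun h => ?_⟩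
  rw [varFun, variance_excursionVolume_eq_zero μ T ν, ENNReal.ofReal_zero]
  intro x t φ
  have h1 := sq_covTrig_le_gain (measurable_excursionVolume μ T) (abs_excursionVolume_le μ T) τ ν
    x t φ
  rw [h, nonpos_iff_eq_zero, ENNReal.ofReal_eq_zero] at h1
  have h2 := (pow_eq_zero_iff two_ne_zero).1 (le_antisymm h1 (sq_nonneg _))
  exact (mul_eq_zero.1 h2).resolve_right (Real.exp_pos _).ne'

end Excursion

/-! ### Decomposition of the variance -/

section Decomposition

variable {𝕏 : Type v} [MetricSpace 𝕏] [CompactSpace 𝕏]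

theorem map_eval_eq_gaussianReal (ν : GaussMeas 𝕏) (x : 𝕏) :
    ν.1.map (fun f => f x) = gaussianReal (meanFun ν x) (covFun ν x x).toNNReal := by
  have h := IsGaussian.map_eq_gaussianReal (μ := ν.1) (ContinuousMap.evalCLM ℝ x)
  rw [covFun, covariance_self (measurable_eval_const x).aemeasurable]
  exact h

/-- The law of a value of the process, as an affine image of the standard normal law. -/
theorem measureReal_eval (ν : GaussMeas 𝕏) (x : 𝕏) {S : Set ℝ} (hS : MeasurableSet S) :
    ν.1.real {f | f x ∈ S} =
      (gaussianReal 0 1).real {u | √(covFun ν x x) * u + meanFun ν x ∈ S} := by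
  have h0 : 0 ≤ covFun ν x x := by
    rw [covFun, covariance_self (measurable_eval_const x).aemeasurable]
    exact variance_nonneg _ _
  have h1 : (gaussianReal 0 1).map (fun u => √(covFun ν x x) * u + meanFun ν x) =
      gaussianReal (meanFun ν x) (covFun ν x x).toNNReal := by
    have e : (fun u : ℝ => √(covFun ν x x) * u + meanFun ν x) =
        (fun u => u + meanFun ν x) ∘ fun u => √(covFun ν x x) * u := rfl
    rw [e, ← Measure.map_map (by fun_prop) (by fun_prop), gaussianReal_map_const_mul,
      gaussianReal_map_add_const]
    congr 1
    · simp
    · ext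
      simp [Real.sq_sqrt h0, Real.coe_toNNReal _ h0]
  have h2 : ν.1 {f | f x ∈ S} = ν.1.map (fun f => f x) S :=
    (Measure.map_apply (measurable_eval_const x) hS).symm
  rw [measureReal_def, h2, map_eval_eq_gaussianReal, ← h1, Measure.map_apply (by fun_prop) hS]
  rfl

/-- Exceedance probabilities converge when the limiting law has no atom at the threshold. -/
theorem GaussTendsto.tendsto_measureReal_eval {ν : ℕ → GaussMeas 𝕏} {νlim : GaussMeas 𝕏}
    (h : GaussTendsto ν νlim) {T : ℝ} {x : 𝕏} (h0 : νlim.1.real {f | f x ∈ ({T} : Set ℝ)} = 0) :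
    Tendsto (fun n => (ν n).1.real {f | T ≤ f x}) atTop (𝓝 (νlim.1.real {f | T ≤ f x})) := by
  have hm : Tendsto (fun n => meanFun (ν n) x) atTop (𝓝 (meanFun νlim x)) := h.1.tendsto_at x
  have hk : Tendsto (fun n => √(covFun (ν n) x x)) atTop (𝓝 (√(covFun νlim x x))) :=
    (h.2.tendsto_at (x, x)).sqrt
  have hI : ∀ η : GaussMeas 𝕏, η.1.real {f | T ≤ f x} =
      ∫ u, {u | √(covFun η x x) * u + meanFun η x ∈ Set.Ici T}.indicator (fun _ => (1 : ℝ)) u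
        ∂(gaussianReal 0 1) := by
    intro η
    have hS : MeasurableSet {u : ℝ | √(covFun η x x) * u + meanFun η x ∈ Set.Ici T} :=
      measurableSet_Ici.preimage (by fun_prop : Measurable fun u : ℝ =>
        √(covFun η x x) * u + meanFun η x)
    rw [integral_indicator_const _ hS, smul_eq_mul, mul_one]
    exact measureReal_eval η x measurableSet_Ici
  simp only [hI]
  -- the limiting affine function avoids the threshold almost surely
  have hne : ∀ᵐ u ∂(gaussianReal 0 1), √(covFun νlim x x) * u + meanFun νlim x ≠ T := by
    rw [measureReal_eval νlim x (measurableSet_singleton T), measureReal_eq_zero_iff] at h0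
    exact measure_eq_zero_iff_ae_notMem.1 h0
  refine tendsto_integral_of_dominated_convergence (fun _ => 1) (fun n => ?_) (integrable_const _)
    (fun n => ae_of_all _ fun u => ?_) ?_
  · exact (measurable_const.indicator (measurableSet_Ici.preimage (by fun_prop : Measurable
      fun u : ℝ => √(covFun (ν n) x x) * u + meanFun (ν n) x))).aestronglyMeasurable
  · exact (norm_indicator_le_norm_self _ _).trans (by simp)
  · filter_upwards [hne] with u hu
    have hl : Tendsto (fun n => √(covFun (ν n) x x) * u + meanFun (ν n) x) atTop
        (𝓝 (√(covFun νlim x x) * u + meanFun νlim x)) := (hk.mul_const u).add hm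
    refine tendsto_const_nhds.congr' ?_
    rcases lt_or_gt_of_ne hu with hlt | hgt
    · filter_upwards [hl.eventually (gt_mem_nhds hlt)] with n hn
      rw [Set.indicator_of_notMem (by simpa using hlt), Set.indicator_of_notMem (by simpa using hn)]
    · filter_upwards [hl.eventually (lt_mem_nhds hgt)] with n hn
      rw [Set.indicator_of_mem (by simpa using hgt.le), Set.indicator_of_mem (by simpa using hn.le)]

/-- A Gaussian random variable that has an atom is constant. -/
theorem eval_ae_eq_of_measure_ne_zero (ν : GaussMeas 𝕏) (x : 𝕏) {T : ℝ}
    (h : ν.1 {f | f x ∈ ({T} : Set ℝ)} ≠ 0) : ∀ᵐ f ∂ν.1, f x = T := by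
  have hm := map_eval_eq_gaussianReal ν x
  have h1 : ν.1.map (fun f => f x) {T} ≠ 0 := by
    rwa [Measure.map_apply (measurable_eval_const x) (measurableSet_singleton T)]
  have hv : (covFun ν x x).toNNReal = 0 := by
    by_contra hv
    have := nullSingletonClass_gaussianReal (μ := meanFun ν x) hv
    rw [hm] at h1
    exact h1 (measure_singleton T)
  rw [hv, gaussianReal_zero_var] at hm
  have hT : meanFun ν x = T := by
    by_contra hT
    rw [hm, Measure.dirac_apply' _ (measurableSet_singleton T)] at h1
    simp [hT] at h1
  have h2 : ∀ᵐ y ∂(ν.1.map fun f => f x), y = T := by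
    rw [hm, hT, ae_dirac_eq]
    exact rfl
  exact ae_of_ae_map (measurable_eval_const x).aemeasurable h2

section CondLaws

variable {Ω : Type u} [mΩ : MeasurableSpace Ω] {P : Measure Ω} [IsProbabilityMeasure P]
  {ξ : Ω → C(𝕏, ℝ)}

/-- The conditional probability of an almost sure or null event is almost surely constant. -/
theorem measureReal_condLaw_eq_of_ae {ν : Ω → GaussMeas 𝕏} (h : ν ∈ gaussCondLaws P ξ)
    {A : Set C(𝕏, ℝ)} (hA : MeasurableSet A) {b : ℝ}
    (hb : ∀ᵐ ω ∂P, (ξ ⁻¹' A).indicator (fun _ => (1 : ℝ)) ω = b) :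
    ∀ᵐ ω ∂P, (ν ω).1.real A = b := by
  obtain ⟨𝓕, hle, -, hν⟩ := h
  have h1 : P[(ξ ⁻¹' A).indicator (fun _ => (1 : ℝ)) | 𝓕] =ᵐ[P] P[fun _ => b | 𝓕] :=
    condExp_congr_ae hb
  rw [condExp_const hle] at h1
  filter_upwards [hν A hA, h1] with ω h2 h3
  rw [h2, h3]

/-- Conditional exceedance probabilities at `x` converge. Either the value at `x` has no atom at the
threshold under the prior, and then almost surely none under the limiting conditional distribution,
or it is almost surely equal to the threshold, and all the probabilities are one. -/
theorem tendsto_measureReal_condLaws (hξ : Measurable ξ) (hG : IsGaussian (P.map ξ))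
    {ν : ℕ → Ω → GaussMeas 𝕏} {νlim : Ω → GaussMeas 𝕏} (hν : ∀ n, ν n ∈ gaussCondLaws P ξ)
    (hlim : νlim ∈ gaussCondLaws P ξ)
    (hconv : ∀ᵐ ω ∂P, GaussTendsto (fun n => ν n ω) (νlim ω)) (T : ℝ) (x : 𝕏) :
    ∀ᵐ ω ∂P, Tendsto (fun n => (ν n ω).1.real {f | T ≤ f x}) atTop
      (𝓝 ((νlim ω).1.real {f | T ≤ f x})) := by
  have hm1 : MeasurableSet {f : C(𝕏, ℝ) | f x ∈ ({T} : Set ℝ)} :=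
    measurable_eval_const x (measurableSet_singleton T)
  have hm2 : MeasurableSet {f : C(𝕏, ℝ) | T ≤ f x} := measurable_eval_const x measurableSet_Ici
  by_cases h0 : P.map ξ {f | f x ∈ ({T} : Set ℝ)} = 0
  · rw [Measure.map_apply hξ hm1] at h0
    have h1 := measureReal_condLaw_eq_of_ae hlim hm1 (b := 0) (by
      filter_upwards [measure_eq_zero_iff_ae_notMem.1 h0] with ω hω
      exact Set.indicator_of_notMem hω fun _ => (1 : ℝ))
    filter_upwards [h1, hconv] with ω h2 h3
    exact h3.tendsto_measureReal_eval h2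
  · have h1 : ∀ᵐ ω ∂P, ξ ω x = T :=
      ae_of_ae_map hξ.aemeasurable (eval_ae_eq_of_measure_ne_zero ⟨P.map ξ, hG⟩ x h0)
    have h2 : ∀ᵐ ω ∂P, (ξ ⁻¹' {f | T ≤ f x}).indicator (fun _ => (1 : ℝ)) ω = 1 := by
      filter_upwards [h1] with ω hω
      exact Set.indicator_of_mem (show ω ∈ ξ ⁻¹' {f | T ≤ f x} from hω.ge) fun _ => (1 : ℝ)
    have h3 := fun n => measureReal_condLaw_eq_of_ae (hν n) hm2 h2
    filter_upwards [ae_all_iff.2 h3, measureReal_condLaw_eq_of_ae hlim hm2 h2] with ω h4 h5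
    simp only [h4, h5]
    exact tendsto_const_nhds

end CondLaws

variable [MeasurableSpace 𝕏] [BorelSpace 𝕏] (μ : Measure 𝕏) [IsFiniteMeasure μ] (T : ℝ)

theorem measurable_measureReal_excursion :
    Measurable fun q : GaussMeas 𝕏 × 𝕏 => q.1.1.real {f | T ≤ f q.2} := by
  have hS : MeasurableSet {r : (GaussMeas 𝕏 × 𝕏) × C(𝕏, ℝ) | T ≤ r.2 r.1.2} :=
    measurableSet_le measurable_const
      (measurable_eval.comp (measurable_snd.prodMk (measurable_snd.comp measurable_fst)))
  have := Kernel.measurable_kernel_prodMk_left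
    (κ := (gaussKernel 𝕏).comap (Prod.fst : GaussMeas 𝕏 × 𝕏 → _) measurable_fst) hS
  exact this.ennreal_toReal

/-- Fubini's theorem for the mean excursion volume. -/
theorem integral_excursionVolume (ν : GaussMeas 𝕏) :
    ∫ f, excursionVolume μ T f ∂ν.1 = ∫ x, ν.1.real {f | T ≤ f x} ∂μ := by
  have h2 := lintegral_mul_measure_excursion μ T ν (w := fun _ => 1) measurable_const
  simp only [one_mul, lintegral_one, Measure.restrict_apply MeasurableSet.univ, Set.univ_inter]
    at h2
  have e1 : ∫ f, excursionVolume μ T f ∂ν.1 = (∫⁻ f, μ {x | T ≤ f x} ∂ν.1).toReal :=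
    integral_toReal (measurable_measure_excursion μ T).aemeasurable
      (ae_of_all _ fun f => measure_lt_top _ _)
  have e2 : ∫ x, ν.1.real {f | T ≤ f x} ∂μ = (∫⁻ x, ν.1 {f | T ≤ f x} ∂μ).toReal :=
    integral_toReal (measurable_measure_prodMk_right (measurableSet_excursion T)).aemeasurable
      (ae_of_all _ fun f => measure_lt_top _ _)
  rw [e1, e2, h2]

theorem isASContGauss_neg_sq :
    IsASContGauss.{u} fun ν : GaussMeas 𝕏 => -(∫ f, excursionVolume μ T f ∂ν.1) ^ 2 := by
  intro Ω _ P _ ξ hξ hG ν νlim hν hlim hconv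
  have hmeas : ∀ {η : Ω → GaussMeas 𝕏}, η ∈ gaussCondLaws P ξ →
      Measurable fun q : Ω × 𝕏 => (η q.1).1.real {f | T ≤ f q.2} := fun {η} h => by
    obtain ⟨_, -, h, -⟩ := h
    exact (measurable_measureReal_excursion T).comp
      ((h.comp measurable_fst).prodMk measurable_snd)
  have hset : MeasurableSet {q : 𝕏 × Ω | Tendsto (fun n => (ν n q.2).1.real {f | T ≤ f q.1}) atTop
      (𝓝 ((νlim q.2).1.real {f | T ≤ f q.1}))} :=
    measurableSet_tendsto_fun (fun n => (hmeas (hν n)).comp measurable_swap)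
      ((hmeas hlim).comp measurable_swap)
  have h1 : ∀ᵐ q ∂(μ.prod P), Tendsto (fun n => (ν n q.2).1.real {f | T ≤ f q.1}) atTop
      (𝓝 ((νlim q.2).1.real {f | T ≤ f q.1})) :=
    (Measure.ae_prod_iff_ae_ae hset).2
      (ae_of_all _ fun x => tendsto_measureReal_condLaws hξ hG hν hlim hconv T x)
  have h2 : ∀ᵐ ω ∂P, ∀ᵐ x ∂μ, Tendsto (fun n => (ν n ω).1.real {f | T ≤ f x}) atTop
      (𝓝 ((νlim ω).1.real {f | T ≤ f x})) :=
    (Measure.ae_ae_comm hset).1 (Measure.ae_ae_of_ae_prod h1)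
  filter_upwards [h2] with ω hω
  refine (Tendsto.pow ?_ 2).neg
  simp only [integral_excursionVolume]
  refine tendsto_integral_of_dominated_convergence (fun _ => 1) (fun n => ?_) (integrable_const _)
    (fun n => ae_of_all _ fun x => ?_) hω
  · exact ((hmeas (hν n)).comp (measurable_const.prodMk measurable_id)).aestronglyMeasurable
  · rw [Real.norm_eq_abs, abs_of_nonneg measureReal_nonneg]
    exact measureReal_le_one

theorem isUIGauss_of_abs_le {H : GaussMeas 𝕏 → ℝ} (hH : Measurable H) {c : ℝ}
    (hc : ∀ ν, |H ν| ≤ c) : IsUIGauss.{u} H := by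
  intro Ω _ P _ ξ _ _
  -- the events in the definition are empty beyond the bound
  refine uniformIntegrable_of le_rfl (by simp) (fun ν => ?_) fun ε _ =>
    ⟨c.toNNReal + 1, fun ν => ?_⟩
  · obtain ⟨_, -, h, -⟩ := ν.2
    exact (hH.comp h).aestronglyMeasurable
  · have : {ω | c.toNNReal + 1 ≤ ‖H (ν.1 ω)‖₊} = ∅ := by
      refine Set.eq_empty_of_forall_notMem fun ω hω => ?_
      have h1 : ((c.toNNReal + 1 : ℝ≥0) : ℝ) ≤ ‖H (ν.1 ω)‖ := hω
      have h2 := hc (ν.1 ω)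
      rw [Real.norm_eq_abs] at h1
      push_cast at h1
      linarith [Real.le_coe_toNNReal c]
    rw [this]
    simp

/-- The decomposition of the variance into the second moment and minus the squared mean. -/
theorem isUICDecomposition_varFun :
    IsUICDecomposition.{u} (varFun (𝕏 := 𝕏) (excursionVolume μ T))
      (fun f => excursionVolume μ T f ^ 2) fun ν => -(∫ f, excursionVolume μ T f ∂ν.1) ^ 2 where
  measurable_L₀ := (measurable_excursionVolume μ T).pow_const 2
  integrable_L₀ ν := integrable_of_abs_le ((measurable_excursionVolume μ T).pow_const 2)
    fun f => abs_sq_le_of_abs_le (abs_excursionVolume_le μ T f)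
  measurable_H₁ :=
    ((measurable_integral_gaussMeas (measurable_excursionVolume μ T)).pow_const 2).neg
  eq_add ν := by
    rw [toReal_varFun, variance_eq_integral_sq_sub (measurable_excursionVolume μ T)
      (abs_excursionVolume_le μ T), sub_eq_add_neg]
  isUI_H₁ := isUIGauss_of_abs_le
    ((measurable_integral_gaussMeas (measurable_excursionVolume μ T)).pow_const 2).neg
    (c := μ.real Set.univ ^ 2) fun ν => by
      rw [abs_neg]
      exact abs_sq_le_of_abs_le (abs_integral_le_of_abs_le (abs_excursionVolume_le μ T))
  isASCont_H₁ := isASContGauss_neg_sq μ T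

end Decomposition

/-! ### Existence of quasi-SUR designs -/

section Design

variable {𝕏 : Type v} [MetricSpace 𝕏] [CompactSpace 𝕏] [MeasurableSpace 𝕏] [BorelSpace 𝕏]

theorem measurable_expResidual (τ : C(𝕏, ℝ≥0)) {H : GaussMeas 𝕏 → ℝ≥0∞} (hH : Measurable H) :
    Measurable fun q : 𝕏 × GaussMeas 𝕏 => expResidual τ H q.1 q.2 := by
  have h1 : Measurable fun r : ((𝕏 × GaussMeas 𝕏) × C(𝕏, ℝ)) × ℝ =>
      r.1.2 r.1.1.1 + τ r.1.1.1 * r.2 :=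
    (measurable_eval.comp (measurable_snd.prodMk (measurable_fst.comp measurable_fst))
      |>.comp measurable_fst).add (((measurable_noise τ).comp (measurable_fst.comp
        (measurable_fst.comp measurable_fst))).mul measurable_snd)
  have h2 : Measurable fun r : ((𝕏 × GaussMeas 𝕏) × C(𝕏, ℝ)) × ℝ =>
      H (condObs τ r.1.1.1 (r.1.2 r.1.1.1 + τ r.1.1.1 * r.2) r.1.1.2) :=
    hH.comp ((measurable_condObs τ).comp
      (f := fun r : ((𝕏 × GaussMeas 𝕏) × C(𝕏, ℝ)) × ℝ =>
        (r.1.1.1, r.1.2 r.1.1.1 + τ r.1.1.1 * r.2, r.1.1.2))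
      ((measurable_fst.comp (measurable_fst.comp measurable_fst)).prodMk
        (h1.prodMk (measurable_snd.comp (measurable_fst.comp measurable_fst)))))
  exact measurable_lintegral_gaussMeas (ν := fun q : 𝕏 × GaussMeas 𝕏 => q.2) measurable_snd
    h2.lintegral_prod_right'

/-- A measurable choice of an almost optimal design point; minimizing over a dense sequence is
enough because the expected residual is upper semicontinuous in the design point. -/
theorem exists_measurable_almost_minimizer [Nonempty 𝕏] {a : C(𝕏, ℝ) → ℝ} {c : ℝ}
    (ha : Measurable a) (hc : ∀ f, |a f| ≤ c) (τ : C(𝕏, ℝ≥0)) {ε : ℝ} (hε : 0 < ε) :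
    ∃ s : GaussMeas 𝕏 → 𝕏, Measurable s ∧ ∀ ν, expResidual τ (varFun a) (s ν) ν ≤
      (⨅ x, expResidual τ (varFun a) x ν) + ENNReal.ofReal ε := by
  classical
  have hm : ∀ x, Measurable fun ν : GaussMeas 𝕏 => expResidual τ (varFun a) x ν := fun x =>
    (measurable_expResidual τ (measurable_varFun ha hc)).comp
      (measurable_const.prodMk measurable_id)
  have hI : Measurable fun ν : GaussMeas 𝕏 =>
      (⨅ i, expResidual τ (varFun a) (denseSeq 𝕏 i) ν) + ENNReal.ofReal ε :=
    (Measurable.iInf fun i => hm _).add_const _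
  have hex : ∀ ν : GaussMeas 𝕏, ∃ i, expResidual τ (varFun a) (denseSeq 𝕏 i) ν ≤
      (⨅ i, expResidual τ (varFun a) (denseSeq 𝕏 i) ν) + ENNReal.ofReal ε := fun ν => by
    have hfin : ⨅ i, expResidual τ (varFun a) (denseSeq 𝕏 i) ν ≠ ∞ :=
      ((iInf_le _ 0).trans_lt ((expResidual_varFun_le ha hc τ _ ν).trans_lt
        ENNReal.ofReal_lt_top)).ne
    obtain ⟨i, hi⟩ := iInf_lt_iff.1 (ENNReal.lt_add_right hfin (ENNReal.ofReal_pos.2 hε).ne')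
    exact ⟨i, hi.le⟩
  refine ⟨fun ν => denseSeq 𝕏 (Nat.find (hex ν)), ?_, fun ν => ?_⟩
  · exact (measurable_of_countable (denseSeq 𝕏)).comp
      (measurable_find hex fun i => measurableSet_le (hm _) hI)
  · rw [← iInf_expResidual_denseSeq ha hc τ ν]
    exact Nat.find_spec (hex ν)

section Feedback

variable {Ω : Type u} [mΩ : MeasurableSpace Ω] {P : Measure Ω} [IsProbabilityMeasure P]

/-- The posterior distributions when the `n`-th design point is the value of `s n` at the current
posterior distribution. -/
noncomputable def feedbackLaw (τ : C(𝕏, ℝ≥0)) (M : GPModel 𝕏 P) (s : ℕ → GaussMeas 𝕏 → 𝕏) :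
    ℕ → Ω → GaussMeas 𝕏
  | 0, _ => M.law
  | n + 1, ω => condObs τ (s n (feedbackLaw τ M s n ω))
      (obs τ M (fun _ ω => s n (feedbackLaw τ M s n ω)) n ω) (feedbackLaw τ M s n ω)

theorem postLaw_feedback (τ : C(𝕏, ℝ≥0)) (M : GPModel 𝕏 P) (s : ℕ → GaussMeas 𝕏 → 𝕏) (n : ℕ)
    (ω : Ω) : postLaw τ M (fun n ω => s n (feedbackLaw τ M s n ω)) n ω = feedbackLaw τ M s n ω := by
  induction n with
  | zero => rfl
  | succ n ih => rw [postLaw, feedbackLaw, ih]; rfl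

theorem exists_isQuasiSUR [Nonempty 𝕏] {a : C(𝕏, ℝ) → ℝ} {c : ℝ}
    (ha : Measurable a) (hc : ∀ f, |a f| ≤ c) (τ : C(𝕏, ℝ≥0)) (M : GPModel 𝕏 P) {ε : ℕ → ℝ}
    (hε : ∀ n, 0 < ε n) : ∃ X : ℕ → Ω → 𝕏, IsQuasiSUR τ (varFun a) M ε X := by
  choose s hs hle using fun n => exists_measurable_almost_minimizer ha hc τ (hε n)
  refine ⟨fun n ω => s n (feedbackLaw τ M s n ω), fun n => ?_, 0,
    fun n _ => ae_of_all _ fun ω => ?_⟩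
  · have : (fun ω => s n (feedbackLaw τ M s n ω)) =
        s n ∘ postLaw τ M (fun n ω => s n (feedbackLaw τ M s n ω)) n :=
      funext fun ω => congrArg (s n) (postLaw_feedback τ M s n ω).symm
    have hm := (hs n).comp (measurable_postLaw τ M (fun n ω => s n (feedbackLaw τ M s n ω)) n)
    rwa [← this] at hm
  · rw [postLaw_feedback]
    exact hle n _

end Feedback

end Design

/-! ### The limiting conditional distribution -/

section Limit

variable {𝕏 : Type v} [MetricSpace 𝕏] [CompactSpace 𝕏]

/-- A measure on `C(𝕏, ℝ)` is Gaussian if the rational combinations of the evaluations that enter a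
sequence of finite-rank approximations of the identity are: real combinations and continuous linear
functionals are pointwise limits. -/
theorem isGaussian_of_rat_combinations {N : ℕ → ℕ} {x : ∀ n, Fin (N n) → 𝕏}
    {φ : ∀ n, Fin (N n) → C(𝕏, ℝ)}
    (hT : ∀ f : C(𝕏, ℝ), Tendsto (fun n => ∑ i, f (x n i) • φ n i) atTop (𝓝 f))
    {κ : Measure C(𝕏, ℝ)} [IsProbabilityMeasure κ]
    (h : ∀ n (q : Fin (N n) → ℚ), HasGaussianLaw (fun f : C(𝕏, ℝ) => ∑ i, q i * f (x n i)) κ) :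
    IsGaussian κ := by
  have hm : ∀ n (r : Fin (N n) → ℝ), Measurable fun f : C(𝕏, ℝ) => ∑ i, r i * f (x n i) :=
    fun n r => Finset.measurable_sum _ fun i _ => (measurable_eval_const _).const_mul _
  have hr : ∀ n (r : Fin (N n) → ℝ),
      HasGaussianLaw (fun f : C(𝕏, ℝ) => ∑ i, r i * f (x n i)) κ := fun n r => by
    choose u _ _ hu using fun i => Real.exists_seq_rat_strictMono_tendsto (r i)
    exact gaussianLaw_of_tendsto (fun k => hm n fun i => u i k) (fun k => h n fun i => u i k)
      fun f => tendsto_finsetSum _ fun i _ => (hu i).mul_const _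
  refine isGaussian_of_isGaussian_map fun L => ?_
  refine (gaussianLaw_of_tendsto (P := κ) (Z := L) (fun n => hm n fun i => L (φ n i))
    (fun n => hr n fun i => L (φ n i)) fun f => ?_).isGaussian_map
  refine ((L.continuous.tendsto _).comp (hT f)).congr fun n => ?_
  simp [mul_comm]

theorem hasGaussianLaw_combination (ν : GaussMeas 𝕏) {N : ℕ} (x : Fin N → 𝕏) (r : Fin N → ℝ) :
    HasGaussianLaw (fun f : C(𝕏, ℝ) => ∑ i, r i * f (x i)) ν.1 := by
  have h : HasGaussianLaw (fun f : C(𝕏, ℝ) => f) ν.1 := ⟨by rw [Measure.map_id']; infer_instance⟩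
  refine (h.map (∑ i, r i • ContinuousMap.evalCLM ℝ (x i) : C(𝕏, ℝ) →L[ℝ] ℝ)).congr
    (ae_of_all _ fun f => ?_)
  simp

variable {Ω : Type u} {mΩ : MeasurableSpace Ω} {P : Measure Ω} [IsProbabilityMeasure P]
  {ξ : Ω → C(𝕏, ℝ)} {𝓕 : Filtration ℕ mΩ} {ν : ℕ → Ω → GaussMeas 𝕏}

/-- Lévy's upward theorem for regular conditional distributions. -/
theorem tendsto_integral_condDistrib (hν : ∀ n, IsRegCond P ξ (𝓕 n) (ν n)) (hξ : Measurable ξ)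
    {g : C(𝕏, ℝ) → ℝ} (hg : Measurable g) (hint : Integrable (fun ω => g (ξ ω)) P) :
    ∀ᵐ ω ∂P, Tendsto (fun n => ∫ f, g f ∂(ν n ω).1) atTop
      (𝓝 (∫ f, g f ∂(@condDistrib Ω Ω C(𝕏, ℝ) _ _ _ mΩ (⨆ n, 𝓕 n) ξ id P _ ω))) := by
  have hle : ⨆ n, 𝓕 n ≤ mΩ := iSup_le 𝓕.le
  have h1 := condExp_ae_eq_integral_condDistrib (mβ := ⨆ n, 𝓕 n) (X := id) (measurable_id'' hle)
    hξ.aemeasurable hg.stronglyMeasurable hint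
  rw [MeasurableSpace.comap_id] at h1
  filter_upwards [h1, ae_all_iff.2 fun n => (hν n).integral_ae_eq hξ hg hint,
    tendsto_ae_condExp (ℱ := 𝓕) (fun ω => g (ξ ω))] with ω h2 h3 h4
  rw [h2] at h4
  exact h4.congr fun n => (h3 n).symm

/-- The characteristic function of the law of `Y` under `Q` has at `t` the value that it has for a
Gaussian random variable; real and imaginary parts are separated. -/
def GaussianCharAt (Y : C(𝕏, ℝ) → ℝ) (t : ℝ) (Q : Measure C(𝕏, ℝ)) : Prop :=
  ∫ f, Real.cos (t * Y f) ∂Q =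
      gaussianCharRe t Q[Y] (∫ f, Y f ^ 2 ∂Q) ∧
    ∫ f, Real.sin (t * Y f) ∂Q =
      gaussianCharIm t Q[Y] (∫ f, Y f ^ 2 ∂Q)

theorem measurableSet_gaussianCharAt {Ω' : Type*} {mΩ' : MeasurableSpace Ω'}
    (κ : Kernel Ω' C(𝕏, ℝ)) {Y : C(𝕏, ℝ) → ℝ} (hY : Measurable Y) (t : ℝ) :
    MeasurableSet {ω | GaussianCharAt Y t (κ ω)} := by
  have hI : ∀ {g : C(𝕏, ℝ) → ℝ}, Measurable g → Measurable fun ω => ∫ f, g f ∂κ ω :=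
    fun hg => (StronglyMeasurable.integral_kernel (κ := κ) hg.stronglyMeasurable).measurable
  have h1 := hI hY
  have h2 := hI (g := fun f => Y f ^ 2) (hY.pow_const 2)
  have h3 := hI (g := fun f => Real.cos (t * Y f)) (Real.measurable_cos.comp (hY.const_mul _))
  have h4 := hI (g := fun f => Real.sin (t * Y f)) (Real.measurable_sin.comp (hY.const_mul _))
  have h5 := (continuous_gaussianCharRe t).measurable
  have h6 := (continuous_gaussianCharIm t).measurable
  have h7 := measurableSet_eq_fun h3 (h5.comp (h1.prodMk h2))
  have h8 := measurableSet_eq_fun h4 (h6.comp (h1.prodMk h2))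
  have h9 := h7.inter h8
  simp only [GaussianCharAt]
  exact h9

/-- The Gaussian form of the characteristic function is preserved when the first two moments and the
characteristic function converge. -/
theorem gaussianCharAt_of_tendsto {Y : C(𝕏, ℝ) → ℝ} (hY : Measurable Y) {t : ℝ}
    {ν : ℕ → GaussMeas 𝕏} {Q : Measure C(𝕏, ℝ)} (hG : ∀ n, HasGaussianLaw Y (ν n).1)
    (h1 : Tendsto (fun n => ∫ f, Y f ∂(ν n).1) atTop (𝓝 (∫ f, Y f ∂Q)))
    (h2 : Tendsto (fun n => ∫ f, Y f ^ 2 ∂(ν n).1) atTop (𝓝 (∫ f, Y f ^ 2 ∂Q)))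
    (h3 : Tendsto (fun n => ∫ f, Real.cos (t * Y f) ∂(ν n).1) atTop
      (𝓝 (∫ f, Real.cos (t * Y f) ∂Q)))
    (h4 : Tendsto (fun n => ∫ f, Real.sin (t * Y f) ∂(ν n).1) atTop
      (𝓝 (∫ f, Real.sin (t * Y f) ∂Q))) : GaussianCharAt Y t Q := by
  have h5 := ((continuous_gaussianCharRe t).tendsto _).comp (h1.prodMk_nhds h2)
  have h6 := ((continuous_gaussianCharIm t).tendsto _).comp (h1.prodMk_nhds h2)
  have hn := fun n => (hG n).integral_cos_sin hY t
  exact ⟨tendsto_nhds_unique (h3.congr fun n => (hn n).1) h5,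
    tendsto_nhds_unique (h4.congr fun n => (hn n).2) h6⟩

theorem ae_gaussianCharAt_condDistrib (hν : ∀ n, IsRegCond P ξ (𝓕 n) (ν n)) (hξ : Measurable ξ)
    {Y : C(𝕏, ℝ) → ℝ} (hY : Measurable Y) (hG : ∀ η : GaussMeas 𝕏, HasGaussianLaw Y η.1)
    (hlaw : HasGaussianLaw Y (P.map ξ)) (t : ℝ) :
    ∀ᵐ ω ∂P, GaussianCharAt Y t (@condDistrib Ω Ω C(𝕏, ℝ) _ _ _ mΩ (⨆ n, 𝓕 n) ξ id P _ ω) := by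
  have : IsProbabilityMeasure (P.map ξ) := Measure.isProbabilityMeasure_map hξ.aemeasurable
  have hlim : ∀ {g : C(𝕏, ℝ) → ℝ}, Measurable g → Integrable g (P.map ξ) →
      ∀ᵐ ω ∂P, Tendsto (fun n => ∫ f, g f ∂(ν n ω).1) atTop
        (𝓝 (∫ f, g f ∂(@condDistrib Ω Ω C(𝕏, ℝ) _ _ _ mΩ (⨆ n, 𝓕 n) ξ id P _ ω))) :=
    fun hg hint => tendsto_integral_condDistrib hν hξ hg
      ((integrable_map_measure hg.aestronglyMeasurable hξ.aemeasurable).1 hint)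
  have hcm : Measurable fun f => Real.cos (t * Y f) := Real.measurable_cos.comp (hY.const_mul _)
  have hsm : Measurable fun f => Real.sin (t * Y f) := Real.measurable_sin.comp (hY.const_mul _)
  filter_upwards [hlim hY (hlaw.memLp_two.integrable (by simp)),
    hlim (g := fun f => Y f ^ 2) (hY.pow_const 2) hlaw.memLp_two.integrable_sq,
    hlim hcm (Integrable.of_bound hcm.aestronglyMeasurable 1
      (ae_of_all _ fun f => Real.abs_cos_le_one _)),
    hlim hsm (Integrable.of_bound hsm.aestronglyMeasurable 1
      (ae_of_all _ fun f => Real.abs_sin_le_one _))] with ω h1 h2 h3 h4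
  exact gaussianCharAt_of_tendsto hY (fun n => hG (ν n ω)) h1 h2 h3 h4

/-- Conditional distributions along a filtration that are Gaussian have a Gaussian limit, the
conditional distribution given the limiting σ-algebra. The limit is redefined on a null set that
belongs to the limiting σ-algebra. -/
theorem exists_isRegCond_iSup (hν : ∀ n, IsRegCond P ξ (𝓕 n) (ν n)) (hξ : Measurable ξ)
    (hG : IsGaussian (P.map ξ)) : ∃ νlim, IsRegCond P ξ (⨆ n, 𝓕 n) νlim := by
  classical
  obtain ⟨N, x, φ, hT⟩ := exists_finite_rank_approx 𝕏
  let κ : @Kernel Ω C(𝕏, ℝ) (⨆ n, 𝓕 n) _ := @condDistrib Ω Ω C(𝕏, ℝ) _ _ _ mΩ (⨆ n, 𝓕 n) ξ id P _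
  have hle : ⨆ n, 𝓕 n ≤ mΩ := iSup_le 𝓕.le
  let Y : (Σ n, Fin (N n) → ℚ) → C(𝕏, ℝ) → ℝ := fun j f => ∑ i, (j.2 i : ℝ) * f (x j.1 i)
  have hY : ∀ j, Measurable (Y j) := fun j =>
    Finset.measurable_sum _ fun i _ => (measurable_eval_const _).const_mul _
  -- countably many equations, measurable in the measure, characterize Gaussianity
  let S : Set Ω := {ω | ∀ j, ∀ t : ℚ, GaussianCharAt (Y j) t (κ ω)}
  have hgauss : ∀ ω ∈ S, IsGaussian (κ ω) := fun ω h => by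
    have : IsProbabilityMeasure (κ ω) := by
      dsimp only [κ]
      infer_instance
    exact isGaussian_of_rat_combinations hT fun n q =>
      hasGaussianLaw_of_integral_cos_sin (hY ⟨n, q⟩) fun t => h ⟨n, q⟩ t
  have hset : MeasurableSet[⨆ n, 𝓕 n] S := by
    simp only [S, Set.ofPred_forall]
    exact MeasurableSet.iInter fun j => MeasurableSet.iInter fun t =>
      measurableSet_gaussianCharAt κ (hY j) t
  have hae : ∀ᵐ ω ∂P, ω ∈ S := ae_all_iff.2 fun j => ae_all_iff.2 fun t =>
    ae_gaussianCharAt_condDistrib hν hξ (hY j)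
      (fun η => hasGaussianLaw_combination η (x j.1) fun i => (j.2 i : ℝ))
      (hasGaussianLaw_combination ⟨P.map ξ, hG⟩ (x j.1) fun i => (j.2 i : ℝ)) t
  refine ⟨fun ω => ⟨if ω ∈ S then κ ω else P.map ξ, ?_⟩, hle, ?_, ?_⟩
  · split_ifs with h
    · exact hgauss ω h
    · exact hG
  · exact Measurable.subtype_mk (Measurable.ite hset κ.measurable measurable_const)
  · filter_upwards [hae] with ω hω
    exact if_pos hω

end Limit

/-! ### Convergence of quasi-SUR designs -/

section Convergence

variable {𝕏 : Type v} [MetricSpace 𝕏] [CompactSpace 𝕏]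

section Levy

variable {Ω : Type u} {mΩ : MeasurableSpace Ω} {P : Measure Ω} [IsProbabilityMeasure P]
  {ξ : Ω → C(𝕏, ℝ)} {𝓕 : Filtration ℕ mΩ} {ν : ℕ → Ω → GaussMeas 𝕏} {νlim : Ω → GaussMeas 𝕏}

theorem IsRegCond.tendsto_integral (hν : ∀ n, IsRegCond P ξ (𝓕 n) (ν n))
    (hlim : IsRegCond P ξ (⨆ n, 𝓕 n) νlim) (hξ : Measurable ξ)
    {g : C(𝕏, ℝ) → ℝ} (hg : Measurable g) {c : ℝ} (hc : ∀ f, |g f| ≤ c) :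
    ∀ᵐ ω ∂P, Tendsto (fun n => ∫ f, g f ∂(ν n ω).1) atTop (𝓝 (∫ f, g f ∂(νlim ω).1)) := by
  filter_upwards [tendsto_integral_condDistrib hν hξ hg (integrable_of_abs_le (hg.comp hξ)
    fun ω => hc (ξ ω)), hlim.ae_eq] with ω h1 h2
  rwa [h2]

theorem IsRegCond.tendsto_varFun (hν : ∀ n, IsRegCond P ξ (𝓕 n) (ν n))
    (hlim : IsRegCond P ξ (⨆ n, 𝓕 n) νlim) (hξ : Measurable ξ)
    {a : C(𝕏, ℝ) → ℝ} (ha : Measurable a) {c : ℝ} (hc : ∀ f, |a f| ≤ c) :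
    ∀ᵐ ω ∂P, Tendsto (fun n => varFun a (ν n ω)) atTop (𝓝 (varFun a (νlim ω))) := by
  filter_upwards [IsRegCond.tendsto_integral hν hlim hξ ha hc,
    IsRegCond.tendsto_integral hν hlim hξ (ha.pow_const 2) fun f => abs_sq_le_of_abs_le (hc f)]
    with ω h1 h2
  simp only [varFun, variance_eq_integral_sq_sub ha hc]
  exact ENNReal.tendsto_ofReal (h2.sub (h1.pow 2))

theorem IsRegCond.tendsto_covTrig (hν : ∀ n, IsRegCond P ξ (𝓕 n) (ν n))
    (hlim : IsRegCond P ξ (⨆ n, 𝓕 n) νlim) (hξ : Measurable ξ)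
    {a : C(𝕏, ℝ) → ℝ} (ha : Measurable a) {c : ℝ} (hc : ∀ f, |a f| ≤ c) (x : 𝕏) (t φ : ℝ) :
    ∀ᵐ ω ∂P, Tendsto (fun n => covTrig a (ν n ω) x t φ) atTop (𝓝 (covTrig a (νlim ω) x t φ)) := by
  have hcos := measurable_cos_eval x t φ
  filter_upwards [IsRegCond.tendsto_integral hν hlim hξ ha hc,
    IsRegCond.tendsto_integral hν hlim hξ hcos fun f => Real.abs_cos_le_one _,
    IsRegCond.tendsto_integral hν hlim hξ (ha.mul hcos) fun f => abs_mul_cos_le hc f _]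
    with ω h1 h2 h3
  exact h3.sub (h1.mul h2)

end Levy

variable [MeasurableSpace 𝕏] [BorelSpace 𝕏]
theorem measurable_condObs_noisyEval {Ω' : Type*} {mΩ' : MeasurableSpace Ω'} (τ : C(𝕏, ℝ≥0))
    {x : Ω' → 𝕏} (hx : Measurable x) {ν : Ω' → GaussMeas 𝕏} (hν : Measurable ν) :
    Measurable fun q : Ω' × (C(𝕏, ℝ) × ℝ) =>
      condObs τ (x q.1) (noisyEval τ (x q.1) q.2) (ν q.1) :=
  (measurable_condObs τ).comp (f := fun q : Ω' × (C(𝕏, ℝ) × ℝ) =>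
    (x q.1, noisyEval τ (x q.1) q.2, ν q.1)) ((hx.comp measurable_fst).prodMk
      ((measurable_noisyEval_comp τ hx).prodMk (hν.comp measurable_fst)))

variable {Ω : Type u} [mΩ : MeasurableSpace Ω] {P : Measure Ω} [IsProbabilityMeasure P]
  {τ : C(𝕏, ℝ≥0)} {M : GPModel 𝕏 P} {X : ℕ → Ω → 𝕏}

/-- The expected residual is the conditional expectation of the next value of the functional; this
is its integrated form. -/
theorem lintegral_postLaw_succ (hX : IsDesign τ M X) {H : GaussMeas 𝕏 → ℝ≥0∞} (hH : Measurable H)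
    (n : ℕ) : ∫⁻ ω, H (postLaw τ M X (n + 1) ω) ∂P =
      ∫⁻ ω, expResidual τ H (X n ω) (postLaw τ M X n ω) ∂P := by
  have hξ := M.measurable_path
  have hr := isRegCond_postLaw hX n
  have hZ := @Measurable.comp _ _ _ (@Prod.instMeasurableSpace _ _ (obsSigma τ M X n) _) _ _ _ _ hH
    (measurable_condObs_noisyEval (mΩ' := obsSigma τ M X n) τ (hX n) hr.measurable)
  have key := Disintegrates.lintegral_noisyLaw (mΩ' := obsSigma τ M X n) (hr.disintegrates hξ)
    (measurable_id'' hr.le) hξ (M.measurable_U n) (M.law_U n) (indepFun_obsSigma_noise hX n) hZ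
  have hin : ∀ ω, ∫⁻ p, H (condObs τ (X n ω) (noisyEval τ (X n ω) p) (postLaw τ M X n ω))
      ∂(noisyLaw (postLaw τ M X n ω)) = expResidual τ H (X n ω) (postLaw τ M X n ω) := fun ω =>
    lintegral_prod _ (hH.comp ((measurable_condObs_right τ _ _).comp
      (measurable_noisyEval τ _))).aemeasurable
  simp only [id, Function.comp_apply, hin] at key
  exact key

/-- The expected one-step decreases of the variance sum to at most its initial value, so they tend
to zero. -/
theorem ae_tendsto_varFun_sub_expResidual (hX : IsDesign τ M X) {a : C(𝕏, ℝ) → ℝ} {c : ℝ}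
    (ha : Measurable a) (hc : ∀ f, |a f| ≤ c) :
    ∀ᵐ ω ∂P, Tendsto (fun n => varFun a (postLaw τ M X n ω) -
      expResidual τ (varFun a) (X n ω) (postLaw τ M X n ω)) atTop (𝓝 0) := by
  have hm : ∀ n, Measurable (postLaw τ M X n) := fun n =>
    (measurable_postLaw τ M X n).mono (obsSigma_le hX n) le_rfl
  have hH : ∀ n, Measurable fun ω => varFun a (postLaw τ M X n ω) := fun n =>
    (measurable_varFun ha hc).comp (hm n)
  have hJ : ∀ n, Measurable fun ω => expResidual τ (varFun a) (X n ω) (postLaw τ M X n ω) :=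
    fun n => (measurable_expResidual τ (measurable_varFun ha hc)).comp
      (((hX n).mono (obsSigma_le hX n) le_rfl).prodMk (hm n))
  have hD : ∀ n, Measurable fun ω => varFun a (postLaw τ M X n ω) -
      expResidual τ (varFun a) (X n ω) (postLaw τ M X n ω) := fun n => (hH n).sub (hJ n)
  have hstep : ∀ n, ∫⁻ ω, (varFun a (postLaw τ M X n ω) -
      expResidual τ (varFun a) (X n ω) (postLaw τ M X n ω)) ∂P +
        ∫⁻ ω, varFun a (postLaw τ M X (n + 1) ω) ∂P = ∫⁻ ω, varFun a (postLaw τ M X n ω) ∂P :=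
    fun n => by
      rw [lintegral_postLaw_succ hX (measurable_varFun ha hc), ← lintegral_add_right _ (hJ n)]
      exact lintegral_congr fun ω => tsub_add_cancel_of_le (expResidual_varFun_le ha hc τ _ _)
  -- the sum of the expected decreases telescopes
  have hsum : ∀ n, ∑ k ∈ Finset.range n, ∫⁻ ω, (varFun a (postLaw τ M X k ω) -
      expResidual τ (varFun a) (X k ω) (postLaw τ M X k ω)) ∂P +
        ∫⁻ ω, varFun a (postLaw τ M X n ω) ∂P = varFun a M.law := fun n => by
    induction n with
    | zero => simp [postLaw]
    | succ n ih => rw [Finset.sum_range_succ, add_assoc, hstep, ih]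
  have htop : ∫⁻ ω, ∑' n, (varFun a (postLaw τ M X n ω) -
      expResidual τ (varFun a) (X n ω) (postLaw τ M X n ω)) ∂P ≠ ∞ := by
    rw [lintegral_tsum fun n => (hD n).aemeasurable]
    refine ne_top_of_le_ne_top (ENNReal.ofReal_ne_top (r := Var[a; M.law.1])) ?_
    exact ENNReal.tsum_le_of_sum_range_le fun n => (le_self_add).trans (hsum n).le
  filter_upwards [ae_lt_top (Measurable.tsum hD) htop] with ω hω
  exact ENNReal.tendsto_atTop_zero_of_tsum_ne_top hω.ne

theorem IsQuasiSUR.ae_tendsto_maxGain {ε : ℕ → ℝ} {a : C(𝕏, ℝ) → ℝ} {c : ℝ}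
    (hX : IsQuasiSUR τ (varFun a) M ε X) (hε : Tendsto ε atTop (𝓝 0))
    (ha : Measurable a) (hc : ∀ f, |a f| ≤ c) :
    ∀ᵐ ω ∂P, Tendsto (fun n => maxGain τ (varFun a) (postLaw τ M X n ω)) atTop (𝓝 0) := by
  obtain ⟨hd, n₀, hn₀⟩ := hX
  have hall : ∀ᵐ ω ∂P, ∀ n ≥ n₀, expResidual τ (varFun a) (X n ω) (postLaw τ M X n ω) ≤
      (⨅ x, expResidual τ (varFun a) x (postLaw τ M X n ω)) + ENNReal.ofReal (ε n) :=
    ae_all_iff.2 fun n => by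
      by_cases h : n₀ ≤ n
      · filter_upwards [hn₀ n h] with ω hω _ using hω
      · exact ae_of_all _ fun ω h' => absurd h' h
  filter_upwards [hall, ae_tendsto_varFun_sub_expResidual hd ha hc] with ω h1 h2
  have h3 := h2.add (ENNReal.tendsto_ofReal hε)
  rw [ENNReal.ofReal_zero, add_zero] at h3
  refine tendsto_of_tendsto_of_tendsto_of_le_of_le' tendsto_const_nhds h3
    (Eventually.of_forall fun n => zero_le) ?_
  filter_upwards [eventually_ge_atTop n₀] with n hn
  refine iSup_le fun x => tsub_le_iff_right.2 ?_
  calc varFun a (postLaw τ M X n ω)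
      ≤ (varFun a (postLaw τ M X n ω) - expResidual τ (varFun a) (X n ω) (postLaw τ M X n ω)) +
        expResidual τ (varFun a) (X n ω) (postLaw τ M X n ω) := le_tsub_add
    _ ≤ (varFun a (postLaw τ M X n ω) - expResidual τ (varFun a) (X n ω) (postLaw τ M X n ω)) +
        (expResidual τ (varFun a) x (postLaw τ M X n ω) + ENNReal.ofReal (ε n)) := by
        gcongr
        exact (h1 n hn).trans (by gcongr; exact iInf_le _ x)
    _ = _ := by ring

/-- When the maximal gain tends to zero, the limiting conditional distribution leaves no
uncertainty on the excursion volume. -/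
theorem ae_varFun_eq_zero_of_tendsto_maxGain [Nonempty 𝕏] (μ : Measure 𝕏) [IsFiniteMeasure μ]
    (T : ℝ) {ξ : Ω → C(𝕏, ℝ)} {𝓕 : Filtration ℕ mΩ} {ν : ℕ → Ω → GaussMeas 𝕏}
    {νlim : Ω → GaussMeas 𝕏} (hν : ∀ n, IsRegCond P ξ (𝓕 n) (ν n))
    (hlim : IsRegCond P ξ (⨆ n, 𝓕 n) νlim) (hξ : Measurable ξ)
    (hgain : ∀ᵐ ω ∂P, Tendsto (fun n => maxGain τ (varFun (excursionVolume μ T)) (ν n ω)) atTop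
      (𝓝 0)) : ∀ᵐ ω ∂P, varFun (excursionVolume μ T) (νlim ω) = 0 := by
  have ha := measurable_excursionVolume μ T
  have hc := abs_excursionVolume_le μ T
  have hall : ∀ᵐ ω ∂P, ∀ (i : ℕ) (t φ : ℚ),
      Tendsto (fun n => covTrig (excursionVolume μ T) (ν n ω) (denseSeq 𝕏 i) t φ) atTop
        (𝓝 (covTrig (excursionVolume μ T) (νlim ω) (denseSeq 𝕏 i) t φ)) :=
    ae_all_iff.2 fun i => ae_all_iff.2 fun t => ae_all_iff.2 fun φ =>
      IsRegCond.tendsto_covTrig hν hlim hξ ha hc _ _ _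
  filter_upwards [hall, hgain] with ω h1 h2
  have h3 : ∀ i (t φ : ℚ), covTrig (excursionVolume μ T) (νlim ω) (denseSeq 𝕏 i) t φ = 0 := by
    intro i t φ
    have h4 := ENNReal.tendsto_ofReal
      (((h1 i t φ).mul_const (Real.exp (-((t * τ (denseSeq 𝕏 i)) ^ 2 / 2)))).pow 2)
    have h5 := le_of_tendsto_of_tendsto' h4 h2 fun n => sq_covTrig_le_gain ha hc τ (ν n ω) _ _ _
    have h6 := ENNReal.ofReal_eq_zero.1 (le_zero_iff.1 h5)
    have h7 := pow_eq_zero_iff (two_ne_zero) |>.1 (le_antisymm h6 (sq_nonneg _))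
    exact (mul_eq_zero.1 h7).resolve_right (Real.exp_pos _).ne'
  have h8 := variance_excursionVolume_eq_zero μ T (νlim ω)
    (covTrig_eq_zero_of_dense ha hc (νlim ω) h3)
  rw [varFun, h8, ENNReal.ofReal_zero]

end Convergence

end SUR

theorem mainTheorem7 {𝕏 : Type v} [MetricSpace 𝕏] [CompactSpace 𝕏] [Nonempty 𝕏]
    [MeasurableSpace 𝕏] [BorelSpace 𝕏] (τ : C(𝕏, ℝ≥0)) (μ : Measure 𝕏) [IsFiniteMeasure μ]
    (T : ℝ) :
    -- the loss is regular, and its uncertainty functional is the variance of the excursion volume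
    IsRegularLoss.{u} τ (volumeLoss μ T) ∧
    (∀ ν : GaussMeas 𝕏,
      uncertainty (volumeLoss μ T) ν = ENNReal.ofReal Var[excursionVolume μ T; ν.1]) ∧
    -- the functional is measurable and has the supermartingale property
    Measurable (uncertainty (volumeLoss μ T) : GaussMeas 𝕏 → ℝ≥0∞) ∧
    HasSupermartingaleProperty.{u} τ (fun ν => (uncertainty (volumeLoss μ T) ν).toReal) ∧
    (∃ L₀ H₁, IsUICDecomposition.{u} (uncertainty (volumeLoss μ T)) L₀ H₁ ∧
      HasSupermartingaleProperty.{u} τ H₁) ∧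
    ∀ (Ω : Type u) [MeasurableSpace Ω] (P : Measure Ω) [IsProbabilityMeasure P]
      (M : GPModel 𝕏 P),
      -- existence of quasi-SUR designs
      (∀ ε : ℕ → ℝ, (∀ n, 0 < ε n) →
        ∃ X : ℕ → Ω → 𝕏, IsQuasiSUR τ (uncertainty (volumeLoss μ T)) M ε X) ∧
      ∀ X : ℕ → Ω → 𝕏, IsDesign τ M X →
        -- the residual uncertainty is the conditional variance of the excursion volume
        (∀ n, (fun ω => (uncertainty (volumeLoss μ T) (postLaw τ M X n ω)).toReal)
          =ᵐ[P] Var[fun ω => excursionVolume μ T (M.ξ ω); P | obsSigma τ M X n]) ∧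
        -- convergence, with respect to the conditional distribution given all observations
        ∃ Plim : Ω → GaussMeas 𝕏,
          Measurable[⨆ n, obsSigma τ M X n] Plim ∧
          IsCondLaw P M.ξ (⨆ n, obsSigma τ M X n) Plim ∧
          (∀ᵐ ω ∂P, Tendsto (fun n => uncertainty (volumeLoss μ T) (postLaw τ M X n ω)) atTop
            (𝓝 (uncertainty (volumeLoss μ T) (Plim ω)))) ∧
          ∀ ε : ℕ → ℝ, (∀ n, 0 < ε n) → Tendsto ε atTop (𝓝 0) →
            IsQuasiSUR τ (uncertainty (volumeLoss μ T)) M ε X →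
            (∀ᵐ ω ∂P, Tendsto
              (fun n => maxGain τ (uncertainty (volumeLoss μ T)) (postLaw τ M X n ω)) atTop
              (𝓝 (maxGain τ (uncertainty (volumeLoss μ T)) (Plim ω)))) ∧
            (∀ᵐ ω ∂P, maxGain τ (uncertainty (volumeLoss μ T)) (Plim ω) = 0) ∧
            (∀ᵐ ω ∂P, Tendsto (fun n => uncertainty (volumeLoss μ T) (postLaw τ M X n ω))
              atTop (𝓝 0)) ∧
            (∀ᵐ ω ∂P, Tendsto (fun n =>
              Var[fun ω => excursionVolume μ T (M.ξ ω); P | obsSigma τ M X n] ω) atTop (𝓝 0)) := by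
  have ha := measurable_excursionVolume μ T
  have hc := abs_excursionVolume_le μ T
  have hH : uncertainty (volumeLoss μ T) = varFun (excursionVolume μ T) :=
    funext fun ν => uncertainty_sq ha hc ν
  have hsm : HasSupermartingaleProperty.{u} τ
      (fun ν => (uncertainty (volumeLoss μ T) ν).toReal) := by
    rw [hH]
    exact fun Ω _ P _ M X hX => supermartingale_varFun_postLaw hX ha hc
  have hdec := isUICDecomposition_varFun.{u} μ T
  refine ⟨⟨⟨0⟩, inferInstance, fun f d => sq_nonneg _, fun d => (ha.sub_const d).pow_const 2,
    fun ν d => ?_, fun ν => ?_, ⟨_, _, hH ▸ hdec⟩, ?_⟩, fun ν => uncertainty_sq ha hc ν, ?_, hsm,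
    ⟨_, _, hH ▸ hdec, fun Ω _ P _ M X hX => supermartingale_neg_sq_integral_postLaw hX ha hc⟩, ?_⟩
  · exact (avgLoss_sq ha hc ν d).trans_ne ENNReal.ofReal_ne_top
  · rw [show avgLoss (volumeLoss μ T) ν = _ from funext (avgLoss_sq ha hc ν)]
    exact ENNReal.continuous_ofReal.comp (by fun_prop)
  · rw [hH]
    exact Set.ext fun ν => varFun_eq_zero_iff μ T ν τ
  · rw [hH]
    exact measurable_varFun ha hc
  rw [hH]
  intro Ω _ P _ M
  refine ⟨fun ε hε => exists_isQuasiSUR ha hc τ M hε, fun X hX => ?_⟩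
  have hξ := M.measurable_path
  have hν : ∀ n, IsRegCond P M.ξ (obsFiltration hX n) (postLaw τ M X n) := isRegCond_postLaw hX
  have hvar : ∀ n, (fun ω => (varFun (excursionVolume μ T) (postLaw τ M X n ω)).toReal)
      =ᵐ[P] Var[fun ω => excursionVolume μ T (M.ξ ω); P | obsSigma τ M X n] := fun n => by
    simp only [toReal_varFun]
    exact (hν n).variance_ae_eq hξ ha hc
  obtain ⟨Plim, hlim⟩ := exists_isRegCond_iSup hν hξ M.law.2
  have hconv := IsRegCond.tendsto_varFun hν hlim hξ ha hc
  refine ⟨hvar, Plim, hlim.measurable, hlim.isCondLaw hξ, hconv, fun ε _ hε hsur => ?_⟩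
  have hgain := hsur.ae_tendsto_maxGain hε ha hc
  have hzero := ae_varFun_eq_zero_of_tendsto_maxGain μ T hν hlim hξ hgain
  have hgzero : ∀ᵐ ω ∂P, maxGain τ (varFun (excursionVolume μ T)) (Plim ω) = 0 :=
    hzero.mono fun ω h => (varFun_eq_zero_iff μ T _ τ).1 h
  have hto : ∀ᵐ ω ∂P, Tendsto (fun n => varFun (excursionVolume μ T) (postLaw τ M X n ω)) atTop
      (𝓝 0) := by
    filter_upwards [hconv, hzero] with ω h1 h2
    rwa [h2] at h1
  refine ⟨?_, hgzero, hto, ?_⟩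
  · filter_upwards [hgain, hgzero] with ω h1 h2
    rwa [h2]
  · filter_upwards [hto, ae_all_iff.2 hvar] with ω h1 h2
    exact ((ENNReal.tendsto_toReal ENNReal.zero_ne_top).comp h1).congr h2
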